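/- **Theorem 2.2.** Let $\epsilon,m>0$, let $L$ be a positive integer multiple of $\epsilon$, let $\Lambda=L\mathbb T^d\cap\epsilon\mathbb Z^d$ be the periodic lattice, let $(\Delta^\epsilon\varphi)_x=\epsilon^{-2}\sum_{y\sim x}(\varphi_y-\varphi_x)$ be the discrete Laplacian, and let $A=\epsilon^d(-\Delta^\epsilon+m)$. Let $\gamma$ be the Gaussian free field, i.e. the centred Gaussian measure on $\mathbb R^\Lambda$ with covariance $A^{-1}$. Let $V_0:\mathbb R^\Lambda\to\mathbb R$ be a $C^\infty$ function such that $\nu(d\varphi)=e^{-V_0(\varphi)}\gamma(d\varphi)$ is a probability measure. For $t\ge 0$ put $Q_t=e^{-tA/2}$, $C_t=\int_0^tQ_s^2\,ds$ and $V_t(\varphi)=-\log\mathbf E_{C_t}[e^{-V_0(\varphi+\zeta)}]$, where $\zeta$ is a centred Gaussian vector with covariance $C_t$. Suppose that $\nu$ satisfies the multiscale Bakry–Émery criterion: there are real numbers $\dot\lambda_t$ with $$Q_t\nabla^2V_t(\varphi)Q_t\succeq\dot\lambda_t\operatorname{Id}\qquad\text{for all }t\ge0,\ \varphi\in\mathbb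 R^\Lambda,$$ where $t\mapsto\dot\lambda_t$ is integrable on bounded intervals, and set $\lambda_t=\int_0^t\dot\lambda_s\,ds$. Let $(U_t)_{t\ge0}$ be the Ornstein–Uhlenbeck semigroup of the dynamics $d\Phi_t=-A\Phi_t\,dt+\sqrt2\,dB_t$, let $p_t$ be the law of $\Phi_t$ when $\Phi_0\sim\nu$, and let $u_t=\log U_te^{-V_0}$. Then the equation $\partial_tS_t(\varphi)=-\nabla u_t(S_t(\varphi))$, $S_0=\operatorname{Id}$, has a unique solution $(S_t)_{t\ge0}$, each $S_t$ is a $C^1$-diffeomorphism of $\mathbb R^\Lambda$, and for every $t\ge0$ the Langevin (Ornstein–Uhlenbeck) transport map $T_t=S_t^{-1}$ pushes forward $p_t$ to $\nu$ and is $e^{-\lambda_{2t}/2}$-Lipschitz for the Euclidean norm. If moreover $\dot\lambda$ is integrable on $(0,\infty)$, with $\lambda_\infty=\int_0^\infty\dot\lambda_s\,ds$, then the pointwise limit $T=\lim_{t\to\infty}T_t$ exists, pushes forward $\gamma$ to $\nu$, and is $e^{-\lambda_\infty/2}$-Lipschitz. -/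

import Mathlib

open MeasureTheory ProbabilityTheory Filter Topology Matrix
open scoped ContDiff

noncomputable section

namespace LangevinTransport

/-! ### The lattice and the Gaussian free field -/

/-- The periodic lattice `L𝕋^d ∩ εℤ^d` with `L = N ε`: the point `ε x` is recorded by its integer
coordinates `x`, taken modulo `N`. -/
abbrev TorusLattice (d N : ℕ) : Type := Fin d → ZMod N

/-- Nearest neighbours on the periodic lattice. -/
def neighbourGraph (d N : ℕ) : SimpleGraph (TorusLattice d N) where
  Adj x y := x ≠ y ∧ ∃ i, y = x + Pi.single i 1 ∨ x = y + Pi.single i 1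
  symm := ⟨fun _ _ h => ⟨h.1.symm, h.2.imp fun _ hi => hi.symm⟩⟩
  loopless := ⟨fun _ h => h.1 rfl⟩

open scoped Classical in
/-- The discrete Laplacian `(Δ^ε φ)_x = ε⁻² ∑_{y ∼ x} (φ_y - φ_x)`, as a matrix. -/
def discreteLaplacian (d N : ℕ) [NeZero N] (ε : ℝ) : Matrix (TorusLattice d N) (TorusLattice d N) ℝ :=
  -((ε ^ 2)⁻¹ • (neighbourGraph d N).lapMatrix ℝ)

/-- The inverse covariance `A_ε = ε^d (-Δ^ε + m)` of the Gaussian free field of mass `m`. -/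
def freeFieldMatrix (d N : ℕ) [NeZero N] (ε m : ℝ) : Matrix (TorusLattice d N) (TorusLattice d N) ℝ :=
  ε ^ d • (-discreteLaplacian d N ε + m • (1 : Matrix (TorusLattice d N) (TorusLattice d N) ℝ))

variable {ι : Type*} [Fintype ι] [DecidableEq ι]

/-- The centred Gaussian measure with covariance `A⁻¹`, for positive definite `A`. -/
def freeField (A : Matrix ι ι ℝ) : Measure (EuclideanSpace ℝ ι) :=
  multivariateGaussian 0 A⁻¹

/-- The model `ν(dφ) = e^{-V₀(φ)} γ(dφ)`. -/
def model (A : Matrix ι ι ℝ) (V₀ : EuclideanSpace ℝ ι → ℝ) : Measure (EuclideanSpace ℝ ι) :=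
  (freeField A).withDensity fun φ => ENNReal.ofReal (Real.exp (-V₀ φ))

/-! ### The renormalized potential and the multiscale Bakry–Émery criterion -/

/-- `Q_t = e^{-tA/2}`. -/
def Q (A : Matrix ι ι ℝ) (t : ℝ) : Matrix ι ι ℝ := NormedSpace.exp (-(t / 2) • A)

/-- `C_t = ∫₀ᵗ Q_s² ds`, an entrywise integral. -/
def C (A : Matrix ι ι ℝ) (t : ℝ) : Matrix ι ι ℝ :=
  Matrix.of fun i j => ∫ s in (0 : ℝ)..t, (Q A s * Q A s) i j

/-- The renormalized potential `V_t(φ) = -log 𝐄_{C_t}[e^{-V₀(φ+ζ)}]`, where `ζ` is a centred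
Gaussian vector with covariance `C_t` (so `ζ = 0` for `t = 0`). -/
def renormalizedPotential (A : Matrix ι ι ℝ) (V₀ : EuclideanSpace ℝ ι → ℝ) (t : ℝ)
    (φ : EuclideanSpace ℝ ι) : ℝ :=
  -Real.log (∫ ζ, Real.exp (-V₀ (φ + ζ)) ∂multivariateGaussian 0 (C A t))

/-- The Hessian matrix of a function at a point. -/
def hessian (f : EuclideanSpace ℝ ι → ℝ) (φ : EuclideanSpace ℝ ι) : Matrix ι ι ℝ :=
  Matrix.of fun i j =>
    iteratedFDeriv ℝ 2 f φ ![EuclideanSpace.single i 1, EuclideanSpace.single j 1]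

/-- The multiscale Bakry–Émery criterion with the numbers `lam t` (written `λ̇_t` on paper):
`Q_t ∇²V_t(φ) Q_t ⪰ λ̇_t Id` for all `t ≥ 0` and all `φ`. -/
def MultiscaleBakryEmery (A : Matrix ι ι ℝ) (V₀ : EuclideanSpace ℝ ι → ℝ) (lam : ℝ → ℝ) : Prop :=
  ∀ t : ℝ, 0 ≤ t → ∀ φ : EuclideanSpace ℝ ι,
    (Q A t * hessian (renormalizedPotential A V₀ t) φ * Q A t
      - lam t • (1 : Matrix ι ι ℝ)).PosSemidef

/-! ### The Ornstein–Uhlenbeck (Langevin) dynamics `dΦ_t = -A Φ_t dt + √2 dB_t` -/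

/-- The covariance `2 ∫₀ᵗ e^{-2sA} ds` of the noise `√2 ∫₀ᵗ e^{-(t-s)A} dB_s`. -/
def ouCovariance (A : Matrix ι ι ℝ) (t : ℝ) : Matrix ι ι ℝ :=
  Matrix.of fun i j => ∫ s in (0 : ℝ)..t, 2 * NormedSpace.exp (-(2 * s) • A) i j

/-- The law at time `t` of the Ornstein–Uhlenbeck process with initial law `μ`, that is, of
`Φ_t = e^{-tA} Φ_0 + √2 ∫₀ᵗ e^{-(t-s)A} dB_s` with `Φ_0 ∼ μ` independent of `B`. -/
def ouLaw (A : Matrix ι ι ℝ) (t : ℝ) (μ : Measure (EuclideanSpace ℝ ι)) :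
    Measure (EuclideanSpace ℝ ι) :=
  (μ.map (Matrix.toEuclideanCLM (𝕜 := ℝ) (NormedSpace.exp (-t • A)))) ∗
    multivariateGaussian 0 (ouCovariance A t)

/-- The Ornstein–Uhlenbeck semigroup `U_t F(φ) = 𝐄[F(Φ_t) | Φ_0 = φ]`. -/
def ouSemigroup (A : Matrix ι ι ℝ) (t : ℝ) (F : EuclideanSpace ℝ ι → ℝ)
    (φ : EuclideanSpace ℝ ι) : ℝ :=
  ∫ ψ, F ψ ∂ouLaw A t (Measure.dirac φ)

/-- `u_t = log U_t e^{-V₀}`. -/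
def drivingPotential (A : Matrix ι ι ℝ) (V₀ : EuclideanSpace ℝ ι → ℝ) (t : ℝ)
    (φ : EuclideanSpace ℝ ι) : ℝ :=
  Real.log (ouSemigroup A t (fun ψ => Real.exp (-V₀ ψ)) φ)

/-- `(S_t)_{t ≥ 0}` solves `∂_t S_t(φ) = -∇u_t(S_t(φ))`, `S_0 = Id` (the derivative at `t = 0` is
one-sided). Values of `S` at negative times are irrelevant. -/
structure IsLangevinFlow (A : Matrix ι ι ℝ) (V₀ : EuclideanSpace ℝ ι → ℝ)
    (S : ℝ → EuclideanSpace ℝ ι → EuclideanSpace ℝ ι) : Prop where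
  initial : ∀ φ, S 0 φ = φ
  hasDeriv : ∀ φ, ∀ t : ℝ, 0 ≤ t →
    HasDerivWithinAt (fun s => S s φ) (-gradient (drivingPotential A V₀ t) (S t φ)) (Set.Ici 0) t

end LangevinTransport

end

open LangevinTransport

/-! The key identity is that the criterion at scale `2t` is a convexity statement about `u_t`. Since
`Q_{2t} = e^{-tA}` and `C_{2t}` is the covariance of the Ornstein–Uhlenbeck noise at time `t`, one
has `u_t = -V_{2t} ∘ e^{-tA}` (`renormalizedPotential_two_mul`). By the chain rule the velocity `v_t
= -∇u_t` satisfies `Dv_t = Q_{2t} ∇²V_{2t} Q_{2t} ⪰ λ̇_{2t}`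
(`velDeriv_ge_of_multiscaleBakryEmery`). Hence `log ‖S_t x - S_t y‖` grows at rate at least
`λ̇_{2t}`, and `∫₀ᵗ λ̇_{2s} ds = λ_{2t}/2` gives the Lipschitz constant of the inverse
(`IsFlow.norm_sub_ge`). Expansion makes the image of `S_t` closed and a nonvanishing Jacobian makes
it open, so `S_t` is a diffeomorphism (`exists_inverse_of_expanding`).

The push-forward is conservation of mass. With `U = U_t e^{-V₀}` and `g` the Gaussian density,
`U(S_t x) g(S_t x) det DS_t(x)` is constant in `t`, by Liouville's formula and the backward equation
`∂_t U = ΔU - ⟨Ax, ∇U⟩` (`density_mul_det_eq`). This also shows that the determinant is positive.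

The analytic work is to show that `v` generates a global `C¹` flow although `V₀` is only smooth,
with no growth condition. For `t > 0`, `U` is the integral of Mehler's kernel against `ν`. The
kernel and its derivatives are bounded in the integration variable, so finiteness of `ν` suffices
for differentiation. Near `t = 0` the function `e^{-V₀}` is split into a compactly supported part,
whose derivatives pass inside the semigroup, and a part vanishing near the point, which the
off-diagonal decay of the kernel kills (`continuousWithinAt_semi_zero`). Jensen's inequality makes
`log U` semiconvex, and with quadratic two-sided bounds this yields linear growth of `v` away from
time `0` (`exists_norm_mehlerIntGrad_le`). Local boundedness covers the short initial interval.

For the limit, an integrable `λ̇` cannot stay below minus the smallest eigenvalue of `A`. At one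
good time the semiconcavity of `log U` then gives the evolved law a first moment, and this passes
back to `ν` (`integrable_norm_of_velDeriv_ge`). A first moment makes `v_t` decay exponentially on
bounded sets, so `T_t` converges pointwise. Fatou's lemma passes to the limit in the push-forward
(`map_eq_of_tendsto_density`). -/

namespace LangevinTransport

/-! ### Global existence for ordinary differential equations -/

section ODE

open Set Metric
open scoped NNReal

variable {F : Type*} [NormedAddCommGroup F] [NormedSpace ℝ F]

/-- Global solutions exist for a field which is locally Lipschitz, bounded near the initial point
for a short time, and of linear growth afterwards. -/
theorem exists_solution_of_linear_growth [CompleteSpace F] {f : ℝ → F → F} {T : ℝ}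
    (hLip : ∀ R : ℝ, ∃ K : ℝ≥0, ∀ t ∈ Icc 0 T, LipschitzOnWith K (f t) (closedBall 0 R))
    (hcont : ∀ x, ContinuousOn (f · x) (Icc 0 T))
    {r δ L C : ℝ} (hr : 0 ≤ r) (hδ0 : 0 ≤ δ) (hδT : δ ≤ T) (hL0 : 0 ≤ L)
    (hL : ∀ t ∈ Icc 0 δ, ∀ x, ‖x‖ ≤ r + 1 → ‖f t x‖ ≤ L) (hLδ : (L + 1) * δ ≤ 1) (hC0 : 0 ≤ C)
    (hC : ∀ t ∈ Icc δ T, ∀ x, ‖f t x‖ ≤ C * (1 + ‖x‖)) :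
    ∃ R : ℝ, ∀ x₀ : F, ‖x₀‖ ≤ r → ∃ α : ℝ → F, α 0 = x₀ ∧
      ∀ t ∈ Icc 0 T, HasDerivWithinAt α (f t (α t)) (Icc 0 T) t ∧ ‖α t‖ ≤ R := by
  have hT : 0 ≤ T := hδ0.trans hδT
  set R : ℝ := max (r + 1) (gronwallBound (r + 1) C C (T - δ)) with hR
  have hR0 : 0 ≤ R := le_trans (by linarith) (le_max_left _ _)
  refine ⟨R, fun x₀ hx₀ => ?_⟩
  -- Picard–Lindelöf on the whole of `[0, T]` needs a bounded field, so the field is cut off outside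
  -- the ball of radius `R`. The a priori bounds below also hold for the cut-off field and show that
  -- its solution never reaches the region where `χ ≠ 1`.
  set χ : F → ℝ := fun x => max 0 (min 1 (R + 1 - ‖x‖)) with hχ
  have hχ0 : ∀ x, 0 ≤ χ x := fun x => le_max_left _ _
  have hχ1 : ∀ x, χ x ≤ 1 := fun x => max_le zero_le_one (min_le_left _ _)
  have hχR : ∀ x, ‖x‖ ≤ R → χ x = 1 := fun x hx => by
    simp only [hχ]; rw [min_eq_left (by linarith), max_eq_right zero_le_one]
  have hχout : ∀ x, R + 1 ≤ ‖x‖ → χ x = 0 := fun x hx => by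
    simp only [hχ]; rw [max_eq_left]; exact (min_le_right _ _).trans (by linarith)
  have hχL : ∀ x y, |χ x - χ y| ≤ ‖x - y‖ := fun x y => by
    have h1 := abs_norm_sub_norm_le x y
    simp only [hχ]
    rw [abs_le] at *
    simp only [max_def, min_def]
    constructor <;> split_ifs <;> linarith
  obtain ⟨K₁, hK₁⟩ := hLip (R + 1)
  obtain ⟨M₀, hM₀⟩ : ∃ M₀, ∀ t ∈ Icc 0 T, ‖f t 0‖ ≤ M₀ :=
    (isCompact_Icc).exists_bound_of_continuousOn (hcont 0)
  have hM00 : 0 ≤ M₀ := (norm_nonneg _).trans (hM₀ 0 ⟨le_rfl, hT⟩)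
  set M : ℝ := M₀ + K₁ * (R + 1) with hM
  have hMb : ∀ t ∈ Icc 0 T, ∀ x, ‖x‖ ≤ R + 1 → ‖f t x‖ ≤ M := fun t ht x hx => by
    have h := (hK₁ t ht).dist_le_mul x (by simpa using hx) 0 (by simp; linarith)
    rw [dist_eq_norm, dist_zero_right] at h
    have h2 : ‖f t x‖ ≤ ‖f t 0‖ + ‖f t x - f t 0‖ := by
      simpa using norm_add_le (f t 0) (f t x - f t 0)
    have h3 : (K₁ : ℝ) * ‖x‖ ≤ K₁ * (R + 1) := by gcongr
    have := hM₀ t ht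
    linarith
  have hM0 : 0 ≤ M := by positivity
  have hgb : ∀ t ∈ Icc 0 T, ∀ x, ‖χ x • f t x‖ ≤ M := fun t ht x => by
    rw [norm_smul, Real.norm_of_nonneg (hχ0 x)]
    rcases le_total ‖x‖ (R + 1) with h | h
    · exact (mul_le_mul (hχ1 x) (hMb t ht x h) (norm_nonneg _) zero_le_one).trans (by simp)
    · simp [hχout x h, hM0]
  set a : ℝ := M * T + ‖x₀‖ with ha
  have ha0 : 0 ≤ a := by positivity
  obtain ⟨K₂, hK₂⟩ := hLip (‖x₀‖ + a)
  obtain ⟨M₂, hM₂⟩ : ∃ M₂ : ℝ≥0, ∀ t ∈ Icc 0 T, ∀ x, ‖x‖ ≤ ‖x₀‖ + a → ‖f t x‖ ≤ M₂ := by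
    refine ⟨⟨M₀ + K₂ * (‖x₀‖ + a), by positivity⟩, fun t ht x hx => ?_⟩
    have h := (hK₂ t ht).dist_le_mul x (by simpa using hx) 0 (by simp; positivity)
    rw [dist_eq_norm, dist_zero_right] at h
    have h2 : ‖f t x‖ ≤ ‖f t 0‖ + ‖f t x - f t 0‖ := by
      simpa using norm_add_le (f t 0) (f t x - f t 0)
    have h3 : (K₂ : ℝ) * ‖x‖ ≤ K₂ * (‖x₀‖ + a) := by gcongr
    have := hM₀ t ht
    change _ ≤ M₀ + K₂ * (‖x₀‖ + a)
    linarith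
  have hPL : IsPicardLindelof (fun t x => χ x • f t x) (⟨0, le_rfl, hT⟩ : Icc 0 T) x₀
      ⟨a, ha0⟩ 0 ⟨M, hM0⟩ (K₂ + M₂) := by
    refine ⟨fun t ht => ?_, fun x _ => (hcont x).const_smul _, fun t ht x _ => hgb t ht x, ?_⟩
    · refine LipschitzOnWith.of_dist_le_mul fun x hx y hy => ?_
      have hb : ∀ z ∈ closedBall x₀ ((⟨a, ha0⟩ : ℝ≥0) : ℝ), ‖z‖ ≤ ‖x₀‖ + a := fun z hz => by
        have h1 : ‖z - x₀‖ ≤ a := by simpa [dist_eq_norm] using hz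
        have := norm_add_le x₀ (z - x₀)
        rw [add_sub_cancel] at this
        linarith
      have h := (hK₂ t ht).dist_le_mul x (by simpa using hb x hx) y (by simpa using hb y hy)
      have h' := hM₂ t ht y (hb y hy)
      rw [dist_eq_norm, dist_eq_norm] at *
      have : χ x • f t x - χ y • f t y = χ x • (f t x - f t y) + (χ x - χ y) • f t y := by
        rw [smul_sub, sub_smul]; abel
      rw [this]
      refine (norm_add_le _ _).trans ?_
      rw [norm_smul, norm_smul, Real.norm_of_nonneg (hχ0 x), Real.norm_eq_abs]
      have e1 : χ x * ‖f t x - f t y‖ ≤ 1 * (K₂ * ‖x - y‖) :=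
        mul_le_mul (hχ1 x) h (norm_nonneg _) zero_le_one
      have e2 : |χ x - χ y| * ‖f t y‖ ≤ ‖x - y‖ * M₂ :=
        mul_le_mul (hχL x y) h' (norm_nonneg _) (norm_nonneg _)
      push_cast
      linarith
    · change M * max (T - 0) (0 - 0) ≤ a - 0
      rw [sub_zero, sub_zero, max_eq_left hT, sub_zero]
      simp [ha]
  obtain ⟨α, hα0, hα⟩ := hPL.exists_eq_forall_mem_Icc_hasDerivWithinAt₀
  simp only at hα0
  have hαc : ContinuousOn α (Icc 0 T) := fun t ht => (hα t ht).continuousWithinAt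
  have hαr : ∀ t ∈ Ico 0 T, HasDerivWithinAt α (χ (α t) • f t (α t)) (Ici t) t := fun t ht =>
    (hα t ⟨ht.1, ht.2.le⟩).mono_of_mem_nhdsWithin
      (mem_of_superset (Icc_mem_nhdsGE_of_mem ht) (Icc_subset_Icc_left le_rfl))
  have hsm : ∀ t ∈ Icc 0 T, ‖χ (α t) • f t (α t)‖ ≤ ‖f t (α t)‖ := fun t _ => by
    rw [norm_smul, Real.norm_of_nonneg (hχ0 _)]
    exact mul_le_of_le_one_left (norm_nonneg _) (hχ1 _)
  -- The barrier `r + (L + 1) t` has slope strictly above the speed bound `L`, as the comparison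
  -- lemma requires, and `hLδ` keeps it below `r + 1`, where that speed bound is valid.
  have hphase1 : ∀ t ∈ Icc 0 δ, ‖α t‖ ≤ r + 1 := by
    have key : ∀ ⦃t⦄, t ∈ Icc 0 δ → ‖α t‖ ≤ r + (L + 1) * t := by
      refine image_norm_le_of_norm_deriv_right_lt_deriv_boundary
        (f' := fun t => χ (α t) • f t (α t)) (B' := fun _ => L + 1)
        (hαc.mono (Icc_subset_Icc_right hδT))
        (fun t ht => hαr t ⟨ht.1, ht.2.trans_le hδT⟩) (by simpa [hα0] using hx₀)
        (fun t => by simpa using ((hasDerivAt_id t).const_mul (L + 1)).const_add r) ?_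
      intro t ht hEq
      refine lt_of_le_of_lt ((hsm t ⟨ht.1, (ht.2.le.trans hδT)⟩).trans
        (hL t ⟨ht.1, ht.2.le⟩ _ ?_)) (by linarith)
      rw [hEq]
      have : (L + 1) * t ≤ (L + 1) * δ := by gcongr; exact ht.2.le
      linarith
    intro t ht
    have : (L + 1) * t ≤ (L + 1) * δ := by gcongr; exact ht.2
    linarith [key ht]
  have hphase2 : ∀ t ∈ Icc δ T, ‖α t‖ ≤ gronwallBound (r + 1) C C (t - δ) := by
    refine norm_le_gronwallBound_of_norm_deriv_right_le
      (f' := fun t => χ (α t) • f t (α t)) (hαc.mono (Icc_subset_Icc_left hδ0))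
      (fun t ht => hαr t ⟨hδ0.trans ht.1, ht.2⟩) (hphase1 δ ⟨hδ0, le_rfl⟩) fun t ht => ?_
    refine ((hsm t ⟨hδ0.trans ht.1, ht.2.le⟩).trans (hC t ⟨ht.1, ht.2.le⟩ _)).trans (by linarith)
  have hbd : ∀ t ∈ Icc 0 T, ‖α t‖ ≤ R := fun t ht => by
    rcases le_total t δ with h | h
    · exact (hphase1 t ⟨ht.1, h⟩).trans (le_max_left _ _)
    · exact ((hphase2 t ⟨h, ht.2⟩).trans
        (gronwallBound_mono (by linarith) hC0 hC0 (by linarith [ht.2]))).trans (le_max_right _ _)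
  refine ⟨α, hα0, fun t ht => ⟨?_, hbd t ht⟩⟩
  have := hα t ht
  simpa [hχR _ (hbd t ht)] using this

end ODE

/-! ### Flows of time-dependent fields: existence, uniqueness, local bounds -/

section Flow

open Set Metric
open scoped NNReal

variable {F : Type*} [NormedAddCommGroup F] [NormedSpace ℝ F]

/-- A time-dependent vector field on `[0, ∞)`, of class `C¹` in space, jointly continuous with its
derivative, and of linear growth away from time `0`. -/
structure RegularField (v : ℝ → F → F) (Dv : ℝ → F → F →L[ℝ] F) : Prop where
  continuousOn : ContinuousOn (fun p : ℝ × F => v p.1 p.2) (Ici 0 ×ˢ univ)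
  hasFDerivAt : ∀ t, 0 ≤ t → ∀ x, HasFDerivAt (v t) (Dv t x) x
  continuousOn_deriv : ContinuousOn (fun p : ℝ × F => Dv p.1 p.2) (Ici 0 ×ˢ univ)
  growth : ∀ δ T : ℝ, 0 < δ → ∃ C, 0 ≤ C ∧ ∀ t ∈ Icc δ T, ∀ x, ‖v t x‖ ≤ C * (1 + ‖x‖)

/-- `S` is a flow of `v` for nonnegative times. -/
structure IsFlow (v : ℝ → F → F) (S : ℝ → F → F) : Prop where
  initial : ∀ x, S 0 x = x
  hasDeriv : ∀ x, ∀ t, 0 ≤ t → HasDerivWithinAt (fun s => S s x) (v t (S t x)) (Ici 0) t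

omit [NormedSpace ℝ F] in
theorem continuousOn_comp_path {G : Type*} [TopologicalSpace G] {w : ℝ → F → G}
    (hw : ContinuousOn (fun p : ℝ × F => w p.1 p.2) (Ici 0 ×ˢ univ)) {x : ℝ → F} {s : Set ℝ}
    (hs : s ⊆ Ici 0) (hx : ContinuousOn x s) : ContinuousOn (fun t => w t (x t)) s :=
  hw.comp (f := fun t => (t, x t)) (continuousOn_id.prodMk hx) fun _ ht => ⟨hs ht, mem_univ _⟩

omit [NormedSpace ℝ F] in
theorem exists_bound_on_ball [ProperSpace F] {G : Type*} [NormedAddCommGroup G] {w : ℝ → F → G}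
    (hw : ContinuousOn (fun p : ℝ × F => w p.1 p.2) (Ici 0 ×ˢ univ)) (T R : ℝ) :
    ∃ C, 0 ≤ C ∧ ∀ t ∈ Icc 0 T, ∀ x, ‖x‖ ≤ R → ‖w t x‖ ≤ C := by
  obtain ⟨C, hC⟩ := ((isCompact_Icc (a := (0 : ℝ)) (b := T)).prod
    (isCompact_closedBall (0 : F) R)).exists_bound_of_continuousOn
    (hw.mono (prod_mono Icc_subset_Ici_self (subset_univ _)))
  exact ⟨max C 0, le_max_right _ _, fun t ht x hx =>
    (hC (t, x) ⟨ht, by simpa using hx⟩).trans (le_max_left _ _)⟩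

namespace RegularField

variable {v : ℝ → F → F} {Dv : ℝ → F → F →L[ℝ] F} (hv : RegularField v Dv)
include hv

theorem lipschitzOnWith [ProperSpace F] (T R : ℝ) :
    ∃ K : ℝ≥0, (∀ t ∈ Icc 0 T, LipschitzOnWith K (v t) (closedBall 0 R)) ∧
      ∀ t ∈ Icc 0 T, ∀ x, ‖x‖ ≤ R → ‖Dv t x‖ ≤ K := by
  obtain ⟨C, hC0, hC⟩ := exists_bound_on_ball hv.continuousOn_deriv T R
  refine ⟨⟨C, hC0⟩, fun t ht => ?_, hC⟩
  refine (convex_closedBall (0 : F) R).lipschitzOnWith_of_nnnorm_hasFDerivWithin_le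
    (fun x _ => (hv.hasFDerivAt t ht.1 x).hasFDerivWithinAt) fun x hx => ?_
  exact hC t ht x (by simpa using hx)

/-- Linear growth is only available from a positive time on; before that, local boundedness confines
the solution because the time is short. The bound `R` is common to all starting points in a ball,
which later makes the flow locally bounded and locally Lipschitz. -/
theorem exists_solution_Icc [ProperSpace F] {r T : ℝ} (hr : 0 ≤ r) (hT : 0 ≤ T) :
    ∃ R : ℝ, ∀ x₀ : F, ‖x₀‖ ≤ r → ∃ α : ℝ → F, α 0 = x₀ ∧
      ∀ t ∈ Icc 0 T, HasDerivWithinAt α (v t (α t)) (Icc 0 T) t ∧ ‖α t‖ ≤ R := by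
  rcases hT.eq_or_lt with rfl | hT
  · refine ⟨r, fun x₀ hx₀ => ⟨fun _ => x₀, rfl, fun t ht => ⟨?_, hx₀⟩⟩⟩
    rw [Icc_self]
    have : t = 0 := by simpa using ht
    subst this
    exact HasFDerivWithinAt.of_subsingleton subsingleton_singleton
  obtain ⟨L, hL0, hL⟩ := exists_bound_on_ball hv.continuousOn T (r + 1)
  -- Moving at speed below `L + 1`, a trajectory travels at most distance `1` before time `δ`.
  set δ : ℝ := min T (1 / (L + 1)) with hδ
  have hδ0 : 0 < δ := lt_min hT (by positivity)
  obtain ⟨C, hC0, hC⟩ := hv.growth δ T hδ0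
  refine exists_solution_of_linear_growth (fun R => ?_) (fun x => ?_) hr hδ0.le (min_le_left _ _)
    hL0 (fun t ht => hL t ⟨ht.1, ht.2.trans (min_le_left _ _)⟩) ?_ hC0 hC
  · exact (hv.lipschitzOnWith T R).imp fun K hK => hK.1
  · exact continuousOn_comp_path hv.continuousOn Icc_subset_Ici_self continuousOn_const
  · calc (L + 1) * δ ≤ (L + 1) * (1 / (L + 1)) := by gcongr; exact min_le_right _ _
      _ = 1 := by field_simp

theorem exists_bound_of_solution [ProperSpace F] {T : ℝ} {α β : ℝ → F}
    (hα : ContinuousOn α (Icc 0 T)) (hβ : ContinuousOn β (Icc 0 T)) :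
    ∃ R, ∃ K : ℝ≥0, (∀ t ∈ Icc 0 T, LipschitzOnWith K (v t) (closedBall 0 R)) ∧
      ∀ t ∈ Icc 0 T, α t ∈ closedBall 0 R ∧ β t ∈ closedBall 0 R := by
  obtain ⟨R₁, h₁⟩ := isCompact_Icc.exists_bound_of_continuousOn hα
  obtain ⟨R₂, h₂⟩ := isCompact_Icc.exists_bound_of_continuousOn hβ
  obtain ⟨K, hK, -⟩ := hv.lipschitzOnWith T (max R₁ R₂)
  exact ⟨_, K, hK, fun t ht => ⟨by simpa using Or.inl (h₁ t ht), by simpa using Or.inr (h₂ t ht)⟩⟩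

theorem solution_unique [ProperSpace F] {T : ℝ} {α β : ℝ → F}
    (hα : ∀ t ∈ Icc 0 T, HasDerivWithinAt α (v t (α t)) (Icc 0 T) t)
    (hβ : ∀ t ∈ Icc 0 T, HasDerivWithinAt β (v t (β t)) (Icc 0 T) t) (h0 : α 0 = β 0) :
    EqOn α β (Icc 0 T) := by
  have hαc : ContinuousOn α (Icc 0 T) := fun t ht => (hα t ht).continuousWithinAt
  have hβc : ContinuousOn β (Icc 0 T) := fun t ht => (hβ t ht).continuousWithinAt
  obtain ⟨R, K, hK, hR⟩ := hv.exists_bound_of_solution hαc hβc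
  have hn : ∀ t ∈ Ico 0 T, Icc 0 T ∈ 𝓝[Ici t] t := fun t ht =>
    mem_of_superset (Icc_mem_nhdsGE_of_mem ht) (Icc_subset_Icc_left le_rfl)
  exact ODE_solution_unique_of_mem_Icc_right (s := fun _ => closedBall 0 R)
    (fun t ht => hK t (Ico_subset_Icc_self ht)) hαc
    (fun t ht => (hα t (Ico_subset_Icc_self ht)).mono_of_mem_nhdsWithin (hn t ht))
    (fun t ht => (hR t (Ico_subset_Icc_self ht)).1) hβc
    (fun t ht => (hβ t (Ico_subset_Icc_self ht)).mono_of_mem_nhdsWithin (hn t ht))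
    (fun t ht => (hR t (Ico_subset_Icc_self ht)).2) h0

/-- Uniqueness backwards in time is what makes the flow maps injective. -/
theorem solution_unique_left [ProperSpace F] {T : ℝ} {α β : ℝ → F}
    (hα : ∀ t ∈ Icc 0 T, HasDerivWithinAt α (v t (α t)) (Icc 0 T) t)
    (hβ : ∀ t ∈ Icc 0 T, HasDerivWithinAt β (v t (β t)) (Icc 0 T) t) (hT : α T = β T) :
    EqOn α β (Icc 0 T) := by
  have hαc : ContinuousOn α (Icc 0 T) := fun t ht => (hα t ht).continuousWithinAt
  have hβc : ContinuousOn β (Icc 0 T) := fun t ht => (hβ t ht).continuousWithinAt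
  obtain ⟨R, K, hK, hR⟩ := hv.exists_bound_of_solution hαc hβc
  have hn : ∀ t ∈ Ioc 0 T, Icc 0 T ∈ 𝓝[Iic t] t := fun t ht =>
    mem_of_superset (Icc_mem_nhdsLE_of_mem ht) (Icc_subset_Icc_right le_rfl)
  exact ODE_solution_unique_of_mem_Icc_left (s := fun _ => closedBall 0 R)
    (fun t ht => hK t (Ioc_subset_Icc_self ht)) hαc
    (fun t ht => (hα t (Ioc_subset_Icc_self ht)).mono_of_mem_nhdsWithin (hn t ht))
    (fun t ht => (hR t (Ioc_subset_Icc_self ht)).1) hβc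
    (fun t ht => (hβ t (Ioc_subset_Icc_self ht)).mono_of_mem_nhdsWithin (hn t ht))
    (fun t ht => (hR t (Ioc_subset_Icc_self ht)).2) hT

theorem exists_isFlow [ProperSpace F] : ∃ S, IsFlow v S := by
  have h : ∀ (x : F) (n : ℕ), ∃ α : ℝ → F, α 0 = x ∧
      ∀ t ∈ Icc (0 : ℝ) n, HasDerivWithinAt α (v t (α t)) (Icc 0 n) t := fun x n => by
    obtain ⟨R, hR⟩ := hv.exists_solution_Icc (norm_nonneg x) (Nat.cast_nonneg n)
    obtain ⟨α, h0, h1⟩ := hR x le_rfl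
    exact ⟨α, h0, fun t ht => (h1 t ht).1⟩
  choose α hα0 hα using h
  have hmono : ∀ x (m n : ℕ), m ≤ n → EqOn (α x m) (α x n) (Icc 0 m) := fun x m n hmn => by
    have hsub : Icc (0 : ℝ) m ⊆ Icc 0 n := Icc_subset_Icc_right (by exact_mod_cast hmn)
    exact hv.solution_unique (hα x m) (fun t ht => (hα x n t (hsub ht)).mono hsub)
      (by rw [hα0, hα0])
  have hS : ∀ x (n : ℕ) (t : ℝ), t ∈ Icc (0 : ℝ) n → α x ⌈t⌉₊ t = α x n t := fun x n t ht =>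
    hmono x _ _ (Nat.ceil_le.2 ht.2) ⟨ht.1, Nat.le_ceil t⟩
  refine ⟨fun t x => α x ⌈t⌉₊ t, fun x => by simp [hα0], fun x t ht => ?_⟩
  -- The extra `1` makes `t < n` strict, so that `[0, n]` is a neighbourhood of `t` within `[0, ∞)`
  -- and a derivative within it is a derivative within `[0, ∞)`.
  set n : ℕ := ⌈t⌉₊ + 1 with hn
  have htn : t < n := (Nat.le_ceil t).trans_lt (by simp [hn])
  have h1 := hα x n t ⟨ht, htn.le⟩
  have h2 : Icc (0 : ℝ) n ∈ 𝓝[Ici 0] t := by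
    rw [← Ici_inter_Iic]
    exact inter_mem self_mem_nhdsWithin (mem_nhdsWithin_of_mem_nhds (Iic_mem_nhds htn))
  rw [hS x n t ⟨ht, htn.le⟩]
  exact (h1.congr (fun s hs => hS x n s hs) (hS x n t ⟨ht, htn.le⟩)).mono_of_mem_nhdsWithin h2

end RegularField

namespace IsFlow

variable {v : ℝ → F → F} {Dv : ℝ → F → F →L[ℝ] F} {S : ℝ → F → F}

theorem continuousOn_path (hS : IsFlow v S) (x : F) : ContinuousOn (fun t => S t x) (Ici 0) :=
  fun t ht => (hS.hasDeriv x t ht).continuousWithinAt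

theorem hasDeriv_Icc (hS : IsFlow v S) (x : F) (T : ℝ) : ∀ t ∈ Icc 0 T,
    HasDerivWithinAt (fun s => S s x) (v t (S t x)) (Icc 0 T) t :=
  fun t ht => (hS.hasDeriv x t ht.1).mono Icc_subset_Ici_self

theorem hasDeriv_right (hS : IsFlow v S) (x : F) {t : ℝ} (ht : 0 ≤ t) :
    HasDerivWithinAt (fun s => S s x) (v t (S t x)) (Ici t) t :=
  (hS.hasDeriv x t ht).mono (Ici_subset_Ici.2 ht)

variable [ProperSpace F]

theorem unique {S' : ℝ → F → F} (hv : RegularField v Dv) (hS : IsFlow v S) (hS' : IsFlow v S')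
    {t : ℝ} (ht : 0 ≤ t) : S' t = S t := by
  ext x
  exact hv.solution_unique (hS'.hasDeriv_Icc x t) (hS.hasDeriv_Icc x t)
    (by simp [hS.initial, hS'.initial]) ⟨ht, le_rfl⟩

theorem injective (hv : RegularField v Dv) (hS : IsFlow v S) {t : ℝ} (ht : 0 ≤ t) :
    Function.Injective (S t) := fun x y hxy => by
  have := hv.solution_unique_left (hS.hasDeriv_Icc x t) (hS.hasDeriv_Icc y t) hxy ⟨le_rfl, ht⟩
  simpa [hS.initial] using this

theorem exists_bound (hv : RegularField v Dv) (hS : IsFlow v S) {r T : ℝ} (hr : 0 ≤ r)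
    (hT : 0 ≤ T) : ∃ R, ∀ x, ‖x‖ ≤ r → ∀ t ∈ Icc 0 T, ‖S t x‖ ≤ R := by
  obtain ⟨R, hR⟩ := hv.exists_solution_Icc hr hT
  refine ⟨R, fun x hx t ht => ?_⟩
  obtain ⟨α, h0, h1⟩ := hR x hx
  have := hv.solution_unique (hS.hasDeriv_Icc x T) (fun t ht => (h1 t ht).1)
    (by simp [hS.initial, h0]) ht
  simp only at this
  rw [this]
  exact (h1 t ht).2

/-- On bounded sets the flow is Lipschitz in space, uniformly on bounded time intervals. -/
theorem exists_lipschitz (hv : RegularField v Dv) (hS : IsFlow v S) {r T : ℝ} (hr : 0 ≤ r)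
    (hT : 0 ≤ T) : ∃ C, 0 ≤ C ∧ ∀ x y, ‖x‖ ≤ r → ‖y‖ ≤ r → ∀ t ∈ Icc 0 T,
      ‖S t x - S t y‖ ≤ C * ‖x - y‖ := by
  obtain ⟨R, hR⟩ := hS.exists_bound hv hr hT
  obtain ⟨K, hK, -⟩ := hv.lipschitzOnWith T R
  refine ⟨Real.exp (K * T), (Real.exp_pos _).le, fun x y hx hy t ht => ?_⟩
  have hc : ∀ z, ContinuousOn (fun t => S t z) (Icc 0 T) := fun z =>
    (hS.continuousOn_path z).mono Icc_subset_Ici_self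
  have := dist_le_of_trajectories_ODE_of_mem (v := v) (s := fun _ => closedBall 0 R)
    (fun t ht => hK t (Ico_subset_Icc_self ht)) (hc x)
    (fun t ht => hS.hasDeriv_right x ht.1)
    (fun t ht => by simpa using hR x hx t (Ico_subset_Icc_self ht)) (hc y)
    (fun t ht => hS.hasDeriv_right y ht.1)
    (fun t ht => by simpa using hR y hy t (Ico_subset_Icc_self ht))
    (δ := ‖x - y‖) (by simp [hS.initial, dist_eq_norm]) t ht
  rw [dist_eq_norm, sub_zero] at this
  refine this.trans ?_
  rw [mul_comm]
  gcongr
  exact ht.2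

end IsFlow

end Flow

/-! ### Differentiability of the flow in space -/

section Variation

open Set Metric
open scoped NNReal

variable {F : Type*} [NormedAddCommGroup F] [NormedSpace ℝ F] [FiniteDimensional ℝ F]

-- The variational equation is itself an ordinary differential equation, on the space of operators.
-- Seeing it as a regular field lets the same existence theorem solve it.
omit [FiniteDimensional ℝ F] in
theorem RegularField.ofLinear [ProperSpace F] {B : ℝ → F →L[ℝ] F} (hB : ContinuousOn B (Ici 0)) :
    RegularField (fun t (N : F →L[ℝ] F) => B t ∘L N)
      (fun t _ => ContinuousLinearMap.compL ℝ F F F (B t)) := by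
  have hfst : ContinuousOn (fun p : ℝ × (F →L[ℝ] F) => B p.1) (Ici 0 ×ˢ univ) :=
    hB.comp continuousOn_fst fun p hp => hp.1
  refine ⟨hfst.clm_comp continuousOn_snd,
    fun t _ x => (ContinuousLinearMap.compL ℝ F F F (B t)).hasFDerivAt,
    (ContinuousLinearMap.compL ℝ F F F).continuous.comp_continuousOn hfst, fun δ T hδ => ?_⟩
  obtain ⟨C, hC⟩ := (isCompact_Icc (a := δ) (b := T)).exists_bound_of_continuousOn
    (hB.mono (Icc_subset_Ici_self.trans (Ici_subset_Ici.2 hδ.le)))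
  refine ⟨max C 0, le_max_right _ _, fun t ht x => ?_⟩
  calc ‖B t ∘L x‖ ≤ ‖B t‖ * ‖x‖ := ContinuousLinearMap.opNorm_comp_le _ _
    _ ≤ max C 0 * (1 + ‖x‖) := by
      gcongr
      · exact (hC t ht).trans (le_max_left _ _)
      · linarith

namespace IsFlow

variable {v : ℝ → F → F} {Dv : ℝ → F → F →L[ℝ] F} {S : ℝ → F → F}

theorem exists_variation (hv : RegularField v Dv) (hS : IsFlow v S) (x : F) :
    ∃ M : ℝ → F →L[ℝ] F, M 0 = ContinuousLinearMap.id ℝ F ∧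
      ∀ t, 0 ≤ t → HasDerivWithinAt M (Dv t (S t x) ∘L M t) (Ici 0) t := by
  have : ProperSpace (F →L[ℝ] F) := FiniteDimensional.proper ℝ _
  have : ProperSpace F := FiniteDimensional.proper ℝ _
  have hB : ContinuousOn (fun t => Dv t (S t x)) (Ici 0) :=
    continuousOn_comp_path hv.continuousOn_deriv subset_rfl (hS.continuousOn_path x)
  obtain ⟨Φ, hΦ⟩ := (RegularField.ofLinear hB).exists_isFlow
  exact ⟨fun t => Φ t (ContinuousLinearMap.id ℝ F), hΦ.initial _, hΦ.hasDeriv _⟩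

/-- The solution of the variational equation along a trajectory is the space derivative of the
flow. -/
theorem hasFDerivAt_of_variation (hv : RegularField v Dv) (hS : IsFlow v S) {x : F}
    {M : ℝ → F →L[ℝ] F} (hM0 : M 0 = ContinuousLinearMap.id ℝ F)
    (hM : ∀ t, 0 ≤ t → HasDerivWithinAt M (Dv t (S t x) ∘L M t) (Ici 0) t) {T : ℝ} (hT : 0 ≤ T) :
    HasFDerivAt (S T) (M T) x := by
  have : ProperSpace F := FiniteDimensional.proper ℝ _
  have hr : 0 ≤ ‖x‖ + 1 := by positivity
  obtain ⟨R, hR⟩ := hS.exists_bound hv hr hT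
  obtain ⟨C, hC0, hC⟩ := hS.exists_lipschitz hv hr hT
  obtain ⟨K, -, hK⟩ := hv.lipschitzOnWith T R
  have huc : UniformContinuousOn (fun p : ℝ × F => Dv p.1 p.2) (Icc 0 T ×ˢ closedBall 0 R) :=
    (isCompact_Icc.prod (isCompact_closedBall _ _)).uniformContinuousOn_of_continuous
      (hv.continuousOn_deriv.mono (prod_mono Icc_subset_Ici_self (subset_univ _)))
  rw [Metric.uniformContinuousOn_iff] at huc
  rw [hasFDerivAt_iff_isLittleO_nhds_zero, Asymptotics.isLittleO_iff]
  intro c hc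
  set G : ℝ := gronwallBound 0 K 1 T with hG
  have hG0 : 0 ≤ G := by
    have := gronwallBound_mono (δ := 0) (ε := 1) (K := K) le_rfl zero_le_one K.2 hT
    rwa [gronwallBound_x0] at this
  obtain ⟨η, hη, hηuc⟩ := huc (c / ((C + 1) * (G + 1))) (by positivity)
  have hsmall : ∀ᶠ h : F in 𝓝 0, ‖h‖ < min 1 (η / (C + 1)) :=
    (continuous_norm.tendsto' (0 : F) 0 norm_zero).eventually
      (gt_mem_nhds (lt_min one_pos (by positivity)))
  filter_upwards [hsmall] with h hh
  have hx1 : ‖x‖ ≤ ‖x‖ + 1 := by linarith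
  have hx2 : ‖x + h‖ ≤ ‖x‖ + 1 :=
    (norm_add_le _ _).trans (by linarith [hh.trans_le (min_le_left _ _)])
  have hd : ∀ t ∈ Icc 0 T, ‖S t (x + h) - S t x‖ ≤ C * ‖h‖ := fun t ht => by
    simpa using hC (x + h) x hx2 hx1 t ht
  have hdη : C * ‖h‖ < η := by
    have h1 : ‖h‖ < η / (C + 1) := hh.trans_le (min_le_right _ _)
    rw [lt_div_iff₀ (by positivity)] at h1
    nlinarith [norm_nonneg h]
  set e : ℝ := c / ((C + 1) * (G + 1)) with he
  have he0 : 0 < e := by positivity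
  -- The linearization error is small relative to `‖h‖`, uniformly in time. This is the mean value
  -- inequality on an intersection of two balls, which is convex and on which `Dv` varies by at most
  -- `e`.
  have hrem : ∀ t ∈ Icc 0 T, ‖v t (S t (x + h)) - v t (S t x)
      - Dv t (S t x) (S t (x + h) - S t x)‖ ≤ e * (C * ‖h‖) := fun t ht => by
    have hmem : ∀ y ∈ closedBall (0 : F) R, ‖y - S t x‖ ≤ C * ‖h‖ →
        ‖Dv t y - Dv t (S t x)‖ ≤ e := fun y hy hyd => by
      rw [← dist_eq_norm]
      refine (hηuc (t, y) ⟨ht, hy⟩ (t, S t x) ⟨ht, by simpa using hR x hx1 t ht⟩ ?_).le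
      rw [Prod.dist_eq, dist_self, max_eq_right dist_nonneg, dist_eq_norm]
      linarith
    have hconv : Convex ℝ (closedBall (0 : F) R ∩ closedBall (S t x) (C * ‖h‖)) :=
      (convex_closedBall _ _).inter (convex_closedBall _ _)
    have := hconv.norm_image_sub_le_of_norm_hasFDerivWithin_le' (f := v t)
      (f' := fun y => Dv t y) (φ := Dv t (S t x)) (C := e)
      (fun y _ => (hv.hasFDerivAt t ht.1 y).hasFDerivWithinAt)
      (fun y hy => hmem y hy.1 (by simpa [dist_eq_norm] using hy.2))
      (x := S t x) (y := S t (x + h))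
      ⟨by simpa using hR x hx1 t ht, mem_closedBall_self (by positivity)⟩
      ⟨by simpa using hR _ hx2 t ht, by simpa [dist_eq_norm] using hd t ht⟩
    exact this.trans (by gcongr; exact hd t ht)
  have hMr : ∀ t, 0 ≤ t → HasDerivWithinAt (fun s => M s h) (Dv t (S t x) (M t h)) (Ici t) t :=
    fun t ht => by
      have := ((hM t ht).mono (Ici_subset_Ici.2 ht)).clm_apply
        (hasDerivWithinAt_const t (Ici t) h)
      simpa using this
  have hMc : ContinuousOn M (Icc 0 T) := fun t ht =>
    ((hM t ht.1).continuousWithinAt).mono Icc_subset_Ici_self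
  have hSc : ∀ z, ContinuousOn (fun t => S t z) (Icc 0 T) := fun z =>
    (hS.continuousOn_path z).mono Icc_subset_Ici_self
  -- The increment `S t (x + h) - S t x` solves the linearized equation up to the error just
  -- bounded, while `M t h` solves it exactly from the same initial value. Grönwall's inequality
  -- compares them.
  have key := dist_le_of_approx_trajectories_ODE_of_mem
    (v := fun t y => Dv t (S t x) y) (s := fun _ => univ) (K := K) (a := 0) (b := T)
    (f := fun t => S t (x + h) - S t x) (f' := fun t => v t (S t (x + h)) - v t (S t x))
    (g := fun t => M t h) (g' := fun t => Dv t (S t x) (M t h)) (εf := e * (C * ‖h‖)) (εg := 0)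
    (δ := 0) ?_ ((hSc _).sub (hSc _))
    (fun t ht => (hS.hasDeriv_right _ ht.1).sub (hS.hasDeriv_right _ ht.1))
    (fun t ht => by rw [dist_eq_norm]; exact hrem t (Ico_subset_Icc_self ht))
    (fun _ _ => mem_univ _) (hMc.clm_apply continuousOn_const) (fun t ht => hMr t ht.1)
    (fun t _ => by simp) (fun _ _ => mem_univ _) (by simp [hS.initial, hM0]) T ⟨hT, le_rfl⟩
  · rw [dist_eq_norm, sub_zero, add_zero] at key
    refine key.trans ?_
    have hlin : gronwallBound 0 K (e * (C * ‖h‖)) T = (e * (C * ‖h‖)) * G := by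
      rw [hG]; unfold gronwallBound; split_ifs <;> ring
    rw [hlin]
    have h1 : e * (C + 1) * (G + 1) = c := by rw [he]; field_simp
    calc e * (C * ‖h‖) * G ≤ e * ((C + 1) * ‖h‖) * (G + 1) := by
          gcongr <;> linarith
      _ = c * ‖h‖ := by rw [← h1]; ring
  · intro t ht
    refine LipschitzWith.lipschitzOnWith ?_
    exact (Dv t (S t x)).lipschitz.weaken (hK t (Ico_subset_Icc_self ht) _
      (hR x hx1 t (Ico_subset_Icc_self ht)))

/-- The solution `M y` solves the equation of `M x` up to an error `e * B`, where `e` bounds the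
change of `Dv` between the two trajectories and `B` bounds `M y`. Both start at the identity, so
Grönwall's inequality controls the difference at time `T`. -/
theorem tendsto_variation (hv : RegularField v Dv) (hS : IsFlow v S)
    {M : F → ℝ → F →L[ℝ] F} (hM0 : ∀ x, M x 0 = ContinuousLinearMap.id ℝ F)
    (hM : ∀ x t, 0 ≤ t → HasDerivWithinAt (M x) (Dv t (S t x) ∘L M x t) (Ici 0) t) {T : ℝ}
    (hT : 0 ≤ T) : Continuous (fun x => M x T) := by
  have : ProperSpace F := FiniteDimensional.proper ℝ _
  rw [continuous_iff_continuousAt]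
  intro x
  have hr : 0 ≤ ‖x‖ + 1 := by positivity
  obtain ⟨R, hR⟩ := hS.exists_bound hv hr hT
  obtain ⟨C, hC0, hC⟩ := hS.exists_lipschitz hv hr hT
  obtain ⟨K, -, hK⟩ := hv.lipschitzOnWith T R
  have huc : UniformContinuousOn (fun p : ℝ × F => Dv p.1 p.2) (Icc 0 T ×ˢ closedBall 0 R) :=
    (isCompact_Icc.prod (isCompact_closedBall _ _)).uniformContinuousOn_of_continuous
      (hv.continuousOn_deriv.mono (prod_mono Icc_subset_Ici_self (subset_univ _)))
  rw [Metric.uniformContinuousOn_iff] at huc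
  have hMc : ∀ y, ContinuousOn (M y) (Icc 0 T) := fun y t ht =>
    ((hM y t ht.1).continuousWithinAt).mono Icc_subset_Ici_self
  have hMr : ∀ y t, 0 ≤ t → HasDerivWithinAt (M y) (Dv t (S t y) ∘L M y t) (Ici t) t :=
    fun y t ht => (hM y t ht).mono (Ici_subset_Ici.2 ht)
  set G : ℝ := gronwallBound 0 K 1 T with hG
  have hG0 : 0 ≤ G := by
    have := gronwallBound_mono (δ := 0) (ε := 1) (K := K) le_rfl zero_le_one K.2 hT
    rwa [gronwallBound_x0] at this
  set B : ℝ := ‖ContinuousLinearMap.id ℝ F‖ * Real.exp (K * T) with hB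
  have hMb : ∀ y, ‖y‖ ≤ ‖x‖ + 1 → ∀ t ∈ Icc 0 T, ‖M y t‖ ≤ B := fun y hy t ht => by
    have := norm_le_gronwallBound_of_norm_deriv_right_le (K := K) (ε := 0)
      (δ := ‖ContinuousLinearMap.id ℝ F‖) (hMc y) (fun t ht => hMr y t ht.1) (by rw [hM0])
      (fun t ht => by
        rw [add_zero]
        exact (ContinuousLinearMap.opNorm_comp_le _ _).trans (by
          gcongr; exact hK t (Ico_subset_Icc_self ht) _ (hR y hy t (Ico_subset_Icc_self ht)))) t ht
    rw [gronwallBound_ε0, sub_zero] at this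
    refine this.trans ?_
    rw [hB]
    gcongr
    exact ht.2
  rw [ContinuousAt, Metric.tendsto_nhds]
  intro c hc
  have hB0 : 0 ≤ B := by positivity
  set e : ℝ := c / ((B + 1) * (G + 1)) with he
  have he0 : 0 < e := by positivity
  obtain ⟨η, hη, hηuc⟩ := huc e he0
  have hsmall : ∀ᶠ y : F in 𝓝 x, dist y x < min 1 (η / (C + 1)) :=
    Metric.ball_mem_nhds x (lt_min one_pos (by positivity))
  filter_upwards [hsmall] with y hy
  rw [dist_eq_norm] at hy
  have hx1 : ‖x‖ ≤ ‖x‖ + 1 := by linarith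
  have hy1 : ‖y‖ ≤ ‖x‖ + 1 := by
    have := norm_add_le x (y - x)
    rw [add_sub_cancel] at this
    linarith [hy.trans_le (min_le_left _ _)]
  have hdη : C * ‖y - x‖ < η := by
    have h1 : ‖y - x‖ < η / (C + 1) := hy.trans_le (min_le_right _ _)
    rw [lt_div_iff₀ (by positivity)] at h1
    nlinarith [norm_nonneg (y - x)]
  have key := dist_le_of_approx_trajectories_ODE_of_mem
    (v := fun t (N : F →L[ℝ] F) => Dv t (S t x) ∘L N) (s := fun _ => univ) (K := K) (a := 0)
    (b := T) (f := M y) (f' := fun t => Dv t (S t y) ∘L M y t)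
    (g := M x) (g' := fun t => Dv t (S t x) ∘L M x t) (εf := e * B) (εg := 0)
    (δ := 0) ?_ (hMc y) (fun t ht => hMr y t ht.1) ?_ (fun _ _ => mem_univ _) (hMc x)
    (fun t ht => hMr x t ht.1) (fun t _ => by simp) (fun _ _ => mem_univ _)
    (by simp [hM0]) T ⟨hT, le_rfl⟩
  · rw [sub_zero, add_zero] at key
    refine key.trans_lt ?_
    have hlin : gronwallBound 0 K (e * B) T = (e * B) * G := by
      rw [hG]; unfold gronwallBound; split_ifs <;> ring
    rw [hlin]
    have h1 : e * (B + 1) * (G + 1) = c := by rw [he]; field_simp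
    rw [← h1]
    have : 0 ≤ e * B * G := by positivity
    nlinarith [mul_nonneg he0.le hB0, mul_nonneg he0.le hG0]
  · intro t ht
    refine LipschitzOnWith.of_dist_le_mul fun N _ N' _ => ?_
    rw [dist_eq_norm, dist_eq_norm, ← ContinuousLinearMap.comp_sub]
    refine (ContinuousLinearMap.opNorm_comp_le _ _).trans ?_
    gcongr
    exact hK t (Ico_subset_Icc_self ht) _ (hR x hx1 t (Ico_subset_Icc_self ht))
  · intro t ht
    have ht' := Ico_subset_Icc_self ht
    rw [dist_eq_norm, ← ContinuousLinearMap.sub_comp]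
    refine (ContinuousLinearMap.opNorm_comp_le _ _).trans ?_
    gcongr
    · rw [← dist_eq_norm]
      refine (hηuc (t, S t y) ⟨ht', by simpa using hR y hy1 t ht'⟩ (t, S t x)
        ⟨ht', by simpa using hR x hx1 t ht'⟩ ?_).le
      rw [Prod.dist_eq, dist_self, max_eq_right dist_nonneg, dist_eq_norm]
      exact (hC y x hy1 hx1 t ht').trans_lt hdη
    · exact hMb y hy1 t ht'

/-- The flow of a regular field is `C¹` in space, with derivative solving the variational
equation. -/
theorem exists_deriv (hv : RegularField v Dv) (hS : IsFlow v S) :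
    ∃ M : F → ℝ → F →L[ℝ] F, (∀ x, M x 0 = ContinuousLinearMap.id ℝ F) ∧
      (∀ x t, 0 ≤ t → HasDerivWithinAt (M x) (Dv t (S t x) ∘L M x t) (Ici 0) t) ∧
      (∀ t, 0 ≤ t → ∀ x, HasFDerivAt (S t) (M x t) x) ∧
      ∀ t, 0 ≤ t → ContDiff ℝ 1 (S t) := by
  choose M hM0 hM using hS.exists_variation hv
  have hd : ∀ t, 0 ≤ t → ∀ x, HasFDerivAt (S t) (M x t) x := fun t ht x =>
    hS.hasFDerivAt_of_variation hv (hM0 x) (hM x) ht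
  refine ⟨M, hM0, hM, hd, fun t ht => ?_⟩
  rw [contDiff_one_iff_fderiv]
  refine ⟨fun x => (hd t ht x).differentiableAt, ?_⟩
  rw [show fderiv ℝ (S t) = fun x => M x t from funext fun x => (hd t ht x).fderiv]
  exact hS.tendsto_variation hv hM0 hM ht

end IsFlow

end Variation

/-! ### Jacobi's and Liouville's formulas, and change of variables -/

section Liouville

open Set Metric
open scoped NNReal RealInnerProductSpace ENNReal

/-- The product rule in the Leibniz expansion gives a sum of determinants in each of which one
column is replaced by its derivative. Cramer's rule identifies these with the diagonal entries of
the adjugate times `N'`. -/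
theorem _root_.Matrix.hasDerivWithinAt_det {n : Type*} [Fintype n] [DecidableEq n]
    {N : ℝ → Matrix n n ℝ} {N' : Matrix n n ℝ} {s : Set ℝ} {t : ℝ}
    (h : ∀ i j, HasDerivWithinAt (fun r => N r i j) (N' i j) s t) :
    HasDerivWithinAt (fun r => (N r).det) ((N t).adjugate * N').trace s t := by
  have h1 : HasDerivWithinAt (fun r => ∑ σ : Equiv.Perm n, ((σ.sign : ℤ) : ℝ) *
      ∏ i, N r (σ i) i) (∑ σ : Equiv.Perm n, ((σ.sign : ℤ) : ℝ) *
      ∑ k, (∏ j ∈ Finset.univ.erase k, N t (σ j) j) • N' (σ k) k) s t :=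
    HasDerivWithinAt.fun_sum fun σ _ =>
      (HasDerivWithinAt.fun_finsetProd fun i _ => h (σ i) i).const_mul _
  simp_rw [Matrix.det_apply']
  convert h1 using 1
  have h2 : ((N t).adjugate * N').trace = ∑ k, ((N t).updateCol k (N'.col k)).det := by
    simp only [Matrix.trace, Matrix.diag, Matrix.mul_apply]
    refine Finset.sum_congr rfl fun k _ => ?_
    rw [← Matrix.cramer_apply, Matrix.cramer_eq_adjugate_mulVec]
    rfl
  rw [h2]
  simp_rw [Matrix.det_apply', Finset.mul_sum]
  rw [Finset.sum_comm]
  refine Finset.sum_congr rfl fun σ _ => Finset.sum_congr rfl fun k _ => ?_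
  congr 1
  rw [← Finset.mul_prod_erase _ _ (Finset.mem_univ k), smul_eq_mul, mul_comm]
  congr 1
  · refine Finset.prod_congr rfl fun j hj => ?_
    rw [Matrix.updateCol_ne (Finset.ne_of_mem_erase hj)]
  · simp

variable {E : Type*} [NormedAddCommGroup E] [NormedSpace ℝ E] [FiniteDimensional ℝ E]

/-- **Liouville's formula** for the determinant of a solution of a linear equation. -/
theorem hasDerivWithinAt_det_of_linear {M : ℝ → E →L[ℝ] E} {B : E →L[ℝ] E} {s : Set ℝ} {t : ℝ}
    (h : HasDerivWithinAt M (B ∘L M t) s t) :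
    HasDerivWithinAt (fun r => (M r).det)
      (LinearMap.trace ℝ E (B : E →ₗ[ℝ] E) * (M t).det) s t := by
  classical
  set b := Module.finBasis ℝ E
  have hdet : ∀ f : E →L[ℝ] E, f.det = (LinearMap.toMatrix b b (f : E →ₗ[ℝ] E)).det := fun f =>
    (LinearMap.det_toMatrix b _).symm
  simp_rw [hdet]
  have h1 : ∀ i j, HasDerivWithinAt (fun r => LinearMap.toMatrix b b (M r : E →ₗ[ℝ] E) i j)
      (LinearMap.toMatrix b b ((B ∘L M t : E →L[ℝ] E) : E →ₗ[ℝ] E) i j) s t := fun i j => by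
    simp only [LinearMap.toMatrix_apply]
    have h2 := (LinearMap.toContinuousLinearMap (b.coord i)).hasFDerivAt.comp_hasDerivWithinAt t
      (h.clm_apply (hasDerivWithinAt_const t s (b j)))
    refine h2.congr_deriv ?_
    simp
  convert Matrix.hasDerivWithinAt_det h1 using 1
  -- Cyclicity of the trace brings `M` next to its adjugate, and their product is the scalar `det
  -- M`.
  rw [show ((B ∘L M t : E →L[ℝ] E) : E →ₗ[ℝ] E) = (B : E →ₗ[ℝ] E) ∘ₗ (M t : E →ₗ[ℝ] E) from rfl,
    LinearMap.toMatrix_comp b b b, ← Matrix.mul_assoc,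
    Matrix.trace_mul_comm, ← Matrix.mul_assoc, Matrix.mul_adjugate, Matrix.smul_mul, Matrix.one_mul,
    Matrix.trace_smul, smul_eq_mul, LinearMap.trace_eq_matrix_trace ℝ b, mul_comm]

/-- The image of a density under a `C¹` bijection. -/
theorem map_withDensity_of_det [MeasurableSpace E] [BorelSpace E] (μ : Measure E)
    [μ.IsAddHaarMeasure] {S T : E → E}
    {M : E → E →L[ℝ] E} (hM : ∀ x, HasFDerivAt S (M x) x) (hT : Measurable T)
    (hl : Function.LeftInverse T S) (hr : Function.RightInverse T S) {ρ₀ ρ : E → ℝ}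
    (hcons : ∀ x, ρ (S x) * |(M x).det| = ρ₀ x) :
    (μ.withDensity fun x => ENNReal.ofReal (ρ x)).map T =
      μ.withDensity fun x => ENNReal.ofReal (ρ₀ x) := by
  ext B hB
  rw [Measure.map_apply hT hB, withDensity_apply _ (hT hB), withDensity_apply _ hB]
  have himg : T ⁻¹' B = S '' B := by
    rw [Set.image_eq_preimage_of_inverse hl hr]
  rw [himg, lintegral_image_eq_lintegral_abs_det_fderiv_mul μ hB
    (fun x _ => (hM x).hasFDerivWithinAt) hl.injective.injOn]
  refine lintegral_congr fun x => ?_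
  rw [← ENNReal.ofReal_mul (abs_nonneg _), ← hcons x, mul_comm]

end Liouville

/-! ### Expanding flows and Lipschitz inverses -/

section Expanding

open Set Metric
open scoped NNReal RealInnerProductSpace ENNReal

variable {E : Type*} [NormedAddCommGroup E] [InnerProductSpace ℝ E]

/-- Mean value theorem for `s ↦ ⟪w (y + s • h), h⟫` along the segment from `y` to `x`. -/
theorem inner_sub_ge_of_hasFDerivAt {w : E → E} {Dw : E → E →L[ℝ] E}
    (hw : ∀ x, HasFDerivAt w (Dw x) x) {l : ℝ} (hl : ∀ x h, l * ‖h‖ ^ 2 ≤ ⟪Dw x h, h⟫) (x y : E) :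
    l * ‖x - y‖ ^ 2 ≤ ⟪w x - w y, x - y⟫ := by
  set h := x - y with hh
  have hd : ∀ s : ℝ, HasDerivAt (fun s : ℝ => ⟪w (y + s • h), h⟫) ⟪Dw (y + s • h) h, h⟫ s :=
    fun s => by
      have h1 : HasDerivAt (fun s : ℝ => y + s • h) h s := by
        simpa using ((hasDerivAt_id s).smul_const h).const_add y
      simpa using ((hw (y + s • h)).comp_hasDerivAt s h1).inner ℝ (hasDerivAt_const s h)
  obtain ⟨s, -, hs⟩ := exists_hasDerivAt_eq_slope _ _ (zero_lt_one' ℝ)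
    (fun s _ => (hd s).continuousAt.continuousWithinAt) (fun s _ => hd s)
  have h2 : y + h = x := by simp [hh]
  simp only [one_smul, zero_smul, add_zero, sub_zero, div_one, h2] at hs
  rw [inner_sub_left, ← hs]
  exact hl _ _

variable [FiniteDimensional ℝ E] {v : ℝ → E → E} {Dv : ℝ → E → E →L[ℝ] E} {S : ℝ → E → E}

/-- The derivative of `log ‖S s x - S s y‖²` is at least `2 l s`; the logarithm makes sense because
the flow is injective. As `l` is merely integrable, the bound is integrated by the one-sided
fundamental theorem for a function whose right derivative is dominated, applied to minus the
logarithm. -/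
theorem IsFlow.norm_sub_ge (hv : RegularField v Dv) (hS : IsFlow v S) {l : ℝ → ℝ}
    (hl : ∀ t, 0 ≤ t → ∀ x h, l t * ‖h‖ ^ 2 ≤ ⟪Dv t x h, h⟫) {t : ℝ} (ht : 0 ≤ t)
    (hint : IntervalIntegrable l volume 0 t) (x y : E) :
    Real.exp (∫ s in (0 : ℝ)..t, l s) * ‖x - y‖ ≤ ‖S t x - S t y‖ := by
  have : ProperSpace E := FiniteDimensional.proper ℝ _
  rcases eq_or_ne x y with rfl | hxy
  · simp
  set D : ℝ → ℝ := fun s => ‖S s x - S s y‖ ^ 2 with hD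
  have hD0 : ∀ s, 0 ≤ s → 0 < D s := fun s hs => by
    have : S s x - S s y ≠ 0 := sub_ne_zero.2 ((hS.injective hv hs).ne hxy)
    positivity
  have hDd : ∀ s, 0 ≤ s → HasDerivWithinAt (fun s => -Real.log (D s))
      (-(2 * ⟪S s x - S s y, v s (S s x) - v s (S s y)⟫ / D s)) (Ici 0) s := fun s hs => by
    have h1 := ((hS.hasDeriv x s hs).sub (hS.hasDeriv y s hs)).norm_sq
    exact (h1.log (hD0 s hs).ne').neg
  have key := intervalIntegral.sub_le_integral_of_hasDeriv_right_of_le (φ := fun s => -2 * l s) ht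
    (g := fun s => -Real.log (D s))
    (fun s hs => ((hDd s hs.1).continuousWithinAt).mono Icc_subset_Ici_self)
    (fun s hs => (hDd s hs.1.le).mono (Ioi_subset_Ici hs.1.le))
    ((((intervalIntegrable_iff_integrableOn_Icc_of_le ht).1 hint).const_mul (-2)))
    (fun s hs => by
      have h1 := inner_sub_ge_of_hasFDerivAt (hv.hasFDerivAt s hs.1.le) (hl s hs.1.le)
        (S s x) (S s y)
      rw [real_inner_comm] at h1
      have h2 : l s ≤ ⟪S s x - S s y, v s (S s x) - v s (S s y)⟫ / D s := by
        rw [le_div_iff₀ (hD0 s hs.1.le)]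
        exact h1
      have h3 : 2 * ⟪S s x - S s y, v s (S s x) - v s (S s y)⟫ / D s
          = 2 * (⟪S s x - S s y, v s (S s x) - v s (S s y)⟫ / D s) := by ring
      rw [h3]
      linarith)
  rw [intervalIntegral.integral_const_mul] at key
  simp only [hD, hS.initial, Real.log_pow] at key
  have hxy' : 0 < ‖x - y‖ := norm_pos_iff.2 (sub_ne_zero.2 hxy)
  have hSxy : 0 < ‖S t x - S t y‖ :=
    norm_pos_iff.2 (sub_ne_zero.2 ((hS.injective hv ht).ne hxy))
  rw [← Real.log_le_log_iff (by positivity) hSxy, Real.log_mul (Real.exp_pos _).ne' hxy'.ne',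
    Real.log_exp]
  push_cast at key
  linarith

/-- The image is open by the inverse function theorem. It is closed because expansion turns a
convergent sequence of values into a Cauchy sequence of points. Connectedness of the space gives
surjectivity; injectivity and the Lipschitz bound are the expansion itself. -/
theorem exists_inverse_of_expanding {S : E → E} {M : E → E →L[ℝ] E} (hC : ContDiff ℝ 1 S)
    (hM : ∀ x, HasFDerivAt S (M x) x) (hdet : ∀ x, (M x).det ≠ 0) {c : ℝ} (hc : 0 < c)
    (hexp : ∀ x y, c * ‖x - y‖ ≤ ‖S x - S y‖) :
    ∃ T : E → E, Function.LeftInverse T S ∧ Function.RightInverse T S ∧ ContDiff ℝ 1 T ∧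
      LipschitzWith c⁻¹.toNNReal T := by
  have : CompleteSpace E := FiniteDimensional.complete ℝ E
  set e : E → E ≃L[ℝ] E := fun x => (M x).toContinuousLinearEquivOfDetNeZero (hdet x) with he
  have hMe : ∀ x, HasFDerivAt S (e x : E →L[ℝ] E) x := fun x => by
    simpa [he] using hM x
  have hopen : IsOpenMap S := by
    refine isOpenMap_of_hasStrictFDerivAt_equiv (f' := e) fun x => ?_
    exact hC.contDiffAt.hasStrictFDerivAt' (hMe x) one_ne_zero
  have hanti : AntilipschitzWith c⁻¹.toNNReal S := by
    refine AntilipschitzWith.of_le_mul_dist fun x y => ?_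
    rw [dist_eq_norm, dist_eq_norm, Real.coe_toNNReal _ (by positivity), inv_mul_eq_div,
      le_div_iff₀ hc, mul_comm]
    exact hexp x y
  have hclosed : IsClosed (range S) := by
    refine isClosed_of_closure_subset fun y hy => ?_
    obtain ⟨u, hu, hlim⟩ := mem_closure_iff_seq_limit.1 hy
    choose z hz using hu
    have hcau : CauchySeq z := by
      have h1 : CauchySeq fun n => S (z n) := by simp_rw [hz]; exact hlim.cauchySeq
      rw [Metric.cauchySeq_iff] at h1 ⊢
      intro ε hε
      obtain ⟨N, hN⟩ := h1 (c * ε) (by positivity)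
      refine ⟨N, fun m hm n hn => ?_⟩
      have h2 := hN m hm n hn
      rw [dist_eq_norm] at h2 ⊢
      exact lt_of_mul_lt_mul_left ((hexp _ _).trans_lt h2) hc.le
    obtain ⟨x, hx⟩ := cauchySeq_tendsto_of_complete hcau
    refine ⟨x, tendsto_nhds_unique ((hC.continuous.tendsto x).comp hx) ?_⟩
    simpa [Function.comp_def, hz] using hlim
  have hsurj : Function.Surjective S := by
    rw [← range_eq_univ]
    exact IsClopen.eq_univ ⟨hclosed, hopen.isOpen_range⟩ (range_nonempty S)
  set φ : E ≃ₜ E := (Equiv.ofBijective S ⟨hanti.injective, hsurj⟩).toHomeomorphOfContinuousOpen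
    hC.continuous hopen with hφ
  refine ⟨φ.symm, φ.symm_apply_apply, φ.apply_symm_apply,
    Homeomorph.contDiff_symm φ (f₀' := e) hMe hC, ?_⟩
  exact hanti.to_rightInverse φ.apply_symm_apply

end Expanding

/-! ### Convergence of the inverses of a decaying flow -/

section LongTime

open Set Metric
open scoped NNReal RealInnerProductSpace ENNReal

variable {E : Type*} [NormedAddCommGroup E] [NormedSpace ℝ E]

/-- A trajectory of an exponentially decaying field moves little at large times. -/
theorem norm_sub_le_of_exp_decay {v : ℝ → E → E} {α : ℝ → E}
    {t t' c C : ℝ} {y : E} (htt' : t ≤ t') (hc : 0 < c) (hC : 0 < C)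
    (hα : ∀ s ∈ Icc t t', HasDerivAt α (v s (α s)) s) (hy : α t' = y)
    (hv : ∀ s ∈ Icc t t', ∀ x, ‖x‖ ≤ ‖y‖ + 1 → ‖v s x‖ ≤ C * Real.exp (-c * s))
    (hsmall : 2 * C / c * Real.exp (-c * t) ≤ 1) :
    ‖α t - y‖ ≤ 2 * C / c * Real.exp (-c * t) := by
  have hmem : ∀ τ ∈ Icc 0 (t' - t), t' - τ ∈ Icc t t' := fun τ hτ =>
    ⟨by linarith [hτ.2], by linarith [hτ.1]⟩
  have hβ : ∀ τ ∈ Icc 0 (t' - t), HasDerivAt (fun τ => α (t' - τ) - y)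
      (-v (t' - τ) (α (t' - τ))) τ := fun τ hτ => by
    have h1 : HasDerivAt (fun τ : ℝ => t' - τ) (-1) τ := by
      simpa using (hasDerivAt_id τ).const_sub t'
    simpa using ((hα _ (hmem τ hτ)).scomp τ h1).sub_const y
  -- A barrier in reversed time, started at `t'`. Its slope is twice the speed bound, for the strict
  -- inequality, and its total increase is at most `1` by `hsmall`, so the trajectory stays in the
  -- ball where the speed bound applies.
  set B : ℝ → ℝ := fun τ => 2 * C / c * (Real.exp (-c * (t' - τ)) - Real.exp (-c * t')) with hB
  have hBd : ∀ τ, HasDerivAt B (2 * C * Real.exp (-c * (t' - τ))) τ := fun τ => by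
    have h1 : HasDerivAt (fun τ : ℝ => -c * (t' - τ)) c τ := by
      simpa using ((hasDerivAt_id τ).const_sub t').const_mul (-c)
    have h2 := ((h1.exp).sub_const (Real.exp (-c * t'))).const_mul (2 * C / c)
    refine h2.congr_deriv ?_
    field_simp
  have hBle : ∀ τ ∈ Icc 0 (t' - t), B τ ≤ 2 * C / c * Real.exp (-c * t) := fun τ hτ => by
    have h1 : Real.exp (-c * (t' - τ)) ≤ Real.exp (-c * t) :=
      Real.exp_le_exp.2 (by nlinarith [hτ.2])
    simp only [hB]
    gcongr
    linarith [Real.exp_pos (-c * t')]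
  have key : ∀ ⦃τ⦄, τ ∈ Icc 0 (t' - t) → ‖α (t' - τ) - y‖ ≤ B τ := by
    refine image_norm_le_of_norm_deriv_right_lt_deriv_boundary
      (f' := fun τ => -v (t' - τ) (α (t' - τ)))
      (B' := fun τ => 2 * C * Real.exp (-c * (t' - τ)))
      (fun τ hτ => (hβ τ hτ).continuousAt.continuousWithinAt)
      (fun τ hτ => (hβ τ (Ico_subset_Icc_self hτ)).hasDerivWithinAt) (by simp [hB, hy]) hBd ?_
    intro τ hτ hEq
    have hτ' := Ico_subset_Icc_self hτ
    have h1 : ‖α (t' - τ)‖ ≤ ‖y‖ + 1 := by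
      have := norm_add_le y (α (t' - τ) - y)
      rw [add_sub_cancel] at this
      have := hBle τ hτ'
      linarith
    rw [norm_neg]
    refine (hv _ (hmem τ hτ') _ h1).trans_lt ?_
    have := mul_pos hC (Real.exp_pos (-c * (t' - τ)))
    linarith
  have h1 := key (right_mem_Icc.2 (by linarith : (0 : ℝ) ≤ t' - t))
  rw [sub_sub_cancel] at h1
  exact h1.trans (hBle _ (right_mem_Icc.2 (by linarith)))

/-- The inverses of an exponentially decaying flow converge, if they are uniformly Lipschitz. -/
theorem IsFlow.exists_tendsto_inverse [CompleteSpace E] {v S T : ℝ → E → E} (hS : IsFlow v S)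
    (hl : ∀ t, 0 ≤ t → Function.LeftInverse (T t) (S t))
    (hr : ∀ t, 0 ≤ t → Function.RightInverse (T t) (S t)) {K : ℝ≥0}
    (hK : ∀ t, 0 ≤ t → LipschitzWith K (T t))
    (hv : ∀ R : ℝ, ∃ C c : ℝ, 0 < C ∧ 0 < c ∧ ∀ t, 1 ≤ t → ∀ x, ‖x‖ ≤ R →
      ‖v t x‖ ≤ C * Real.exp (-c * t)) (y : E) :
    ∃ z, Tendsto (fun t => T t y) atTop (𝓝 z) := by
  obtain ⟨C, c, hC, hc, hdec⟩ := hv (‖y‖ + 1)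
  have hlim : Tendsto (fun t : ℝ => 2 * C / c * Real.exp (-c * t)) atTop (𝓝 0) := by
    have h1 : Tendsto (fun t : ℝ => -c * t) atTop atBot :=
      tendsto_id.const_mul_atTop_of_neg (by linarith)
    simpa using (Real.tendsto_exp_atBot.comp h1).const_mul (2 * C / c)
  refine cauchySeq_tendsto_of_complete ?_
  rw [Metric.cauchySeq_iff']
  intro ε hε
  have h1 : ∀ᶠ t in atTop, 2 * C / c * Real.exp (-c * t) < min 1 (ε / (K + 1)) :=
    hlim.eventually (gt_mem_nhds (lt_min one_pos (by positivity)))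
  obtain ⟨t, htE, ht1⟩ := (h1.and (eventually_ge_atTop 1)).exists
  refine ⟨t, fun t' ht' => ?_⟩
  have ht0 : 0 < t := by linarith
  -- The trajectory started at `z = T t' y` reaches `y` at time `t'`, so `S t z` is already close to
  -- `y`. Applying the Lipschitz map `T t`, which sends `S t z` back to `z`, compares `T t' y` with
  -- `T t y`.
  have h2 := norm_sub_le_of_exp_decay (v := v) (α := fun s => S s (T t' y)) (y := y) ht' hc hC
    (fun s hs => (hS.hasDeriv _ s (ht0.le.trans hs.1)).hasDerivAt
      (Ici_mem_nhds (ht0.trans_le hs.1))) (hr t' (ht0.le.trans ht') y)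
    (fun s hs x hx => hdec s (ht1.trans hs.1) x hx) (htE.le.trans (min_le_left _ _))
  have h3 := (hK t ht0.le).dist_le_mul (S t (T t' y)) y
  rw [hl t ht0.le, dist_eq_norm (S t _)] at h3
  refine h3.trans_lt ?_
  have h4 : ‖S t (T t' y) - y‖ < ε / (K + 1) := h2.trans_lt (htE.trans_le (min_le_right _ _))
  rw [lt_div_iff₀ (by positivity)] at h4
  nlinarith [norm_nonneg (S t (T t' y) - y)]

end LongTime

/-! ### Passing to the limit in the push-forward -/

section Limit

open Set
open scoped NNReal ENNReal BoundedContinuousFunction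

/-- If densities converge pointwise to a probability density and maps converge pointwise, then the
images of the measures converge to the image of the limit. -/
theorem map_eq_of_tendsto_density {E : Type*} [MetricSpace E] [MeasurableSpace E] [BorelSpace E]
    {γ ν : Measure E} [IsProbabilityMeasure γ] [IsProbabilityMeasure ν] {h : ℕ → E → ℝ}
    (hh : ∀ n, Measurable (h n)) (hlim : ∀ x, Tendsto (fun n => h n x) atTop (𝓝 1))
    {T : ℕ → E → E} {T' : E → E} (hT : ∀ n, Continuous (T n)) (hT' : Continuous T')
    (hTlim : ∀ x, Tendsto (fun n => T n x) atTop (𝓝 (T' x)))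
    (hmap : ∀ n, (γ.withDensity fun x => ENNReal.ofReal (h n x)).map (T n) = ν) :
    γ.map T' = ν := by
  -- Fatou's lemma gives one inequality with no domination of the densities.
  have hle : ∀ f : E →ᵇ ℝ≥0, ∫⁻ x, f x ∂(γ.map T') ≤ ∫⁻ x, f x ∂ν := fun f => by
    rw [lintegral_map (by fun_prop) hT'.measurable]
    have h1 : ∀ n, ∫⁻ x, ENNReal.ofReal (h n x) * f (T n x) ∂γ = ∫⁻ x, f x ∂ν := fun n => by
      rw [← hmap n, lintegral_map (by fun_prop) (hT n).measurable,
        lintegral_withDensity_eq_lintegral_mul _ (by fun_prop)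
          (by have := (hT n).measurable; fun_prop)]
      rfl
    have h2 : ∀ x, liminf (fun n => ENNReal.ofReal (h n x) * f (T n x)) atTop
        = (f (T' x) : ℝ≥0∞) := fun x => by
      refine Tendsto.liminf_eq ?_
      have h3 : Tendsto (fun n => ENNReal.ofReal (h n x)) atTop (𝓝 1) := by
        simpa using ENNReal.tendsto_ofReal (hlim x)
      have h4 : Tendsto (fun n => (f (T n x) : ℝ≥0∞)) atTop (𝓝 (f (T' x) : ℝ≥0∞)) :=
        (ENNReal.continuous_coe.tendsto _).comp ((f.continuous.tendsto _).comp (hTlim x))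
      simpa using ENNReal.Tendsto.mul h3 (Or.inl one_ne_zero) h4 (Or.inr ENNReal.one_ne_top)
    calc ∫⁻ x, f (T' x) ∂γ
        = ∫⁻ x, liminf (fun n => ENNReal.ofReal (h n x) * f (T n x)) atTop ∂γ := by simp_rw [h2]
      _ ≤ liminf (fun n => ∫⁻ x, ENNReal.ofReal (h n x) * f (T n x) ∂γ) atTop :=
          lintegral_liminf_le fun n => by have := (hT n).measurable; fun_prop
      _ = ∫⁻ x, f x ∂ν := by simp_rw [h1]; simp
  have : IsProbabilityMeasure (γ.map T') := Measure.isProbabilityMeasure_map hT'.aemeasurable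
  refine ext_of_forall_lintegral_eq_of_IsFiniteMeasure fun f => le_antisymm (hle f) ?_
  set c : ℝ≥0 := nndist f 0
  have hfc : ∀ x, f x ≤ c := fun x => BoundedContinuousFunction.NNReal.upper_bound f x
  -- Both measures have mass one, so the same inequality for `c - f` is the reverse inequality for
  -- `f`.
  set g : E →ᵇ ℝ≥0 := BoundedContinuousFunction.const E c - f
  have hsum : ∀ (μ : Measure E) [IsProbabilityMeasure μ],
      ∫⁻ x, f x ∂μ + ∫⁻ x, g x ∂μ = c := fun μ _ => by
    rw [← lintegral_add_left (by fun_prop)]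
    have : ∀ x, (f x : ℝ≥0∞) + g x = c := fun x => by
      rw [← ENNReal.coe_add]
      congr 1
      exact add_tsub_cancel_of_le (hfc x)
    simp [this]
  have h1 := hsum ν
  rw [← hsum (γ.map T')] at h1
  have hfin : ∫⁻ x, g x ∂(γ.map T') ≠ ⊤ := fun h => by
    have := hsum (γ.map T')
    rw [h] at this
    simp at this
  refine (ENNReal.add_le_add_iff_right hfin).1 ?_
  rw [← h1]
  exact add_le_add le_rfl (hle g)

end Limit

/-! ### Diagonal operators and Gaussian densities -/

noncomputable section Gaussian

open Set Metric Module
open scoped NNReal RealInnerProductSpace ENNReal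

variable {ι : Type*} [Fintype ι] {E : Type*} [NormedAddCommGroup E] [InnerProductSpace ℝ E]

/-- The operator which is diagonal in the orthonormal basis `b`, with diagonal entries `f`. -/
def diagOp (b : OrthonormalBasis ι ℝ E) (f : ι → ℝ) : E →L[ℝ] E :=
  ∑ i, f i • (innerSL ℝ (b i)).smulRight (b i)

variable (b : OrthonormalBasis ι ℝ E)

theorem diagOp_apply (f : ι → ℝ) (x : E) : diagOp b f x = ∑ i, (f i * ⟪b i, x⟫) • b i := by
  simp [diagOp, smul_smul]

@[simp]
theorem inner_diagOp (f : ι → ℝ) (i : ι) (x : E) : ⟪b i, diagOp b f x⟫ = f i * ⟪b i, x⟫ := by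
  classical
  simp [diagOp_apply, inner_sum, inner_smul_right, b.inner_eq_ite]

theorem ext_inner_basis {x y : E} (h : ∀ i, ⟪b i, x⟫ = ⟪b i, y⟫) : x = y :=
  b.repr.injective (by ext i; simpa [b.repr_apply_apply] using h i)

theorem diagOp_one (x : E) : diagOp b (fun _ => 1) x = x :=
  ext_inner_basis b fun i => by simp

theorem diagOp_inv_cancel {f : ι → ℝ} (hf : ∀ i, f i ≠ 0) (x : E) :
    diagOp b f (diagOp b (fun i => (f i)⁻¹) x) = x :=
  ext_inner_basis b fun i => by simp [hf i]

theorem diagOp_inv_cancel' {f : ι → ℝ} (hf : ∀ i, f i ≠ 0) (x : E) :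
    diagOp b (fun i => (f i)⁻¹) (diagOp b f x) = x :=
  ext_inner_basis b fun i => by simp [hf i]

theorem inner_diagOp_left (f : ι → ℝ) (x y : E) :
    ⟪diagOp b f x, y⟫ = ∑ i, f i * (⟪b i, x⟫ * ⟪b i, y⟫) := by
  rw [← b.sum_inner_mul_inner]
  simp_rw [real_inner_comm (b _) (diagOp b f x), inner_diagOp, mul_assoc]

theorem norm_sq_eq_sum_inner (x : E) : ‖x‖ ^ 2 = ∑ i, ⟪b i, x⟫ ^ 2 :=
  (b.sum_sq_inner_right x).symm

theorem abs_inner_basis_le (i : ι) (x : E) : |⟪b i, x⟫| ≤ ‖x‖ := by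
  simpa using abs_real_inner_le_norm (b i) x

theorem norm_diagOp_apply_le {f : ι → ℝ} {C : ℝ} (hC : 0 ≤ C) (hf : ∀ i, |f i| ≤ C) (x : E) :
    ‖diagOp b f x‖ ≤ C * ‖x‖ := by
  refine le_of_sq_le_sq ?_ (by positivity)
  rw [norm_sq_eq_sum_inner b, mul_pow, norm_sq_eq_sum_inner b, Finset.mul_sum]
  refine Finset.sum_le_sum fun i _ => ?_
  rw [inner_diagOp, mul_pow]
  exact mul_le_mul_of_nonneg_right
    (sq_le_sq' (neg_le_of_abs_le (hf i)) (le_of_abs_le (hf i))) (sq_nonneg _)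

theorem det_diagOp [DecidableEq ι] (f : ι → ℝ) : (diagOp b f).det = ∏ i, f i := by
  have : LinearMap.toMatrix b.toBasis b.toBasis (diagOp b f : E →ₗ[ℝ] E) = Matrix.diagonal f := by
    ext i j
    rw [LinearMap.toMatrix_apply]
    simp only [OrthonormalBasis.coe_toBasis, OrthonormalBasis.coe_toBasis_repr_apply,
      OrthonormalBasis.repr_apply_apply, ContinuousLinearMap.coe_coe, inner_diagOp,
      b.inner_eq_ite, Matrix.diagonal_apply]
    split_ifs with h
    · simp [h]
    · simp
  change LinearMap.det (diagOp b f : E →ₗ[ℝ] E) = _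
  rw [← LinearMap.det_toMatrix b.toBasis, this, Matrix.det_diagonal]

theorem trace_eq_sum_inner (f : E →L[ℝ] E) :
    LinearMap.trace ℝ E (f : E →ₗ[ℝ] E) = ∑ i, ⟪b i, f (b i)⟫ := by
  rw [LinearMap.trace_eq_sum_inner (f : E →ₗ[ℝ] E) b]
  rfl

variable [FiniteDimensional ℝ E] [MeasurableSpace E] [BorelSpace E]

variable (E) in
/-- The normalizing constant of the standard Gaussian density. -/
def gaussNorm : ℝ := ∫ x : E, Real.exp (-‖x‖ ^ 2 / 2)

variable (E) in
theorem integrable_exp_neg_norm_sq : Integrable fun x : E => Real.exp (-‖x‖ ^ 2 / 2) := by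
  have h := (GaussianFourier.integrable_cexp_neg_mul_sq_norm_add (V := E) (b := 1 / 2)
    (by norm_num) 0 0).norm
  refine h.congr (ae_of_all _ fun x => ?_)
  simp only [Complex.norm_exp]
  congr 1
  rw [show (-(1 / 2 : ℂ) * (‖x‖ : ℂ) ^ 2 + 0 * ((⟪(0 : E), x⟫ : ℝ) : ℂ))
    = ((-‖x‖ ^ 2 / 2 : ℝ) : ℂ) by push_cast; ring, Complex.ofReal_re]

variable (E) in
theorem gaussNorm_pos : 0 < gaussNorm E :=
  integral_exp_pos (integrable_exp_neg_norm_sq E)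

/-- Comparison of characteristic functions through the Gaussian Fourier integral. Its constant is
identified with `gaussNorm` by evaluating it at frequency zero, so no explicit power of `π` is
carried further. -/
theorem stdGaussian_eq_withDensity : stdGaussian E =
    volume.withDensity fun x => ENNReal.ofReal ((gaussNorm E)⁻¹ * Real.exp (-‖x‖ ^ 2 / 2)) := by
  have hZ := gaussNorm_pos E
  have hint : Integrable fun x : E => (gaussNorm E)⁻¹ * Real.exp (-‖x‖ ^ 2 / 2) :=
    (integrable_exp_neg_norm_sq E).const_mul _
  have : IsFiniteMeasure ((volume : Measure E).withDensity fun x =>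
      ENNReal.ofReal ((gaussNorm E)⁻¹ * Real.exp (-‖x‖ ^ 2 / 2))) :=
    isFiniteMeasure_withDensity_ofReal hint.2
  have hform : ∀ w : E, ∫ v : E, Complex.exp (-(1 / 2 : ℂ) * ‖v‖ ^ 2 + Complex.I * ⟪w, v⟫)
      = gaussNorm E * Complex.exp (-‖w‖ ^ 2 / 2) := fun w => by
    have hb : 0 < (1 / 2 : ℂ).re := by norm_num
    have h0 := GaussianFourier.integral_cexp_neg_mul_sq_norm_add (V := E) hb 0 0
    have h1 := GaussianFourier.integral_cexp_neg_mul_sq_norm_add (V := E) hb Complex.I w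
    have h2 : (gaussNorm E : ℂ) = (Real.pi / (1 / 2 : ℂ)) ^ (finrank ℝ E / 2 : ℂ) := by
      rw [gaussNorm, ← integral_complex_ofReal]
      simp only [zero_mul, add_zero, ne_eq, OfNat.ofNat_ne_zero, not_false_eq_true, zero_pow,
        zero_div, Complex.exp_zero, mul_one] at h0
      rw [← h0]
      congr 1
      ext x
      push_cast
      congr 1
      ring
    rw [h1, h2, Complex.I_sq]
    congr 2
    ring
  refine Measure.ext_of_charFun ?_
  ext t
  rw [charFun_stdGaussian, charFun_apply,
    integral_withDensity_eq_integral_toReal_smul (by fun_prop) (by simp)]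
  have h3 : ∀ x : E, (ENNReal.ofReal ((gaussNorm E)⁻¹ * Real.exp (-‖x‖ ^ 2 / 2))).toReal •
      Complex.exp (⟪x, t⟫ * Complex.I) = ((gaussNorm E)⁻¹ : ℂ) *
        Complex.exp (-(1 / 2 : ℂ) * ‖x‖ ^ 2 + Complex.I * ⟪t, x⟫) := fun x => by
    rw [ENNReal.toReal_ofReal (by positivity), Complex.real_smul, Complex.exp_add,
      real_inner_comm t x]
    push_cast
    rw [mul_assoc]
    congr 2
    · congr 1; ring
    · rw [mul_comm]
  simp_rw [h3]
  rw [integral_const_mul, hform, ← mul_assoc, inv_mul_cancel₀ (by exact_mod_cast hZ.ne'), one_mul]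

/-- The density of the Gaussian law of `m + D z` for diagonal `D`. -/
theorem map_stdGaussian_affine {s : ι → ℝ} (hs : ∀ i, 0 < s i) (m : E) :
    (stdGaussian E).map (fun z => m + diagOp b s z) =
      volume.withDensity fun y => ENNReal.ofReal ((gaussNorm E)⁻¹ *
        Real.exp (-(∑ i, ((s i)⁻¹ * ⟪b i, y - m⟫) ^ 2) / 2) * ∏ i, (s i)⁻¹) := by
  classical
  have hs' : ∀ i, s i ≠ 0 := fun i => (hs i).ne'
  rw [stdGaussian_eq_withDensity]
  refine map_withDensity_of_det volume (S := fun y => diagOp b (fun i => (s i)⁻¹) (y - m))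
    (M := fun _ => diagOp b (fun i => (s i)⁻¹)) (fun y => ?_) (by fun_prop) (fun y => ?_)
    (fun z => ?_) (fun y => ?_)
  · exact (diagOp b _).hasFDerivAt.comp y ((hasFDerivAt_id y).sub_const m)
  · simp [diagOp_inv_cancel b hs']
  · simp [diagOp_inv_cancel' b hs']
  · rw [det_diagOp, abs_of_pos (Finset.prod_pos fun i _ => inv_pos.2 (hs i)),
      norm_sq_eq_sum_inner b]
    simp only [inner_diagOp]

end Gaussian

/-! ### Mehler's formula for the transition density -/

noncomputable section MehlerKernel

open Set Metric Module
open scoped NNReal RealInnerProductSpace ENNReal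

/-- The off-diagonal coefficient `a q / (1 - q²)` of the Mehler kernel, `q = e^{-ta}`. -/
def mehlerA (a t : ℝ) : ℝ := a * Real.exp (-t * a) / (1 - Real.exp (-t * a) ^ 2)

/-- The diagonal coefficient `a q² / (1 - q²)` of the Mehler kernel, `q = e^{-ta}`. -/
def mehlerB (a t : ℝ) : ℝ := a * Real.exp (-t * a) ^ 2 / (1 - Real.exp (-t * a) ^ 2)

/-- The logarithm of the normalization of the Mehler kernel. -/
def mehlerL (a t : ℝ) : ℝ := -(Real.log (1 - Real.exp (-t * a) ^ 2)) / 2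

section Coefficients

variable {a t : ℝ}

theorem one_sub_exp_sq_pos (ha : 0 < a) (ht : 0 < t) : 0 < 1 - Real.exp (-t * a) ^ 2 := by
  have h1 : Real.exp (-t * a) < 1 := Real.exp_lt_one_iff.2 (by nlinarith)
  nlinarith [Real.exp_pos (-t * a)]

theorem mehlerA_pos (ha : 0 < a) (ht : 0 < t) : 0 < mehlerA a t :=
  div_pos (mul_pos ha (Real.exp_pos _)) (one_sub_exp_sq_pos ha ht)

theorem mehlerB_pos (ha : 0 < a) (ht : 0 < t) : 0 < mehlerB a t :=
  div_pos (mul_pos ha (pow_pos (Real.exp_pos _) 2)) (one_sub_exp_sq_pos ha ht)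

/-- The relation which makes the kernel solve the backward equation, in `mehlerTime_eq`. It also
gives `A² / B = B + a`, which stays bounded at large times. -/
theorem mehlerA_sq (ha : 0 < a) (ht : 0 < t) :
    mehlerA a t ^ 2 = mehlerB a t * (mehlerB a t + a) := by
  have := (one_sub_exp_sq_pos ha ht).ne'
  unfold mehlerA mehlerB
  generalize Real.exp (-t * a) = q at *
  field_simp
  ring

/-- The difference equals `a q / (1 + q)` with `q = e^{-ta}`. The singularities of the two
coefficients at `t = 0` cancel. -/
theorem mehlerA_sub_mehlerB_le (ha : 0 < a) (ht : 0 < t) : mehlerA a t - mehlerB a t ≤ a / 2 := by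
  have h := one_sub_exp_sq_pos ha ht
  have hq := Real.exp_pos (-t * a)
  unfold mehlerA mehlerB
  rw [← sub_div, div_le_div_iff₀ h two_pos]
  nlinarith [sq_nonneg (1 - Real.exp (-t * a))]

theorem hasDerivAt_exp_neg_mul (a t : ℝ) :
    HasDerivAt (fun t => Real.exp (-t * a)) (-a * Real.exp (-t * a)) t := by
  have h : HasDerivAt (fun t : ℝ => -t * a) (-a) t := by
    simpa using ((hasDerivAt_id t).neg).mul_const a
  convert h.exp using 1
  ring

theorem hasDerivAt_one_sub_exp_sq (a t : ℝ) :
    HasDerivAt (fun t => 1 - Real.exp (-t * a) ^ 2) (2 * a * Real.exp (-t * a) ^ 2) t := by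
  refine (((hasDerivAt_exp_neg_mul a t).pow 2).const_sub 1).congr_deriv ?_
  push_cast
  ring

theorem hasDerivAt_mehlerA (ha : 0 < a) (ht : 0 < t) :
    HasDerivAt (mehlerA a) (-(mehlerA a t * (a + 2 * mehlerB a t))) t := by
  have h := (one_sub_exp_sq_pos ha ht).ne'
  refine (((hasDerivAt_exp_neg_mul a t).const_mul a).div
    (hasDerivAt_one_sub_exp_sq a t) h).congr_deriv ?_
  unfold mehlerA mehlerB
  generalize Real.exp (-t * a) = q at *
  field_simp
  ring

theorem hasDerivAt_mehlerB (ha : 0 < a) (ht : 0 < t) :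
    HasDerivAt (mehlerB a) (-(2 * mehlerA a t ^ 2)) t := by
  have h := (one_sub_exp_sq_pos ha ht).ne'
  refine ((((hasDerivAt_exp_neg_mul a t).pow 2).const_mul a).div
    (hasDerivAt_one_sub_exp_sq a t) h).congr_deriv ?_
  unfold mehlerA
  simp only [Pi.pow_apply]
  generalize Real.exp (-t * a) = q at *
  push_cast
  field_simp
  ring

theorem hasDerivAt_mehlerL (ha : 0 < a) (ht : 0 < t) :
    HasDerivAt (mehlerL a) (-mehlerB a t) t := by
  have h := (one_sub_exp_sq_pos ha ht).ne'
  refine ((((hasDerivAt_one_sub_exp_sq a t).log h).neg).div_const 2).congr_deriv ?_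
  unfold mehlerB
  field_simp

theorem continuousOn_mehlerA (ha : 0 < a) : ContinuousOn (mehlerA a) (Ioi 0) := fun _ ht =>
  (hasDerivAt_mehlerA ha ht).continuousAt.continuousWithinAt

theorem continuousOn_mehlerB (ha : 0 < a) : ContinuousOn (mehlerB a) (Ioi 0) := fun _ ht =>
  (hasDerivAt_mehlerB ha ht).continuousAt.continuousWithinAt

theorem continuousOn_mehlerL (ha : 0 < a) : ContinuousOn (mehlerL a) (Ioi 0) := fun _ ht =>
  (hasDerivAt_mehlerL ha ht).continuousAt.continuousWithinAt

end Coefficients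

variable {ι : Type*} [Fintype ι] {E : Type*} [NormedAddCommGroup E] [InnerProductSpace ℝ E]
variable (b : OrthonormalBasis ι ℝ E) (a : ι → ℝ)

/-- The exponent of the Mehler kernel. -/
def mehlerExp (t : ℝ) (x y : E) : ℝ :=
  ∑ i, (mehlerL (a i) t - mehlerB (a i) t * (⟪b i, x⟫ ^ 2 + ⟪b i, y⟫ ^ 2) / 2
    + mehlerA (a i) t * (⟪b i, x⟫ * ⟪b i, y⟫))

/-- Symmetry of the kernel is reversibility of the dynamics with respect to the Gaussian measure.
Through it the evolved law acquires the density `U_t e^{-V₀}`. -/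
theorem mehlerExp_comm (t : ℝ) (x y : E) : mehlerExp b a t x y = mehlerExp b a t y x :=
  Finset.sum_congr rfl fun i _ => by ring

/-- The Gaussian measure with covariance diagonal in `b`, with entries `1 / a i`. -/
def diagGaussian [FiniteDimensional ℝ E] [MeasurableSpace E] [BorelSpace E] : Measure E :=
  (stdGaussian E).map (diagOp b fun i => (√(a i))⁻¹)

/-- The standard deviations of the Ornstein–Uhlenbeck noise. -/
def ouDev (t : ℝ) (i : ι) : ℝ := √((1 - Real.exp (-t * a i) ^ 2) / a i)

variable [FiniteDimensional ℝ E] [MeasurableSpace E] [BorelSpace E]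

instance : IsProbabilityMeasure (diagGaussian b a) :=
  Measure.isProbabilityMeasure_map (by fun_prop)

/-- The Ornstein–Uhlenbeck transition law from `x`. -/
def ouKernel (t : ℝ) (x : E) : Measure E :=
  (stdGaussian E).map fun z => diagOp b (fun i => Real.exp (-t * a i)) x + diagOp b (ouDev a t) z

variable {a}

/-- The Lebesgue density of `diagGaussian`. -/
def diagGaussianPDF (a : ι → ℝ) (y : E) : ℝ :=
  (gaussNorm E)⁻¹ * Real.exp (-(∑ i, a i * ⟪b i, y⟫ ^ 2) / 2) * ∏ i, √(a i)

theorem measurable_diagGaussianPDF : Measurable (diagGaussianPDF b a) := by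
  unfold diagGaussianPDF
  fun_prop

theorem diagGaussianPDF_pos (ha : ∀ i, 0 < a i) (y : E) : 0 < diagGaussianPDF b a y :=
  mul_pos (mul_pos (inv_pos.2 (gaussNorm_pos E)) (Real.exp_pos _))
    (Finset.prod_pos fun i _ => Real.sqrt_pos.2 (ha i))

theorem diagGaussian_eq_withDensity (ha : ∀ i, 0 < a i) :
    diagGaussian b a = volume.withDensity fun y => ENNReal.ofReal (diagGaussianPDF b a y) := by
  have h := map_stdGaussian_affine b (s := fun i => (√(a i))⁻¹)
    (fun i => inv_pos.2 (Real.sqrt_pos.2 (ha i))) 0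
  simp only [zero_add] at h
  rw [diagGaussian, h]
  congr 1
  ext y
  simp only [inv_inv, sub_zero, diagGaussianPDF, mul_pow]
  simp_rw [Real.sq_sqrt (ha _).le]

omit [FiniteDimensional ℝ E] [MeasurableSpace E] [BorelSpace E] in
theorem continuous_mehlerExp (t : ℝ) (x : E) : Continuous (mehlerExp b a t x) := by
  unfold mehlerExp
  fun_prop

/-- **Mehler's formula.** -/
theorem ouKernel_eq_withDensity (ha : ∀ i, 0 < a i) {t : ℝ} (ht : 0 < t) (x : E) :
    ouKernel b a t x =
      (diagGaussian b a).withDensity fun y => ENNReal.ofReal (Real.exp (mehlerExp b a t x y)) := by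
  have hq : ∀ i, 0 < 1 - Real.exp (-t * a i) ^ 2 := fun i => one_sub_exp_sq_pos (ha i) ht
  have hσ : ∀ i, 0 < ouDev a t i := fun i => Real.sqrt_pos.2 (div_pos (hq i) (ha i))
  have hc := (continuous_mehlerExp b (a := a) t x).measurable
  rw [ouKernel, map_stdGaussian_affine b hσ, diagGaussian_eq_withDensity b ha,
    ← withDensity_mul _ (measurable_diagGaussianPDF b).ennreal_ofReal (by fun_prop)]
  congr 1
  ext y
  rw [Pi.mul_apply, ← ENNReal.ofReal_mul (diagGaussianPDF_pos b ha y).le]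
  congr 1
  have hprod : ∏ i, (ouDev a t i)⁻¹ = (∏ i, √(a i)) * Real.exp (∑ i, mehlerL (a i) t) := by
    rw [Real.exp_sum, ← Finset.prod_mul_distrib]
    refine Finset.prod_congr rfl fun i _ => ?_
    have h1 : Real.exp (mehlerL (a i) t) = (√(1 - Real.exp (-t * a i) ^ 2))⁻¹ := by
      rw [mehlerL, neg_div, Real.exp_neg, ← Real.log_sqrt (hq i).le,
        Real.exp_log (Real.sqrt_pos.2 (hq i))]
    rw [h1, ouDev, Real.sqrt_div (hq i).le, inv_div, div_eq_mul_inv]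
  -- The product of the inverse deviations supplies the factors `√a` of the Gaussian density and the
  -- exponential of `mehlerL`; what remains is an identity of exponents, checked coordinate by
  -- coordinate.
  suffices hkey : -(∑ i, ((ouDev a t i)⁻¹ *
      ⟪b i, y - diagOp b (fun i => Real.exp (-t * a i)) x⟫) ^ 2) / 2 + ∑ i, mehlerL (a i) t
      = -(∑ i, a i * ⟪b i, y⟫ ^ 2) / 2 + mehlerExp b a t x y by
    have h1 := congrArg Real.exp hkey
    rw [Real.exp_add, Real.exp_add] at h1
    rw [hprod, diagGaussianPDF]
    linear_combination (gaussNorm E)⁻¹ * (∏ i, √(a i)) * h1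
  rw [mehlerExp, ← sub_eq_zero]
  have e1 : ∀ f : ι → ℝ, -(∑ i, f i) / 2 = ∑ i, -(f i) / 2 := fun f => by
    rw [← Finset.sum_neg_distrib, Finset.sum_div]
  rw [e1, e1, ← Finset.sum_add_distrib, ← Finset.sum_add_distrib, ← Finset.sum_sub_distrib]
  refine Finset.sum_eq_zero fun i _ => ?_
  have h2 : ((ouDev a t i)⁻¹ * ⟪b i, y - diagOp b (fun i => Real.exp (-t * a i)) x⟫) ^ 2
      = (⟪b i, y⟫ - Real.exp (-t * a i) * ⟪b i, x⟫) ^ 2 * a i / (1 - Real.exp (-t * a i) ^ 2) := by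
    rw [mul_pow, inv_pow, ouDev, Real.sq_sqrt (div_pos (hq i) (ha i)).le, inner_sub_right,
      inner_diagOp]
    field_simp
  rw [h2, mehlerA, mehlerB]
  have := (hq i).ne'
  generalize Real.exp (-t * a i) = q at *
  field_simp
  ring

end MehlerKernel

/-! ### Derivatives and uniform bounds of the Mehler kernel -/

noncomputable section MehlerCalculus

open Set Metric Module
open scoped NNReal RealInnerProductSpace ENNReal

variable {ι : Type*} [Fintype ι] {E : Type*} [NormedAddCommGroup E] [InnerProductSpace ℝ E]
variable (b : OrthonormalBasis ι ℝ E) (a : ι → ℝ)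

/-- The gradient in `x` of the exponent of the Mehler kernel. -/
def mehlerGrad (t : ℝ) (x y : E) : E :=
  diagOp b (fun i => mehlerA (a i) t) y - diagOp b (fun i => mehlerB (a i) t) x

/-- The time derivative of the exponent of the Mehler kernel. -/
def mehlerTime (t : ℝ) (x y : E) : ℝ :=
  ∑ i, (-mehlerB (a i) t + mehlerA (a i) t ^ 2 * (⟪b i, x⟫ ^ 2 + ⟪b i, y⟫ ^ 2)
    - mehlerA (a i) t * (a i + 2 * mehlerB (a i) t) * (⟪b i, x⟫ * ⟪b i, y⟫))

/-- The second derivative of the Mehler kernel divided by the kernel. -/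
def mehlerHess (t : ℝ) (x y : E) : E →L[ℝ] E :=
  (innerSL ℝ (mehlerGrad b a t x y)).smulRight (mehlerGrad b a t x y)
    - diagOp b (fun i => mehlerB (a i) t)

variable {a}

theorem inner_mehlerGrad (t : ℝ) (x y : E) (i : ι) : ⟪b i, mehlerGrad b a t x y⟫ =
    mehlerA (a i) t * ⟪b i, y⟫ - mehlerB (a i) t * ⟪b i, x⟫ := by
  rw [mehlerGrad, inner_sub_right, inner_diagOp, inner_diagOp]

theorem hasFDerivAt_mehlerExp (t : ℝ) (x y : E) :
    HasFDerivAt (fun x => mehlerExp b a t x y) (innerSL ℝ (mehlerGrad b a t x y)) x := by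
  have h : ∀ i, HasFDerivAt (fun x : E => ⟪b i, x⟫) (innerSL ℝ (b i)) x := fun i =>
    (innerSL ℝ (b i)).hasFDerivAt
  have h1 := HasFDerivAt.fun_sum (u := Finset.univ) fun i (_ : i ∈ Finset.univ) =>
    ((((((h i).pow 2).add_const (⟪b i, y⟫ ^ 2)).const_mul (mehlerB (a i) t)).mul_const
      (1 / 2)).const_sub (mehlerL (a i) t)).add
      (((h i).mul_const ⟪b i, y⟫).const_mul (mehlerA (a i) t))
  refine (h1.congr_fderiv ?_).congr_of_eventuallyEq (Eventually.of_forall fun z => ?_)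
  · ext w
    rw [innerSL_apply_apply, ← b.sum_inner_mul_inner]
    simp only [_root_.sum_apply]
    refine Finset.sum_congr rfl fun i _ => ?_
    rw [real_inner_comm (b i), inner_mehlerGrad]
    simp
    ring
  · simp only [mehlerExp]
    refine Finset.sum_congr rfl fun i _ => ?_
    simp
    ring

theorem hasDerivAt_mehlerExp (ha : ∀ i, 0 < a i) {t : ℝ} (ht : 0 < t) (x y : E) :
    HasDerivAt (fun t => mehlerExp b a t x y) (mehlerTime b a t x y) t := by
  have h1 := HasDerivAt.fun_sum (u := Finset.univ) fun i (_ : i ∈ Finset.univ) =>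
    ((hasDerivAt_mehlerL (ha i) ht).sub (((hasDerivAt_mehlerB (ha i) ht).mul_const
      (⟪b i, x⟫ ^ 2 + ⟪b i, y⟫ ^ 2)).div_const 2)).add
      ((hasDerivAt_mehlerA (ha i) ht).mul_const (⟪b i, x⟫ * ⟪b i, y⟫))
  refine h1.congr_deriv (Finset.sum_congr rfl fun i _ => ?_)
  ring

/-- The Mehler kernel solves the Ornstein–Uhlenbeck backward equation. -/
theorem mehlerTime_eq (ha : ∀ i, 0 < a i) {t : ℝ} (ht : 0 < t) (x y : E) :
    mehlerTime b a t x y = ∑ i, ⟪b i, mehlerHess b a t x y (b i)⟫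
      - ⟪diagOp b a x, mehlerGrad b a t x y⟫ := by
  classical
  rw [inner_diagOp_left, mehlerTime, ← Finset.sum_sub_distrib]
  refine Finset.sum_congr rfl fun i _ => ?_
  have h := mehlerA_sq (ha i) ht
  simp only [mehlerHess, _root_.sub_apply, ContinuousLinearMap.smulRight_apply,
    innerSL_apply_apply, inner_sub_right, inner_smul_right, inner_diagOp,
    real_inner_comm (b i) (mehlerGrad b a t x y), inner_mehlerGrad, b.inner_eq_ite, if_true]
  linear_combination (⟪b i, x⟫ ^ 2) * h

section Bounds

theorem exists_uniform_bound {f : ι → ℝ → ℝ} (hf : ∀ i, ContinuousOn (f i) (Ioi 0)) {t₀ : ℝ}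
    (ht₀ : 0 < t₀) (T : ℝ) : ∃ C, 0 < C ∧ ∀ i, ∀ t ∈ Icc t₀ T, |f i t| ≤ C := by
  have h : ∀ i, ∃ C, ∀ t ∈ Icc t₀ T, ‖f i t‖ ≤ C := fun i =>
    isCompact_Icc.exists_bound_of_continuousOn ((hf i).mono fun t ht => ht₀.trans_le ht.1)
  choose C hC using h
  refine ⟨1 + ∑ i, |C i|, by positivity, fun i t ht => ?_⟩
  have h1 : |C i| ≤ ∑ i, |C i| :=
    Finset.single_le_sum (f := fun i => |C i|) (fun j _ => abs_nonneg _) (Finset.mem_univ i)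
  have := hC i t ht
  rw [Real.norm_eq_abs] at this
  linarith [le_abs_self (C i)]

/-- The cross term is absorbed by completing the square, at the cost of half of the negative
quadratic term in `y`. The remaining half beats any polynomial in `y`. -/
theorem mehlerExp_le (ha : ∀ i, 0 < a i) {t : ℝ} (ht : 0 < t) (x y : E) :
    mehlerExp b a t x y ≤ ∑ i, (mehlerL (a i) t
      + mehlerA (a i) t ^ 2 / mehlerB (a i) t * ⟪b i, x⟫ ^ 2
      - mehlerB (a i) t * ⟪b i, y⟫ ^ 2 / 4) := by
  refine Finset.sum_le_sum fun i _ => ?_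
  have hB := mehlerB_pos (ha i) ht
  set A := mehlerA (a i) t
  set B := mehlerB (a i) t
  set X := ⟪b i, x⟫
  set Y := ⟪b i, y⟫
  have h1 : A * (X * Y) ≤ A ^ 2 / B * X ^ 2 + B * Y ^ 2 / 4 := by
    have h2 : A ^ 2 / B * X ^ 2 + B * Y ^ 2 / 4 - A * (X * Y) = (A * X - B * Y / 2) ^ 2 / B := by
      field_simp
      ring
    have : 0 ≤ (A * X - B * Y / 2) ^ 2 / B := by positivity
    linarith
  nlinarith [mul_nonneg hB.le (sq_nonneg X)]

theorem one_add_sq_mul_exp_le {κ : ℝ} (hκ : 0 < κ) (r : ℝ) :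
    (1 + r) ^ 2 * Real.exp (-(κ * r ^ 2)) ≤ 2 + 2 / κ := by
  rw [Real.exp_neg, ← div_eq_mul_inv, div_le_iff₀ (Real.exp_pos _)]
  have h1 := Real.add_one_le_exp (κ * r ^ 2)
  have h2 : (1 + r) ^ 2 ≤ 2 + 2 * r ^ 2 := by nlinarith [sq_nonneg (1 - r)]
  have h3 : 2 + 2 * r ^ 2 ≤ (2 + 2 / κ) * (κ * r ^ 2 + 1) := by
    have : (2 + 2 / κ) * (κ * r ^ 2 + 1) = 2 * κ * r ^ 2 + 2 + 2 * r ^ 2 + 2 / κ := by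
      field_simp
      ring
    rw [this]
    have h4 : 0 ≤ 2 * κ * r ^ 2 := by positivity
    have h5 : 0 ≤ 2 / κ := by positivity
    linarith
  calc (1 + r) ^ 2 ≤ (2 + 2 / κ) * (κ * r ^ 2 + 1) := h2.trans h3
    _ ≤ _ := by gcongr

/-- The weight `(1 + ‖y‖)²` is there because the Hessian and time-derivative factors of the kernel
grow quadratically in `y`. -/
theorem exists_mehlerExp_bound (ha : ∀ i, 0 < a i) {t₀ : ℝ} (ht₀ : 0 < t₀) (T R : ℝ) :
    ∃ C, 0 ≤ C ∧ ∀ t ∈ Icc t₀ T, ∀ x : E, ‖x‖ ≤ R → ∀ y : E,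
      (1 + ‖y‖) ^ 2 * Real.exp (mehlerExp b a t x y) ≤ C := by
  obtain ⟨CL, hCL0, hCL⟩ := exists_uniform_bound (fun i => continuousOn_mehlerL (ha i)) ht₀ T
  obtain ⟨CA, hCA0, hCA⟩ := exists_uniform_bound (fun i => ((continuousOn_mehlerA (ha i)).pow 2).div
    (continuousOn_mehlerB (ha i)) fun t ht => (mehlerB_pos (ha i) ht).ne') ht₀ T
  obtain ⟨CB, hCB0, hCB⟩ := exists_uniform_bound (fun i => (continuousOn_mehlerB (ha i)).inv₀
    fun t ht => (mehlerB_pos (ha i) ht).ne') ht₀ T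
  set κ : ℝ := CB⁻¹ / 4 with hκ
  have hκ0 : 0 < κ := by positivity
  refine ⟨Real.exp (∑ _i : ι, (CL + CA * R ^ 2)) * (2 + 2 / κ), by positivity,
    fun t ht x hx y => ?_⟩
  have ht0 : 0 < t := ht₀.trans_le ht.1
  have h1 : mehlerExp b a t x y ≤ ∑ _i : ι, (CL + CA * R ^ 2) + -(κ * ‖y‖ ^ 2) := by
    refine (mehlerExp_le b ha ht0 x y).trans ?_
    rw [norm_sq_eq_sum_inner b y, Finset.mul_sum, ← Finset.sum_neg_distrib,
      ← Finset.sum_add_distrib]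
    refine Finset.sum_le_sum fun i _ => ?_
    have e1 : mehlerL (a i) t ≤ CL := (le_abs_self _).trans (hCL i t ht)
    have e2 : mehlerA (a i) t ^ 2 / mehlerB (a i) t * ⟪b i, x⟫ ^ 2 ≤ CA * R ^ 2 := by
      refine mul_le_mul ((le_abs_self _).trans (hCA i t ht)) ?_ (sq_nonneg _) hCA0.le
      exact sq_le_sq' (by linarith [neg_le_of_abs_le (abs_inner_basis_le b i x)])
        ((le_of_abs_le (abs_inner_basis_le b i x)).trans hx)
    have e3 : CB⁻¹ ≤ mehlerB (a i) t := by
      rw [inv_le_comm₀ hCB0 (mehlerB_pos (ha i) ht0)]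
      exact (le_abs_self _).trans (hCB i t ht)
    have e4 : κ * ⟪b i, y⟫ ^ 2 ≤ mehlerB (a i) t * ⟪b i, y⟫ ^ 2 / 4 := by
      rw [hκ]
      nlinarith [mul_le_mul_of_nonneg_right e3 (sq_nonneg ⟪b i, y⟫)]
    linarith
  calc (1 + ‖y‖) ^ 2 * Real.exp (mehlerExp b a t x y)
      ≤ (1 + ‖y‖) ^ 2 * (Real.exp (∑ _i : ι, (CL + CA * R ^ 2)) * Real.exp (-(κ * ‖y‖ ^ 2))) := by
        rw [← Real.exp_add]; gcongr
    _ = Real.exp (∑ _i : ι, (CL + CA * R ^ 2)) * ((1 + ‖y‖) ^ 2 * Real.exp (-(κ * ‖y‖ ^ 2))) := by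
        ring
    _ ≤ _ := by gcongr; exact one_add_sq_mul_exp_le hκ0 _

theorem norm_mehlerHess_le {t : ℝ} {C : ℝ} (hC : 0 ≤ C) (hB : ∀ i, |mehlerB (a i) t| ≤ C)
    (x y : E) : ‖mehlerHess b a t x y‖ ≤ ‖mehlerGrad b a t x y‖ ^ 2 + C := by
  refine (norm_sub_le _ _).trans (add_le_add ?_ ?_)
  · rw [ContinuousLinearMap.norm_smulRight_apply, innerSL_apply_norm, sq]
  · exact ContinuousLinearMap.opNorm_le_bound _ hC fun z => norm_diagOp_apply_le b hC hB z

theorem norm_mehlerGrad_le {t : ℝ} {C C' : ℝ} (hC : 0 ≤ C) (hA : ∀ i, |mehlerA (a i) t| ≤ C)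
    (hC' : 0 ≤ C') (hB : ∀ i, |mehlerB (a i) t| ≤ C') (x y : E) :
    ‖mehlerGrad b a t x y‖ ≤ C * ‖y‖ + C' * ‖x‖ :=
  (norm_sub_le _ _).trans (add_le_add (norm_diagOp_apply_le b hC hA y)
    (norm_diagOp_apply_le b hC' hB x))

/-- The Mehler kernel and its derivatives are bounded for `t` in a compact subset of `(0, ∞)` and
`x` in a bounded set. -/
theorem exists_mehler_bounds (ha : ∀ i, 0 < a i) {t₀ : ℝ} (ht₀ : 0 < t₀) (T R : ℝ) :
    ∃ C, 0 ≤ C ∧ ∀ t ∈ Icc t₀ T, ∀ x : E, ‖x‖ ≤ R → ∀ y : E,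
      Real.exp (mehlerExp b a t x y) ≤ C ∧
      Real.exp (mehlerExp b a t x y) * ‖mehlerGrad b a t x y‖ ≤ C ∧
      Real.exp (mehlerExp b a t x y) * ‖mehlerHess b a t x y‖ ≤ C ∧
      Real.exp (mehlerExp b a t x y) * |mehlerTime b a t x y| ≤ C := by
  obtain ⟨C₀, hC₀0, hC₀⟩ := exists_mehlerExp_bound b ha ht₀ T (max R 0)
  obtain ⟨CA, hCA0, hCA⟩ := exists_uniform_bound (fun i => continuousOn_mehlerA (ha i)) ht₀ T
  obtain ⟨CB, hCB0, hCB⟩ := exists_uniform_bound (fun i => continuousOn_mehlerB (ha i)) ht₀ T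
  obtain ⟨Ca, hCa0, hCa⟩ := exists_uniform_bound (f := fun i _ => a i)
    (fun i => continuousOn_const) ht₀ T
  set R' := max R 0
  have hR' : 0 ≤ R' := le_max_right _ _
  set G : ℝ := CA + CB * R' with hG
  set H : ℝ := G ^ 2 + CB with hH
  set N : ℝ := (Fintype.card ι : ℝ) with hN
  have hG0 : 0 ≤ G := by positivity
  have hH0 : 0 ≤ H := by positivity
  set K : ℝ := 1 + G + H + (N * H + Ca * R' * G) with hK
  have hK0 : 0 ≤ K := by positivity
  refine ⟨C₀ * K, by positivity, fun t ht x hx y => ?_⟩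
  have ht0 := ht₀.trans_le ht.1
  have hx' : ‖x‖ ≤ R' := hx.trans (le_max_left _ _)
  set e := Real.exp (mehlerExp b a t x y)
  have he : 0 ≤ e := (Real.exp_pos _).le
  have hbase : (1 + ‖y‖) ^ 2 * e ≤ C₀ := hC₀ t ht x hx' y
  have hy := norm_nonneg y
  have hone : 1 ≤ (1 + ‖y‖) := by linarith
  have hone2 : 1 ≤ (1 + ‖y‖) ^ 2 := one_le_pow₀ hone
  have hle2 : (1 + ‖y‖) ≤ (1 + ‖y‖) ^ 2 := by nlinarith
  have gen : ∀ w k : ℝ, w ≤ k * (1 + ‖y‖) ^ 2 → 0 ≤ k → k ≤ K → e * w ≤ C₀ * K :=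
    fun w k hw hk0 hk => by
      calc e * w ≤ e * (k * (1 + ‖y‖) ^ 2) := by gcongr
        _ = ((1 + ‖y‖) ^ 2 * e) * k := by ring
        _ ≤ C₀ * K := mul_le_mul hbase hk hk0 hC₀0
  have hNH : 0 ≤ N * H := by positivity
  have hCG : 0 ≤ Ca * R' * G := by positivity
  have hgrad : ‖mehlerGrad b a t x y‖ ≤ G * (1 + ‖y‖) := by
    refine (norm_mehlerGrad_le b hCA0.le (fun i => hCA i t ht) hCB0.le (fun i => hCB i t ht)
      x y).trans ?_
    have : CB * ‖x‖ ≤ CB * R' := by gcongr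
    have h2 : 0 ≤ CB * R' := by positivity
    rw [hG]
    nlinarith
  have hhess : ‖mehlerHess b a t x y‖ ≤ H * (1 + ‖y‖) ^ 2 := by
    refine (norm_mehlerHess_le b hCB0.le (fun i => hCB i t ht) x y).trans ?_
    have : ‖mehlerGrad b a t x y‖ ^ 2 ≤ (G * (1 + ‖y‖)) ^ 2 := by gcongr
    rw [hH]
    nlinarith
  refine ⟨?_, ?_, ?_, ?_⟩
  · have := gen 1 1 (by linarith) zero_le_one (by rw [hK]; linarith)
    simpa using this
  · exact gen _ G (hgrad.trans (by gcongr)) hG0 (by rw [hK]; linarith)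
  · exact gen _ H hhess hH0 (by rw [hK]; linarith)
  · refine gen _ (N * H + Ca * R' * G) ?_ (by positivity) (by rw [hK]; linarith)
    rw [mehlerTime_eq b ha ht0]
    refine (abs_sub _ _).trans ?_
    have h1 : |∑ i, ⟪b i, mehlerHess b a t x y (b i)⟫| ≤ N * (H * (1 + ‖y‖) ^ 2) := by
      refine (Finset.abs_sum_le_sum_abs _ _).trans ?_
      have : ∀ i ∈ Finset.univ, |⟪b i, mehlerHess b a t x y (b i)⟫| ≤ H * (1 + ‖y‖) ^ 2 :=
        fun i _ => by
          refine (abs_inner_basis_le b i _).trans ?_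
          have := (mehlerHess b a t x y).le_opNorm (b i)
          rw [b.norm_eq_one, mul_one] at this
          exact this.trans hhess
      refine (Finset.sum_le_sum this).trans ?_
      simp [hN]
    have h2 : |⟪diagOp b a x, mehlerGrad b a t x y⟫| ≤ (Ca * R') * (G * (1 + ‖y‖)) := by
      refine (abs_real_inner_le_norm _ _).trans ?_
      refine mul_le_mul ?_ hgrad (norm_nonneg _) (by positivity)
      exact (norm_diagOp_apply_le b hCa0.le (fun i => hCa i t ht) x).trans (by gcongr)
    nlinarith [mul_le_mul_of_nonneg_left hle2 hCG]

end Bounds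

end MehlerCalculus

/-! ### Mehler integrals against a finite measure -/

noncomputable section MehlerIntegral

open Set Metric Module
open scoped NNReal RealInnerProductSpace ENNReal

variable {ι : Type*} [Fintype ι] {E : Type*} [NormedAddCommGroup E] [InnerProductSpace ℝ E]
variable (b : OrthonormalBasis ι ℝ E) (a : ι → ℝ)
variable [MeasurableSpace E] (ν : Measure E)

/-- The integral of the Mehler kernel against a measure. -/
def mehlerInt (t : ℝ) (x : E) : ℝ := ∫ y, Real.exp (mehlerExp b a t x y) ∂ν

/-- The gradient of `mehlerInt`. -/
def mehlerIntGrad (t : ℝ) (x : E) : E :=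
  ∫ y, Real.exp (mehlerExp b a t x y) • mehlerGrad b a t x y ∂ν

/-- The Hessian of `mehlerInt`. -/
def mehlerIntHess (t : ℝ) (x : E) : E →L[ℝ] E :=
  ∫ y, Real.exp (mehlerExp b a t x y) • mehlerHess b a t x y ∂ν

/-- The time derivative of `mehlerInt`. -/
def mehlerIntTime (t : ℝ) (x : E) : ℝ :=
  ∫ y, Real.exp (mehlerExp b a t x y) * mehlerTime b a t x y ∂ν

variable {a}

omit [MeasurableSpace E] in
theorem continuous_mehlerGrad (t : ℝ) (x : E) : Continuous (mehlerGrad b a t x) := by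
  unfold mehlerGrad
  fun_prop

omit [MeasurableSpace E] in
theorem continuous_mehlerHess (t : ℝ) (x : E) : Continuous (mehlerHess b a t x) := by
  have h := continuous_mehlerGrad b (a := a) t x
  have h1 : Continuous fun y => innerSL ℝ (mehlerGrad b a t x y) := (innerSL ℝ).continuous.comp h
  have h2 : Continuous fun p : (E →L[ℝ] ℝ) × E => p.1.smulRight p.2 :=
    isBoundedBilinearMap_smulRight.continuous
  exact (h2.comp (h1.prodMk h)).sub continuous_const

omit [MeasurableSpace E] in
theorem continuous_mehlerTime (t : ℝ) (x : E) : Continuous (mehlerTime b a t x) := by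
  unfold mehlerTime
  fun_prop

omit [MeasurableSpace E] in
theorem continuousAt_mehlerExp_param (ha : ∀ i, 0 < a i) {p : ℝ × E} (hp : 0 < p.1) (y : E) :
    ContinuousAt (fun p : ℝ × E => mehlerExp b a p.1 p.2 y) p := by
  have hA : ∀ i, ContinuousAt (fun p : ℝ × E => mehlerA (a i) p.1) p := fun i =>
    ContinuousAt.comp (f := Prod.fst) (hasDerivAt_mehlerA (ha i) hp).continuousAt continuousAt_fst
  have hB : ∀ i, ContinuousAt (fun p : ℝ × E => mehlerB (a i) p.1) p := fun i =>
    ContinuousAt.comp (f := Prod.fst) (hasDerivAt_mehlerB (ha i) hp).continuousAt continuousAt_fst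
  have hL : ∀ i, ContinuousAt (fun p : ℝ × E => mehlerL (a i) p.1) p := fun i =>
    ContinuousAt.comp (f := Prod.fst) (hasDerivAt_mehlerL (ha i) hp).continuousAt continuousAt_fst
  unfold mehlerExp
  refine tendsto_finsetSum _ fun i _ => ?_
  have h1 : ContinuousAt (fun p : ℝ × E => ⟪b i, p.2⟫) p := by fun_prop
  exact ((hL i).sub (((hB i).mul ((h1.pow 2).add continuousAt_const)).div_const 2)).add
    ((hA i).mul (h1.mul continuousAt_const))

omit [MeasurableSpace E] in
theorem continuousAt_diagOp_param {f : ι → ℝ → ℝ} {p : ℝ × E}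
    (hf : ∀ i, ContinuousAt (f i) p.1) :
    ContinuousAt (fun p : ℝ × E => diagOp b (fun i => f i p.1)) p :=
  tendsto_finsetSum _ fun i _ =>
    (ContinuousAt.comp (f := Prod.fst) (hf i) continuousAt_fst).smul continuousAt_const

omit [MeasurableSpace E] in
theorem continuousAt_mehlerGrad_param (ha : ∀ i, 0 < a i) {p : ℝ × E} (hp : 0 < p.1) (y : E) :
    ContinuousAt (fun p : ℝ × E => mehlerGrad b a p.1 p.2 y) p :=
  ((continuousAt_diagOp_param b fun i => (hasDerivAt_mehlerA (ha i) hp).continuousAt).clm_apply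
    continuousAt_const).sub ((continuousAt_diagOp_param b fun i =>
      (hasDerivAt_mehlerB (ha i) hp).continuousAt).clm_apply continuousAt_snd)

omit [MeasurableSpace E] in
theorem continuousAt_mehlerHess_param (ha : ∀ i, 0 < a i) {p : ℝ × E} (hp : 0 < p.1) (y : E) :
    ContinuousAt (fun p : ℝ × E => mehlerHess b a p.1 p.2 y) p := by
  have h := continuousAt_mehlerGrad_param b ha hp y
  have h1 : ContinuousAt (fun p : ℝ × E => innerSL ℝ (mehlerGrad b a p.1 p.2 y)) p :=
    (innerSL ℝ).continuous.continuousAt.comp h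
  have h2 : Continuous fun p : (E →L[ℝ] ℝ) × E => p.1.smulRight p.2 :=
    isBoundedBilinearMap_smulRight.continuous
  exact (h2.continuousAt.comp (h1.prodMk h)).sub
    (continuousAt_diagOp_param b fun i => (hasDerivAt_mehlerB (ha i) hp).continuousAt)

omit [MeasurableSpace E] in
theorem hasFDerivAt_mehlerGrad (t : ℝ) (x y : E) :
    HasFDerivAt (fun x => mehlerGrad b a t x y) (-diagOp b (fun i => mehlerB (a i) t)) x :=
  ((diagOp b (fun i => mehlerB (a i) t)).hasFDerivAt (x := x)).const_sub
    (diagOp b (fun i => mehlerA (a i) t) y)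

omit [MeasurableSpace E] in
theorem hasFDerivAt_exp_smul_mehlerGrad (t : ℝ) (x y : E) :
    HasFDerivAt (fun x => Real.exp (mehlerExp b a t x y) • mehlerGrad b a t x y)
      (Real.exp (mehlerExp b a t x y) • mehlerHess b a t x y) x := by
  refine ((hasFDerivAt_mehlerExp b t x y).exp.smul (hasFDerivAt_mehlerGrad b t x y)).congr_fderiv ?_
  ext z
  simp [mehlerHess, smul_smul, smul_sub]
  abel

omit [InnerProductSpace ℝ E] [MeasurableSpace E] in
/-- A neighbourhood on which the Mehler kernel is bounded. -/
theorem eventually_mehler_mem {p : ℝ × E} (hp : 0 < p.1) :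
    ∀ᶠ q : ℝ × E in 𝓝 p, q.1 ∈ Icc (p.1 / 2) (p.1 + 1) ∧ ‖q.2‖ ≤ ‖p.2‖ + 1 := by
  have h1 : ∀ᶠ s : ℝ in 𝓝 p.1, s ∈ Icc (p.1 / 2) (p.1 + 1) :=
    Icc_mem_nhds (by linarith) (by linarith)
  have h2 : ∀ᶠ x : E in 𝓝 p.2, ‖x‖ ≤ ‖p.2‖ + 1 :=
    (continuous_norm.tendsto p.2).eventually (ge_mem_nhds (by linarith))
  exact (continuous_fst.continuousAt.eventually h1).and (continuous_snd.continuousAt.eventually h2)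

variable [BorelSpace E] [FiniteDimensional ℝ E] [IsFiniteMeasure ν]

section Continuity

variable {p : ℝ × E} (ha : ∀ i, 0 < a i) (hp : 0 < p.1)
include ha hp

-- The bounds on the kernel are uniform in the integration variable, so a constant dominates and
-- finiteness of the measure suffices. No moment is needed, here or for the derivatives below.
omit [FiniteDimensional ℝ E] in
theorem continuousAt_mehlerInt [SecondCountableTopology E] :
    ContinuousAt (fun p : ℝ × E => mehlerInt b a ν p.1 p.2) p := by
  obtain ⟨C, -, hC⟩ := exists_mehler_bounds b ha (half_pos hp) (p.1 + 1) (‖p.2‖ + 1)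
  refine continuousAt_of_dominated (bound := fun _ => C) (Eventually.of_forall fun q =>
    (Real.continuous_exp.comp (continuous_mehlerExp b q.1 q.2)).aestronglyMeasurable) ?_
    (integrable_const C) (ae_of_all _ fun y =>
      Real.continuous_exp.continuousAt.comp (continuousAt_mehlerExp_param b ha hp y))
  filter_upwards [eventually_mehler_mem hp] with q hq
  refine ae_of_all _ fun y => ?_
  rw [Real.norm_eq_abs, abs_of_pos (Real.exp_pos _)]
  exact (hC q.1 hq.1 q.2 hq.2 y).1

theorem continuousAt_mehlerIntGrad :
    ContinuousAt (fun p : ℝ × E => mehlerIntGrad b a ν p.1 p.2) p := by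
  obtain ⟨C, -, hC⟩ := exists_mehler_bounds b ha (half_pos hp) (p.1 + 1) (‖p.2‖ + 1)
  refine continuousAt_of_dominated (bound := fun _ => C) (Eventually.of_forall fun q =>
    ((Real.continuous_exp.comp (continuous_mehlerExp b q.1 q.2)).smul
      (continuous_mehlerGrad b q.1 q.2)).aestronglyMeasurable) ?_
    (integrable_const C) (ae_of_all _ fun y =>
      (Real.continuous_exp.continuousAt.comp (continuousAt_mehlerExp_param b ha hp y)).smul
        (continuousAt_mehlerGrad_param b ha hp y))
  filter_upwards [eventually_mehler_mem hp] with q hq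
  refine ae_of_all _ fun y => ?_
  rw [norm_smul, Real.norm_eq_abs, abs_of_pos (Real.exp_pos _)]
  exact (hC q.1 hq.1 q.2 hq.2 y).2.1

theorem continuousAt_mehlerIntHess :
    ContinuousAt (fun p : ℝ × E => mehlerIntHess b a ν p.1 p.2) p := by
  obtain ⟨C, -, hC⟩ := exists_mehler_bounds b ha (half_pos hp) (p.1 + 1) (‖p.2‖ + 1)
  refine continuousAt_of_dominated (bound := fun _ => C) (Eventually.of_forall fun q =>
    ((Real.continuous_exp.comp (continuous_mehlerExp b q.1 q.2)).smul
      (continuous_mehlerHess b q.1 q.2)).aestronglyMeasurable) ?_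
    (integrable_const C) (ae_of_all _ fun y =>
      (Real.continuous_exp.continuousAt.comp (continuousAt_mehlerExp_param b ha hp y)).smul
        (continuousAt_mehlerHess_param b ha hp y))
  filter_upwards [eventually_mehler_mem hp] with q hq
  refine ae_of_all _ fun y => ?_
  rw [norm_smul, Real.norm_eq_abs, abs_of_pos (Real.exp_pos _)]
  exact (hC q.1 hq.1 q.2 hq.2 y).2.2.1

end Continuity

section Derivatives

variable (ha : ∀ i, 0 < a i) {t : ℝ} (ht : 0 < t) (x : E)
include ha ht

omit [FiniteDimensional ℝ E] in
theorem integrable_exp_mehlerExp [SecondCountableTopology E] :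
    Integrable (fun y => Real.exp (mehlerExp b a t x y)) ν := by
  obtain ⟨C, -, hC⟩ := exists_mehler_bounds b ha ht t ‖x‖
  refine (integrable_const C).mono'
    (Real.continuous_exp.comp (continuous_mehlerExp b t x)).aestronglyMeasurable
    (ae_of_all _ fun y => ?_)
  rw [Real.norm_eq_abs, abs_of_pos (Real.exp_pos _)]
  exact (hC t ⟨le_rfl, le_rfl⟩ x le_rfl y).1

theorem integrable_exp_smul_mehlerGrad :
    Integrable (fun y => Real.exp (mehlerExp b a t x y) • mehlerGrad b a t x y) ν := by
  obtain ⟨C, -, hC⟩ := exists_mehler_bounds b ha ht t ‖x‖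
  refine (integrable_const C).mono'
    ((Real.continuous_exp.comp (continuous_mehlerExp b t x)).smul
      (continuous_mehlerGrad b t x)).aestronglyMeasurable (ae_of_all _ fun y => ?_)
  rw [norm_smul, Real.norm_eq_abs, abs_of_pos (Real.exp_pos _)]
  exact (hC t ⟨le_rfl, le_rfl⟩ x le_rfl y).2.1

theorem integrable_exp_smul_mehlerHess :
    Integrable (fun y => Real.exp (mehlerExp b a t x y) • mehlerHess b a t x y) ν := by
  obtain ⟨C, -, hC⟩ := exists_mehler_bounds b ha ht t ‖x‖
  refine (integrable_const C).mono'
    ((Real.continuous_exp.comp (continuous_mehlerExp b t x)).smul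
      (continuous_mehlerHess b t x)).aestronglyMeasurable (ae_of_all _ fun y => ?_)
  rw [norm_smul, Real.norm_eq_abs, abs_of_pos (Real.exp_pos _)]
  exact (hC t ⟨le_rfl, le_rfl⟩ x le_rfl y).2.2.1

theorem hasFDerivAt_mehlerInt :
    HasFDerivAt (mehlerInt b a ν t) (innerSL ℝ (mehlerIntGrad b a ν t x)) x := by
  obtain ⟨C, -, hC⟩ := exists_mehler_bounds b ha ht t (‖x‖ + 1)
  have h := hasFDerivAt_integral_of_dominated_of_fderiv_le (𝕜 := ℝ) (μ := ν) (bound := fun _ => C)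
    (F := fun x y => Real.exp (mehlerExp b a t x y))
    (F' := fun x y => Real.exp (mehlerExp b a t x y) • innerSL ℝ (mehlerGrad b a t x y))
    (x₀ := x) (ball_mem_nhds x one_pos) (Eventually.of_forall fun q =>
      (Real.continuous_exp.comp (continuous_mehlerExp b t q)).aestronglyMeasurable)
    (integrable_exp_mehlerExp b ν ha ht x)
    ((Real.continuous_exp.comp (continuous_mehlerExp b t x)).smul
      ((innerSL ℝ).continuous.comp (continuous_mehlerGrad b t x))).aestronglyMeasurable
    (ae_of_all _ fun y z hz => ?_) (integrable_const C)
    (ae_of_all _ fun y z _ => (hasFDerivAt_mehlerExp b t z y).exp)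
  · refine h.congr_fderiv ?_
    ext w
    have hint := integrable_exp_smul_mehlerGrad b ν ha ht x
    rw [innerSL_apply_apply, mehlerIntGrad, real_inner_comm, ← integral_inner hint,
      ContinuousLinearMap.integral_apply]
    · refine integral_congr_ae (ae_of_all _ fun y => ?_)
      simp [inner_smul_right, real_inner_comm w]
    · refine (hint.norm).mono' ((Real.continuous_exp.comp (continuous_mehlerExp b t x)).smul
        ((innerSL ℝ).continuous.comp (continuous_mehlerGrad b t x))).aestronglyMeasurable
        (ae_of_all _ fun y => ?_)
      rw [norm_smul, norm_smul, innerSL_apply_norm]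
  · rw [norm_smul, innerSL_apply_norm, Real.norm_eq_abs, abs_of_pos (Real.exp_pos _)]
    refine (hC t ⟨le_rfl, le_rfl⟩ z ?_ y).2.1
    have := norm_add_le x (z - x)
    rw [add_sub_cancel] at this
    rw [mem_ball, dist_eq_norm] at hz
    linarith

theorem hasFDerivAt_mehlerIntGrad :
    HasFDerivAt (mehlerIntGrad b a ν t) (mehlerIntHess b a ν t x) x := by
  obtain ⟨C, -, hC⟩ := exists_mehler_bounds b ha ht t (‖x‖ + 1)
  refine hasFDerivAt_integral_of_dominated_of_fderiv_le (𝕜 := ℝ) (μ := ν) (bound := fun _ => C)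
    (F := fun x y => Real.exp (mehlerExp b a t x y) • mehlerGrad b a t x y)
    (F' := fun x y => Real.exp (mehlerExp b a t x y) • mehlerHess b a t x y)
    (x₀ := x) (ball_mem_nhds x one_pos) (Eventually.of_forall fun q =>
      ((Real.continuous_exp.comp (continuous_mehlerExp b t q)).smul
        (continuous_mehlerGrad b t q)).aestronglyMeasurable)
    (integrable_exp_smul_mehlerGrad b ν ha ht x)
    ((Real.continuous_exp.comp (continuous_mehlerExp b t x)).smul
      (continuous_mehlerHess b t x)).aestronglyMeasurable
    (ae_of_all _ fun y z hz => ?_) (integrable_const C)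
    (ae_of_all _ fun y z _ => hasFDerivAt_exp_smul_mehlerGrad b t z y)
  rw [norm_smul, Real.norm_eq_abs, abs_of_pos (Real.exp_pos _)]
  refine (hC t ⟨le_rfl, le_rfl⟩ z ?_ y).2.2.1
  have := norm_add_le x (z - x)
  rw [add_sub_cancel] at this
  rw [mem_ball, dist_eq_norm] at hz
  linarith

/-- The backward equation `∂_t U = ΔU - ⟨Ax, ∇U⟩`, obtained by integrating the pointwise identity
`mehlerTime_eq` for the kernel. -/
theorem mehlerIntTime_eq : mehlerIntTime b a ν t x =
    LinearMap.trace ℝ E (mehlerIntHess b a ν t x : E →ₗ[ℝ] E)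
      - ⟪diagOp b a x, mehlerIntGrad b a ν t x⟫ := by
  have hH := integrable_exp_smul_mehlerHess b ν ha ht x
  have hG := integrable_exp_smul_mehlerGrad b ν ha ht x
  have hHi : ∀ i, Integrable (fun y => ⟪b i, (Real.exp (mehlerExp b a t x y) •
      mehlerHess b a t x y) (b i)⟫) ν := fun i =>
    (hH.apply_continuousLinearMap (b i)).const_inner (b i)
  rw [trace_eq_sum_inner b, mehlerIntHess, mehlerIntGrad, ← integral_inner hG]
  simp_rw [ContinuousLinearMap.integral_apply hH, ← integral_inner
    (hH.apply_continuousLinearMap _)]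
  rw [← integral_finsetSum _ fun i _ => hHi i, ← integral_sub (integrable_finsetSum _ fun i _ =>
    hHi i) (hG.const_inner _)]
  refine integral_congr_ae (ae_of_all _ fun y => ?_)
  simp only [mehlerTime_eq b ha ht, _root_.smul_apply, inner_smul_right]
  rw [mul_sub, Finset.mul_sum]

omit [FiniteDimensional ℝ E] in
theorem hasDerivAt_mehlerInt_time [SecondCountableTopology E] :
    HasDerivAt (fun t => mehlerInt b a ν t x) (mehlerIntTime b a ν t x) t := by
  obtain ⟨C, -, hC⟩ := exists_mehler_bounds b ha (half_pos ht) (t + 1) ‖x‖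
  refine (hasDerivAt_integral_of_dominated_loc_of_deriv_le (μ := ν) (bound := fun _ => C)
    (F := fun t y => Real.exp (mehlerExp b a t x y))
    (F' := fun t y => Real.exp (mehlerExp b a t x y) * mehlerTime b a t x y)
    (x₀ := t) (s := Icc (t / 2) (t + 1)) (Icc_mem_nhds (by linarith) (by linarith))
    (Eventually.of_forall fun q =>
      (Real.continuous_exp.comp (continuous_mehlerExp b q x)).aestronglyMeasurable) ?_
    ((Real.continuous_exp.comp (continuous_mehlerExp b t x)).mul
      (continuous_mehlerTime b t x)).aestronglyMeasurable
    (ae_of_all _ fun y s hs => ?_) (integrable_const C)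
    (ae_of_all _ fun y s hs =>
      (hasDerivAt_mehlerExp b ha ((half_pos ht).trans_le hs.1) x y).exp)).2
  · refine (integrable_const C).mono'
      (Real.continuous_exp.comp (continuous_mehlerExp b t x)).aestronglyMeasurable
      (ae_of_all _ fun y => ?_)
    rw [Real.norm_eq_abs, abs_of_pos (Real.exp_pos _)]
    exact (hC t ⟨by linarith, by linarith⟩ x le_rfl y).1
  · rw [norm_mul, Real.norm_eq_abs, Real.norm_eq_abs, abs_of_pos (Real.exp_pos _)]
    exact (hC s hs x le_rfl y).2.2.2

/-- Joint differentiability in time and space. -/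
theorem hasFDerivAt_mehlerInt_prod :
    HasFDerivAt (fun p : ℝ × E => mehlerInt b a ν p.1 p.2)
      (((ContinuousLinearMap.id ℝ ℝ).smulRight (mehlerIntTime b a ν t x)).coprod
        (innerSL ℝ (mehlerIntGrad b a ν t x))) (t, x) := by
  have hp : 0 < ((t, x) : ℝ × E).1 := ht
  have hpos : ∀ᶠ q : ℝ × E in 𝓝 (t, x), 0 < q.1 :=
    continuous_fst.continuousAt.eventually (lt_mem_nhds ht)
  have hG := continuousAt_mehlerIntGrad b ν ha hp
  have hH := continuousAt_mehlerIntHess b ν ha hp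
  -- Joint continuity of the time derivative is read off from the backward equation, since the
  -- gradient and the Hessian are already known to be continuous.
  have hT : ContinuousAt (fun p : ℝ × E => mehlerIntTime b a ν p.1 p.2) (t, x) := by
    have h1 : ContinuousAt (fun p : ℝ × E => ∑ i, ⟪b i, mehlerIntHess b a ν p.1 p.2 (b i)⟫
        - ⟪diagOp b a p.2, mehlerIntGrad b a ν p.1 p.2⟫) (t, x) := by
      refine ContinuousAt.sub (tendsto_finsetSum _ fun i _ => ?_) ?_
      · exact continuousAt_const.inner (hH.clm_apply continuousAt_const)
      · exact ((diagOp b a).continuous.continuousAt.comp continuousAt_snd).inner hG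
    refine h1.congr ?_
    filter_upwards [hpos] with q hq
    rw [mehlerIntTime_eq b ν ha hq, trace_eq_sum_inner b]
  refine (hasStrictFDerivAt_uncurry_coprod (f := mehlerInt b a ν) (𝕜 := ℝ) (u := (t, x))
    (f₁ := fun t x => (ContinuousLinearMap.id ℝ ℝ).smulRight (mehlerIntTime b a ν t x))
    (f₂ := fun t x => innerSL ℝ (mehlerIntGrad b a ν t x)) ?_ ?_ ?_ ?_).hasFDerivAt
  · filter_upwards [hpos] with q hq
    exact hasDerivAt_iff_hasFDerivAt.1 (hasDerivAt_mehlerInt_time b ν ha hq q.2)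
  · filter_upwards [hpos] with q hq
    exact hasFDerivAt_mehlerInt b ν ha hq q.2
  · exact (ContinuousLinearMap.smulRightL ℝ ℝ ℝ (ContinuousLinearMap.id ℝ ℝ)).continuous
      |>.continuousAt.comp hT
  · exact (innerSL ℝ).continuous.continuousAt.comp hG

end Derivatives

end MehlerIntegral

/-! ### Small times: the kernel away from the diagonal -/

noncomputable section SmallTime

open Set Metric Module
open scoped NNReal RealInnerProductSpace ENNReal

section Coefficients

variable {a t : ℝ}

theorem half_mul_le_one_sub_exp_sq (ha : 0 < a) (ht : 0 < t) (hta : t * a ≤ 1 / 8) :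
    t * a / 2 ≤ 1 - Real.exp (-t * a) ^ 2 := by
  have hta0 : 0 < t * a := mul_pos ht ha
  have h1 : Real.exp (-t * a) ≤ 1 / (1 + t * a) := by
    rw [neg_mul, Real.exp_neg, ← one_div]
    exact one_div_le_one_div_of_le (by linarith) (by linarith [Real.add_one_le_exp (t * a)])
  have h2 : Real.exp (-t * a) ≤ 1 - t * a / 2 := by
    refine h1.trans ?_
    rw [div_le_iff₀ (by linarith)]
    nlinarith
  nlinarith [Real.exp_pos (-t * a)]

theorem mehlerA_le_of_small (ha : 0 < a) (ht : 0 < t) (hta : t * a ≤ 1 / 8) :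
    mehlerA a t ≤ 2 / t := by
  have h1 := half_mul_le_one_sub_exp_sq ha ht hta
  have h2 : Real.exp (-t * a) ≤ 1 := Real.exp_le_one_iff.2 (by nlinarith)
  rw [mehlerA, div_le_div_iff₀ (one_sub_exp_sq_pos ha ht) ht]
  have h3 := mul_le_mul_of_nonneg_left h2 (mul_pos ht ha).le
  linarith

theorem mehlerB_le_mehlerA (ha : 0 < a) (ht : 0 < t) : mehlerB a t ≤ mehlerA a t := by
  have h2 : Real.exp (-t * a) ≤ 1 := Real.exp_le_one_iff.2 (by nlinarith)
  have := one_sub_exp_sq_pos ha ht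
  have := Real.exp_pos (-t * a)
  unfold mehlerA mehlerB
  gcongr
  nlinarith

theorem le_mehlerA_sub_of_small (ha : 0 < a) (ht : 0 < t) (hta : t * a ≤ 1 / 8) :
    1 / (8 * t) ≤ mehlerA a t - a := by
  have h1 : 1 - t * a ≤ Real.exp (-t * a) := by
    linarith [Real.add_one_le_exp (-t * a)]
  have h2 : Real.exp (-t * a) ≤ 1 := Real.exp_le_one_iff.2 (by nlinarith)
  have h0 := one_sub_exp_sq_pos ha ht
  have h3 : 1 - Real.exp (-t * a) ^ 2 ≤ 2 * (t * a) := by nlinarith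
  have h4 : 1 / (4 * t) ≤ mehlerA a t := by
    rw [mehlerA, div_le_div_iff₀ (by positivity) h0]
    nlinarith
  have h5 : a ≤ 1 / (8 * t) := by
    rw [le_div_iff₀ (by positivity)]
    linarith
  have h6 : 1 / (4 * t) = 1 / (8 * t) + 1 / (8 * t) := by field_simp; norm_num
  linarith

/-- The inverse square root is bounded by the inverse, since `1 - q²` is at most one. This loses a
power of `t`, but only polynomial blow-up matters against `e^{-c/t}`. -/
theorem exp_mehlerL_le_of_small (ha : 0 < a) (ht : 0 < t) (hta : t * a ≤ 1 / 8) :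
    Real.exp (mehlerL a t) ≤ 2 / (t * a) := by
  have hq := one_sub_exp_sq_pos ha ht
  have h1 := half_mul_le_one_sub_exp_sq ha ht hta
  have h2 : Real.exp (mehlerL a t) = (√(1 - Real.exp (-t * a) ^ 2))⁻¹ := by
    rw [mehlerL, neg_div, Real.exp_neg, ← Real.log_sqrt hq.le, Real.exp_log (Real.sqrt_pos.2 hq)]
  rw [h2, inv_le_comm₀ (Real.sqrt_pos.2 hq) (by positivity), inv_div]
  refine h1.trans ?_
  refine Real.le_sqrt_of_sq_le ?_
  nlinarith [sq_nonneg (Real.exp (-t * a))]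

end Coefficients

variable {ι : Type*} [Fintype ι] {E : Type*} [NormedAddCommGroup E] [InnerProductSpace ℝ E]
variable (b : OrthonormalBasis ι ℝ E) {a : ι → ℝ}

/-- With coordinates `X`, `Y`, the quadratic part is `-A (Y - X)² / 2 + (A - B) (X² + Y²) / 2`. The
last coefficient stays bounded, and `Y² ≤ 2 (Y - X)² + 2 X²` moves the dependence on `Y` into the
first term, where `A - a ≥ 1 / (8t)` absorbs it. -/
theorem mehlerExp_le_of_small (ha : ∀ i, 0 < a i) {t : ℝ} (ht : 0 < t)
    (hta : ∀ i, t * a i ≤ 1 / 8) (x y : E) :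
    mehlerExp b a t x y ≤
      ∑ i, (mehlerL (a i) t + a i * ⟪b i, x⟫ ^ 2) - 1 / (16 * t) * ‖y - x‖ ^ 2 := by
  rw [norm_sq_eq_sum_inner b, Finset.mul_sum, ← Finset.sum_sub_distrib]
  refine Finset.sum_le_sum fun i _ => ?_
  rw [inner_sub_right]
  have h1 := mehlerA_sub_mehlerB_le (ha i) ht
  have h2 := le_mehlerA_sub_of_small (ha i) ht (hta i)
  have h3 : 1 / (16 * t) = 1 / (8 * t) / 2 := by field_simp; norm_num
  rw [h3]
  set A := mehlerA (a i) t
  set B := mehlerB (a i) t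
  set X := ⟪b i, x⟫
  set Y := ⟪b i, y⟫
  have h4 := mul_le_mul_of_nonneg_right h1 (by positivity : 0 ≤ X ^ 2 + Y ^ 2)
  have h5 := mul_le_mul_of_nonneg_right h2 (sq_nonneg (Y - X))
  have h6 : Y ^ 2 ≤ 2 * (Y - X) ^ 2 + 2 * X ^ 2 := by nlinarith [sq_nonneg (Y - 2 * X)]
  have h7 := mul_le_mul_of_nonneg_left h6 (ha i).le
  nlinarith [mul_nonneg (ha i).le (sq_nonneg X)]

theorem tendsto_inv_pow_mul_exp_neg (k : ℕ) {c : ℝ} (hc : 0 < c) :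
    Tendsto (fun t : ℝ => (1 / t) ^ k * Real.exp (-(c / t))) (𝓝[>] 0) (𝓝 0) := by
  have h1 : Tendsto (fun t : ℝ => c / t) (𝓝[>] 0) atTop := by
    simp_rw [div_eq_mul_inv]
    exact tendsto_inv_nhdsGT_zero.const_mul_atTop hc
  have h2 := ((Real.tendsto_pow_mul_exp_neg_atTop_nhds_zero k).comp h1).const_mul ((1 / c) ^ k)
  rw [mul_zero] at h2
  refine h2.congr fun t => ?_
  simp only [Function.comp]
  rw [← mul_assoc, ← mul_pow]
  congr 2
  field_simp

set_option maxHeartbeats 1000000 in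
/-- Away from the diagonal the Mehler kernel and its space derivatives vanish as `t → 0`. -/
theorem eventually_mehler_far_le (ha : ∀ i, 0 < a i) (R : ℝ) {ε : ℝ} (hε : 0 < ε) :
    ∀ᶠ t in 𝓝[>] (0 : ℝ), ∀ x y : E, ‖x‖ ≤ R → 1 ≤ ‖y - x‖ →
      Real.exp (mehlerExp b a t x y) ≤ ε ∧
      Real.exp (mehlerExp b a t x y) * ‖mehlerGrad b a t x y‖ ≤ ε ∧
      Real.exp (mehlerExp b a t x y) * ‖mehlerHess b a t x y‖ ≤ ε := by
  set R' := max R 0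
  have hR' : 0 ≤ R' := le_max_right _ _
  set n := Fintype.card ι
  set P : ℝ := ∏ i, (2 / a i) with hP
  have hP0 : 0 < P := Finset.prod_pos fun i _ => div_pos two_pos (ha i)
  set X : ℝ := Real.exp (∑ i, a i * R' ^ 2)
  set K : ℝ := 100 * P * X * (1 + 2 * R') ^ 2 * 66 with hK
  have hK0 : 0 < K := by positivity
  have hlim := (tendsto_inv_pow_mul_exp_neg (n + 2) (by norm_num : (0 : ℝ) < 1 / 32)).const_mul K
  rw [mul_zero] at hlim
  have hsmall : ∀ᶠ t in 𝓝[>] (0 : ℝ), t ≤ 1 ∧ ∀ i, t * a i ≤ 1 / 8 := by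
    refine mem_nhdsWithin_of_mem_nhds (Filter.Eventually.and (ge_mem_nhds one_pos)
      (eventually_all.2 fun i => ?_))
    have : Tendsto (fun t : ℝ => t * a i) (𝓝 0) (𝓝 0) :=
      (continuous_mul_const (a i)).tendsto' _ _ (zero_mul _)
    exact this.eventually (ge_mem_nhds (by norm_num))
  filter_upwards [hlim.eventually (gt_mem_nhds hε), hsmall, self_mem_nhdsWithin]
    with t htε ⟨ht1, hta⟩ ht x y hx hxy
  have ht : 0 < t := ht
  have hx' : ‖x‖ ≤ R' := hx.trans (le_max_left _ _)
  set r := ‖y - x‖ with hr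
  have hr0 : 0 ≤ r := norm_nonneg _
  set e := Real.exp (mehlerExp b a t x y) with he
  have he0 : 0 < e := Real.exp_pos _
  have hy : ‖y‖ ≤ r + R' := by
    have := norm_add_le (y - x) x
    rw [sub_add_cancel] at this
    linarith
  have hexp : e ≤ P * (1 / t) ^ n * X * Real.exp (-(1 / (16 * t) * r ^ 2)) := by
    have h1 := mehlerExp_le_of_small b ha ht hta x y
    have h2 : ∑ i, a i * ⟪b i, x⟫ ^ 2 ≤ ∑ i, a i * R' ^ 2 := by
      refine Finset.sum_le_sum fun i _ => mul_le_mul_of_nonneg_left ?_ (ha i).le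
      exact sq_le_sq' (by linarith [neg_le_of_abs_le (abs_inner_basis_le b i x)])
        ((le_of_abs_le (abs_inner_basis_le b i x)).trans hx')
    have h3 : Real.exp (∑ i, mehlerL (a i) t) ≤ P * (1 / t) ^ n := by
      have h4 : P * (1 / t) ^ n = ∏ i, (2 / a i * (1 / t)) := by
        rw [Finset.prod_mul_distrib, Finset.prod_const, Finset.card_univ]
      rw [Real.exp_sum, h4]
      refine Finset.prod_le_prod (fun i _ => (Real.exp_pos _).le) fun i _ => ?_
      refine (exp_mehlerL_le_of_small (ha i) ht (hta i)).trans (le_of_eq ?_)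
      have := (ha i).ne'
      field_simp
    rw [Finset.sum_add_distrib] at h1
    calc e ≤ Real.exp (∑ i, mehlerL (a i) t + ∑ i, a i * R' ^ 2 + -(1 / (16 * t) * r ^ 2)) :=
          Real.exp_le_exp.2 (by linarith)
      _ = Real.exp (∑ i, mehlerL (a i) t) * X * Real.exp (-(1 / (16 * t) * r ^ 2)) := by
          rw [Real.exp_add, Real.exp_add]
      _ ≤ _ := by gcongr
  -- The Gaussian factor is split into two equal halves. One absorbs the polynomial in `r`; the
  -- other, since `r ≥ 1`, gives the exponential smallness in `1 / t`.
  have hrexp : (1 + r) ^ 2 * Real.exp (-(1 / (16 * t) * r ^ 2)) ≤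
      66 * Real.exp (-(1 / 32 / t)) := by
    have h1 := one_add_sq_mul_exp_le (by positivity : 0 < 1 / (32 * t)) r
    have h2 : 2 + 2 / (1 / (32 * t)) ≤ 66 := by
      have : 2 / (1 / (32 * t)) = 64 * t := by field_simp; norm_num
      rw [this]; linarith
    have h3 : Real.exp (-(1 / (32 * t) * r ^ 2)) ≤ Real.exp (-(1 / 32 / t)) := by
      refine Real.exp_le_exp.2 (neg_le_neg ?_)
      rw [div_div]
      have : 1 ≤ r ^ 2 := one_le_pow₀ hxy
      exact le_mul_of_one_le_right (by positivity) this
    have h4 : Real.exp (-(1 / (16 * t) * r ^ 2)) =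
        Real.exp (-(1 / (32 * t) * r ^ 2)) * Real.exp (-(1 / (32 * t) * r ^ 2)) := by
      rw [← Real.exp_add]
      congr 1
      field_simp
      norm_num
    rw [h4, ← mul_assoc]
    exact mul_le_mul (h1.trans h2) h3 (Real.exp_pos _).le (by norm_num)
  have hmain : e * (100 * (1 / t) ^ 2 * ((1 + 2 * R') * (1 + r)) ^ 2) ≤ ε := by
    refine le_trans ?_ htε.le
    calc e * (100 * (1 / t) ^ 2 * ((1 + 2 * R') * (1 + r)) ^ 2)
        ≤ (P * (1 / t) ^ n * X * Real.exp (-(1 / (16 * t) * r ^ 2))) *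
          (100 * (1 / t) ^ 2 * ((1 + 2 * R') * (1 + r)) ^ 2) := by gcongr
      _ = (100 * P * X * (1 + 2 * R') ^ 2) * (1 / t) ^ (n + 2) *
          ((1 + r) ^ 2 * Real.exp (-(1 / (16 * t) * r ^ 2))) := by ring
      _ ≤ (100 * P * X * (1 + 2 * R') ^ 2) * (1 / t) ^ (n + 2) *
          (66 * Real.exp (-(1 / 32 / t))) := by gcongr
      _ = K * ((1 / t) ^ (n + 2) * Real.exp (-(1 / 32 / t))) := by rw [hK]; ring
  have ht1' : 1 ≤ 1 / t := by rw [le_div_iff₀ ht]; linarith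
  -- One unit for all derivatives: the gradient is at most `2 D` and the Hessian at most `6 D²`, so
  -- the single bound with `100 D²` covers the three claims.
  set D : ℝ := (1 / t) * ((1 + 2 * R') * (1 + r)) with hD
  have hD1 : 1 ≤ D := by
    have : 1 ≤ (1 + 2 * R') * (1 + r) := one_le_mul_of_one_le_of_one_le (by linarith) (by linarith)
    exact one_le_mul_of_one_le_of_one_le ht1' this
  have hmain' : e * (100 * D ^ 2) ≤ ε := by
    convert hmain using 1
    rw [hD]; ring
  have hA : ∀ i, |mehlerA (a i) t| ≤ 2 / t := fun i => by
    rw [abs_of_pos (mehlerA_pos (ha i) ht)]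
    exact mehlerA_le_of_small (ha i) ht (hta i)
  have hB : ∀ i, |mehlerB (a i) t| ≤ 2 / t := fun i => by
    rw [abs_of_pos (mehlerB_pos (ha i) ht)]
    exact (mehlerB_le_mehlerA (ha i) ht).trans (mehlerA_le_of_small (ha i) ht (hta i))
  have hgrad : ‖mehlerGrad b a t x y‖ ≤ 2 * D := by
    refine (norm_mehlerGrad_le b (by positivity) hA (by positivity) hB x y).trans ?_
    have h1 : ‖y‖ + ‖x‖ ≤ (1 + 2 * R') * (1 + r) := by nlinarith
    calc 2 / t * ‖y‖ + 2 / t * ‖x‖ = 2 * ((1 / t) * (‖y‖ + ‖x‖)) := by ring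
      _ ≤ 2 * D := by rw [hD]; gcongr
  have hhess : ‖mehlerHess b a t x y‖ ≤ 6 * D ^ 2 := by
    refine (norm_mehlerHess_le b (by positivity) hB x y).trans ?_
    have h1 : ‖mehlerGrad b a t x y‖ ^ 2 ≤ (2 * D) ^ 2 := by gcongr
    have h2 : 2 / t ≤ 2 * D := by
      rw [hD]
      have : 1 ≤ (1 + 2 * R') * (1 + r) :=
        one_le_mul_of_one_le_of_one_le (by linarith) (by linarith)
      calc 2 / t = 2 * (1 / t * 1) := by ring
        _ ≤ _ := by gcongr
    nlinarith
  have gen : ∀ w : ℝ, w ≤ 100 * D ^ 2 → e * w ≤ ε := fun w hw =>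
    (mul_le_mul_of_nonneg_left hw he0.le).trans hmain'
  refine ⟨?_, gen _ (hgrad.trans (by nlinarith)), gen _ (hhess.trans (by nlinarith))⟩
  simpa using gen 1 (by nlinarith)

end SmallTime

/-! ### The semigroup on bounded smooth functions -/

noncomputable section NearField

open Set Metric Module
open scoped NNReal RealInnerProductSpace ENNReal

variable {ι : Type*} [Fintype ι] {E : Type*} [NormedAddCommGroup E] [InnerProductSpace ℝ E]
variable (b : OrthonormalBasis ι ℝ E) (a : ι → ℝ)

/-- The gradient, computed in an orthonormal basis. -/
def basisGrad (f : E → ℝ) (x : E) : E := ∑ i, fderiv ℝ f x (b i) • b i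

theorem innerSL_basisGrad (f : E → ℝ) (x : E) : innerSL ℝ (basisGrad b f x) = fderiv ℝ f x := by
  ext w
  rw [innerSL_apply_apply, basisGrad, sum_inner]
  conv_rhs => rw [← b.sum_repr' w, map_sum]
  refine Finset.sum_congr rfl fun i _ => ?_
  rw [real_inner_smul_left, map_smul, smul_eq_mul, mul_comm]

theorem contDiff_basisGrad {f : E → ℝ} (hf : ContDiff ℝ ∞ f) : ContDiff ℝ ∞ (basisGrad b f) := by
  have : ContDiff ℝ ∞ (fderiv ℝ f) := hf.fderiv_right (by simp)
  unfold basisGrad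
  fun_prop

theorem hasCompactSupport_basisGrad {f : E → ℝ} (hf : HasCompactSupport f) :
    HasCompactSupport (basisGrad b f) :=
  (hf.fderiv (𝕜 := ℝ)).comp_left (g := fun L : E →L[ℝ] ℝ => ∑ i, L (b i) • b i) (by simp)

variable [FiniteDimensional ℝ E] [MeasurableSpace E] [BorelSpace E]

/-- The Ornstein–Uhlenbeck semigroup applied to a vector-valued function. -/
def ouMean {G : Type*} [NormedAddCommGroup G] [NormedSpace ℝ G] (g : E → G) (t : ℝ) (x : E) : G :=
  ∫ z, g (diagOp b (fun i => Real.exp (-t * a i)) x + diagOp b (ouDev a t) z) ∂stdGaussian E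

theorem ouMean_eq_integral {G : Type*} [NormedAddCommGroup G] [NormedSpace ℝ G] {g : E → G}
    (hg : Continuous g) (t : ℝ) (x : E) : ouMean b a g t x = ∫ y, g y ∂(ouKernel b a t x) := by
  rw [ouKernel, integral_map (by fun_prop) hg.aestronglyMeasurable]
  rfl

variable {G : Type*} [NormedAddCommGroup G] [NormedSpace ℝ G] {g : E → G}

omit [Fintype ι] in
theorem continuous_ouDev (i : ι) : Continuous fun t => ouDev a t i := by
  unfold ouDev
  fun_prop

theorem continuous_ouMean (hg : Continuous g) {C : ℝ} (hC : ∀ y, ‖g y‖ ≤ C) :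
    Continuous fun p : ℝ × E => ouMean b a g p.1 p.2 := by
  refine continuous_of_dominated (bound := fun _ => C) (fun p => ?_) (fun p => ae_of_all _ fun z =>
    hC _) (integrable_const C) (ae_of_all _ fun z => ?_)
  · exact (hg.comp (by fun_prop)).aestronglyMeasurable
  · have h1 : Continuous fun p : ℝ × E => diagOp b (fun i => Real.exp (-p.1 * a i)) := by
      unfold diagOp; fun_prop
    have h2 : Continuous fun p : ℝ × E => diagOp b (ouDev a p.1) := by
      have := continuous_ouDev a
      unfold diagOp
      fun_prop
    exact hg.comp ((h1.clm_apply continuous_snd).add (h2.clm_apply continuous_const))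

/-- Here the derivative falls on the function instead of on the kernel. The resulting formula has no
singularity at `t = 0`, unlike the differentiated Mehler kernel. -/
theorem hasFDerivAt_ouMean [CompleteSpace G] (hg : Continuous g) {C : ℝ} (hC : ∀ y, ‖g y‖ ≤ C)
    {g' : E → E →L[ℝ] G}
    (hg' : Continuous g') {C' : ℝ} (hC' : ∀ y, ‖g' y‖ ≤ C') (hd : ∀ y, HasFDerivAt g (g' y) y)
    (t : ℝ) (x : E) : HasFDerivAt (ouMean b a g t)
      (ouMean b a g' t x ∘L diagOp b (fun i => Real.exp (-t * a i))) x := by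
  set D := diagOp b (fun i => Real.exp (-t * a i)) with hD
  have hcomp : ∀ L : E →L[ℝ] G, ‖L ∘L D‖ ≤ ‖L‖ * ‖D‖ := fun L =>
    ContinuousLinearMap.opNorm_comp_le _ _
  have hC'0 : 0 ≤ C' := (norm_nonneg _).trans (hC' 0)
  have hmeas : ∀ x, Continuous fun z => D x + diagOp b (ouDev a t) z := fun x => by fun_prop
  have h := hasFDerivAt_integral_of_dominated_of_fderiv_le (𝕜 := ℝ) (μ := stdGaussian E)
    (bound := fun _ => C' * ‖D‖) (F := fun x z => g (D x + diagOp b (ouDev a t) z))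
    (F' := fun x z => g' (D x + diagOp b (ouDev a t) z) ∘L D) (x₀ := x)
    univ_mem (Eventually.of_forall fun x => (hg.comp (hmeas x)).aestronglyMeasurable)
    ((integrable_const C).mono' (hg.comp (hmeas x)).aestronglyMeasurable
      (ae_of_all _ fun z => hC _))
    ((hg'.comp (hmeas x)).clm_comp continuous_const).aestronglyMeasurable
    (ae_of_all _ fun z y _ => (hcomp _).trans (by gcongr; exact hC' _)) (integrable_const _)
    (ae_of_all _ fun z y _ => (hd _).comp y (D.hasFDerivAt.add_const _))
  refine h.congr_fderiv ?_
  have hint : Integrable (fun z => g' (D x + diagOp b (ouDev a t) z)) (stdGaussian E) :=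
    (integrable_const C').mono' (hg'.comp (hmeas x)).aestronglyMeasurable
      (ae_of_all _ fun z => hC' _)
  exact ((ContinuousLinearMap.compL ℝ E E G).flip D).integral_comp_comm hint

theorem hasFDerivAt_ouMean_real {f : E → ℝ} (hf : Continuous f) {C : ℝ} (hC : ∀ y, ‖f y‖ ≤ C)
    {g : E → E} (hg : Continuous g) {C' : ℝ} (hC' : ∀ y, ‖g y‖ ≤ C')
    (hd : ∀ y, HasFDerivAt f (innerSL ℝ (g y)) y) (t : ℝ) (x : E) :
    HasFDerivAt (ouMean b a f t)
      (innerSL ℝ (diagOp b (fun i => Real.exp (-t * a i)) (ouMean b a g t x))) x := by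
  have hg' : Continuous fun y => innerSL ℝ (g y) := (innerSL ℝ).continuous.comp hg
  refine (hasFDerivAt_ouMean b a hf hC (g' := fun y => innerSL ℝ (g y)) hg'
    (C' := C') (fun y => by rw [innerSL_apply_norm]; exact hC' y) hd t x).congr_fderiv ?_
  have hmeas : Continuous fun z => diagOp b (fun i => Real.exp (-t * a i)) x
    + diagOp b (ouDev a t) z := by fun_prop
  ext w
  rw [ContinuousLinearMap.comp_apply, innerSL_apply_apply, inner_diagOp_left, ouMean,
    ContinuousLinearMap.integral_apply]
  · have hint : Integrable (fun z => g (diagOp b (fun i => Real.exp (-t * a i)) x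
        + diagOp b (ouDev a t) z)) (stdGaussian E) :=
      (integrable_const C').mono' (hg.comp hmeas).aestronglyMeasurable
        (ae_of_all _ fun z => hC' _)
    have h1 : ∀ i, Real.exp (-t * a i) * (⟪b i, ouMean b a g t x⟫ * ⟪b i, w⟫)
        = ⟪b i, ouMean b a g t x⟫ * ⟪b i, diagOp b (fun i => Real.exp (-t * a i)) w⟫ := fun i => by
      rw [inner_diagOp]; ring
    simp_rw [h1]
    conv_rhs => enter [2, i]; rw [real_inner_comm (ouMean b a g t x)]
    rw [b.sum_inner_mul_inner, ouMean, real_inner_comm, ← integral_inner hint]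
    refine integral_congr_ae (ae_of_all _ fun z => ?_)
    simp [real_inner_comm]
  · refine (integrable_const C').mono' (hg'.comp hmeas).aestronglyMeasurable
      (ae_of_all _ fun z => ?_)
    rw [innerSL_apply_norm]
    exact hC' _

theorem ouMean_zero [CompleteSpace G] (x : E) : ouMean b a g 0 x = g x := by
  have h1 : ouDev a 0 = fun _ => 0 := by ext i; simp [ouDev]
  have h2 : diagOp b (fun _ : ι => (0 : ℝ)) = 0 := by ext x; simp [diagOp_apply]
  have h3 : (fun i => Real.exp (-0 * a i)) = fun _ => 1 := by ext i; simp
  rw [ouMean, h1, h2, h3]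
  simp [diagOp_one]

variable {a} in
theorem ouMean_eq_mehlerInt (ha : ∀ i, 0 < a i) {f : E → ℝ} (hf : Continuous f)
    (hf0 : ∀ x, 0 ≤ f x) {t : ℝ} (ht : 0 < t) (x : E) : ouMean b a f t x =
      mehlerInt b a ((diagGaussian b a).withDensity fun y => ENNReal.ofReal (f y)) t x := by
  have hc := (continuous_mehlerExp b (a := a) t x).measurable
  have hm := hf.measurable
  rw [ouMean_eq_integral b a hf, ouKernel_eq_withDensity b ha ht, mehlerInt,
    integral_withDensity_eq_integral_toReal_smul (by fun_prop) (by simp),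
    integral_withDensity_eq_integral_toReal_smul (by fun_prop) (by simp)]
  refine integral_congr_ae (ae_of_all _ fun y => ?_)
  simp only [smul_eq_mul]
  rw [ENNReal.toReal_ofReal (Real.exp_pos _).le, ENNReal.toReal_ofReal (hf0 y), mul_comm]

end NearField

/-! ### Continuity of the semigroup and its derivatives up to time zero -/

noncomputable section Semigroup

open Set Metric Module
open scoped NNReal RealInnerProductSpace ENNReal

variable {ι : Type*} [Fintype ι] {E : Type*} [NormedAddCommGroup E] [InnerProductSpace ℝ E]
variable [FiniteDimensional ℝ E] [MeasurableSpace E] [BorelSpace E]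
variable (b : OrthonormalBasis ι ℝ E) (a : ι → ℝ) (F : E → ℝ)

/-- The measure with density `F` with respect to `diagGaussian`. -/
def weighted : Measure E := (diagGaussian b a).withDensity fun y => ENNReal.ofReal (F y)

/-- The Ornstein–Uhlenbeck semigroup applied to `F`. -/
def semi (t : ℝ) (x : E) : ℝ := if 0 < t then mehlerInt b a (weighted b a F) t x else F x

/-- The gradient of `semi`. -/
def semiGrad (t : ℝ) (x : E) : E :=
  if 0 < t then mehlerIntGrad b a (weighted b a F) t x else basisGrad b F x

/-- The Hessian of `semi`. -/
def semiHess (t : ℝ) (x : E) : E →L[ℝ] E :=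
  if 0 < t then mehlerIntHess b a (weighted b a F) t x else fderiv ℝ (basisGrad b F) x

variable {a F} {f : E → ℝ}

theorem weighted_mono {f g : E → ℝ} (h : ∀ x, f x ≤ g x) : weighted b a f ≤ weighted b a g :=
  withDensity_mono (ae_of_all _ fun x => ENNReal.ofReal_le_ofReal (h x))

theorem weighted_add {f g : E → ℝ} (hf : Measurable f) (hf0 : ∀ x, 0 ≤ f x) (hg0 : ∀ x, 0 ≤ g x) :
    weighted b a (fun x => f x + g x) = weighted b a f + weighted b a g := by
  rw [weighted, weighted, weighted, ← withDensity_add_left (by fun_prop)]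
  congr 1
  ext x
  exact ENNReal.ofReal_add (hf0 x) (hg0 x)

section CompactSupport

variable (ha : ∀ i, 0 < a i) (hf : ContDiff ℝ ∞ f) (hfc : HasCompactSupport f)
include hf hfc

omit [FiniteDimensional ℝ E] [MeasurableSpace E] [BorelSpace E] in
theorem exists_bound_basisGrad : ∃ C, ∀ y, ‖basisGrad b f y‖ ≤ C :=
  (hasCompactSupport_basisGrad b hfc).exists_bound_of_continuous
    (contDiff_basisGrad b hf).continuous

omit [FiniteDimensional ℝ E] [MeasurableSpace E] [BorelSpace E] in
theorem exists_bound_fderiv_basisGrad : ∃ C, ∀ y, ‖fderiv ℝ (basisGrad b f) y‖ ≤ C :=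
  ((hasCompactSupport_basisGrad b hfc).fderiv (𝕜 := ℝ)).exists_bound_of_continuous
    ((contDiff_basisGrad b hf).continuous_fderiv (by simp))

variable [IsFiniteMeasure (weighted b a f)] (hf0 : ∀ x, 0 ≤ f x) {t : ℝ} (ht : 0 < t) (x : E)
include ha hf0 ht

/-- The same function is differentiated twice, once through the kernel and once through `f`, and
derivatives are unique. -/
theorem mehlerIntGrad_weighted : mehlerIntGrad b a (weighted b a f) t x =
    diagOp b (fun i => Real.exp (-t * a i)) (ouMean b a (basisGrad b f) t x) := by
  obtain ⟨C, hC⟩ := hfc.exists_bound_of_continuous hf.continuous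
  obtain ⟨C', hC'⟩ := exists_bound_basisGrad b hf hfc
  have h1 := hasFDerivAt_ouMean_real b a hf.continuous hC
    (contDiff_basisGrad b hf).continuous hC' (fun y => by
      rw [innerSL_basisGrad]
      exact (hf.differentiable (by simp) y).hasFDerivAt) t x
  have h2 := hasFDerivAt_mehlerInt b (weighted b a f) ha ht x
  have h3 : ouMean b a f t = mehlerInt b a (weighted b a f) t :=
    funext fun x => ouMean_eq_mehlerInt b ha hf.continuous hf0 ht x
  rw [h3] at h1
  have h4 := h2.unique h1
  refine ext_inner_right ℝ fun w => ?_
  simpa using DFunLike.congr_fun h4 w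

theorem mehlerIntHess_weighted : mehlerIntHess b a (weighted b a f) t x =
    diagOp b (fun i => Real.exp (-t * a i)) ∘L ouMean b a (fderiv ℝ (basisGrad b f)) t x ∘L
      diagOp b (fun i => Real.exp (-t * a i)) := by
  have hc := FiniteDimensional.complete ℝ E
  obtain ⟨C, hC⟩ := exists_bound_basisGrad b hf hfc
  obtain ⟨C', hC'⟩ := exists_bound_fderiv_basisGrad b hf hfc
  have hg := contDiff_basisGrad b hf
  have h1 := (diagOp b (fun i => Real.exp (-t * a i))).hasFDerivAt.comp x
    (hasFDerivAt_ouMean b a hg.continuous hC (hg.continuous_fderiv (by simp)) hC'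
      (fun y => (hg.differentiable (by simp) y).hasFDerivAt) t x)
  refine (hasFDerivAt_mehlerIntGrad b (weighted b a f) ha ht x).unique
    (h1.congr_of_eventuallyEq (Eventually.of_forall fun y => ?_))
  exact mehlerIntGrad_weighted b ha hf hfc hf0 ht y

end CompactSupport

omit [FiniteDimensional ℝ E] [MeasurableSpace E] [BorelSpace E] in
theorem continuous_diagOp_exp (a : ι → ℝ) :
    Continuous fun p : ℝ × E => diagOp b (fun i => Real.exp (-p.1 * a i)) := by
  unfold diagOp
  fun_prop

omit [FiniteDimensional ℝ E] [MeasurableSpace E] [BorelSpace E] [InnerProductSpace ℝ E] in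
theorem continuousWithinAt_of_near [NormedSpace ℝ E] {G : Type*} [NormedAddCommGroup G]
    {W N : ℝ × E → G} {s : Set (ℝ × E)} {p : ℝ × E} (hp : p ∈ s) (hN : ContinuousAt N p)
    (h : ∀ ε : ℝ, 0 < ε → ∀ᶠ q in 𝓝[s] p, ‖W q - N q‖ ≤ ε) : ContinuousWithinAt W s p := by
  have h1 : Tendsto (fun q => W q - N q) (𝓝[s] p) (𝓝 0) := by
    rw [Metric.tendsto_nhds]
    intro ε hε
    filter_upwards [h (ε / 2) (by linarith)] with q hq
    rw [dist_zero_right]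
    linarith
  -- The base point lies in `s`, so the estimate holds at `p` itself for every `ε`, which forces the
  -- two values to agree there.
  have h2 : W p - N p = 0 := by
    refine norm_le_zero_iff.1 (le_of_forall_pos_le_add fun ε hε => ?_)
    rw [zero_add]
    exact (h ε hε).self_of_nhdsWithin hp
  have h3 := h1.add (hN.continuousWithinAt (s := s))
  simp only [sub_add_cancel, zero_add] at h3
  rw [← sub_eq_zero.1 h2] at h3
  exact h3

section Split

variable {h : E → ℝ} {x₀ : E}

theorem weighted_ae_far (hh : ∀ x ∈ closedBall x₀ 2, h x = 0) (hm : Measurable h) :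
    ∀ᵐ y ∂weighted b a h, y ∉ closedBall x₀ 2 := by
  rw [weighted, ae_withDensity_iff (by fun_prop)]
  refine ae_of_all _ fun y hy hy' => hy ?_
  simp [hh y hy']

omit [FiniteDimensional ℝ E] [MeasurableSpace E] [BorelSpace E] in
theorem eventually_far_le (ha : ∀ i, 0 < a i) (x₀ : E) {ε : ℝ} (hε : 0 < ε) :
    ∀ᶠ p : ℝ × E in 𝓝[Ici 0 ×ˢ univ] (0, x₀), 0 ≤ p.1 ∧ p.2 ∈ ball x₀ 1 ∧
      (0 < p.1 → ∀ y ∉ closedBall x₀ 2,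
        Real.exp (mehlerExp b a p.1 p.2 y) ≤ ε ∧
        Real.exp (mehlerExp b a p.1 p.2 y) * ‖mehlerGrad b a p.1 p.2 y‖ ≤ ε ∧
        Real.exp (mehlerExp b a p.1 p.2 y) * ‖mehlerHess b a p.1 p.2 y‖ ≤ ε) := by
  have h1 := eventually_nhdsWithin_iff.1 (eventually_mehler_far_le b ha (‖x₀‖ + 1) hε)
  have h2 : ∀ᶠ p : ℝ × E in 𝓝 (0, x₀), p.2 ∈ ball x₀ 1 :=
    continuous_snd.continuousAt.eventually (ball_mem_nhds x₀ one_pos)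
  filter_upwards [nhdsWithin_le_nhds h2, nhdsWithin_le_nhds
    ((continuous_fst (X := ℝ) (Y := E)).continuousAt (x := (0, x₀)) |>.eventually h1),
    self_mem_nhdsWithin] with p hp1 hp2 hp3
  refine ⟨hp3.1, hp1, fun ht y hy => hp2 ht p.2 y ?_ ?_⟩
  · have := norm_add_le x₀ (p.2 - x₀)
    rw [add_sub_cancel] at this
    rw [mem_ball, dist_eq_norm] at hp1
    linarith
  · rw [mem_closedBall, not_le] at hy
    rw [mem_ball] at hp1
    have := dist_triangle y p.2 x₀
    rw [dist_eq_norm y p.2] at this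
    linarith

variable (hF : ContDiff ℝ ∞ F) (hF0 : ∀ x, 0 ≤ F x)
include hF hF0

omit [MeasurableSpace E] [BorelSpace E] in
/-- A decomposition into a smooth compactly supported part and a part vanishing near `x₀`. -/
theorem exists_near_far (x₀ : E) : ∃ f h : E → ℝ, ContDiff ℝ ∞ f ∧ HasCompactSupport f ∧
    ContDiff ℝ ∞ h ∧ (∀ x, 0 ≤ f x) ∧ (∀ x, 0 ≤ h x) ∧ (∀ x ∈ closedBall x₀ 2, h x = 0) ∧
    F = fun x => f x + h x := by
  let χ : ContDiffBump x₀ := ⟨2, 3, by norm_num, by norm_num⟩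
  refine ⟨fun x => χ x * F x, fun x => (1 - χ x) * F x, χ.contDiff.mul hF,
    χ.hasCompactSupport.mul_right, (contDiff_const.sub χ.contDiff).mul hF,
    fun x => mul_nonneg χ.nonneg (hF0 x), fun x => mul_nonneg (sub_nonneg.2 χ.le_one) (hF0 x),
    fun x hx => ?_, ?_⟩
  · simp [χ.one_of_mem_closedBall hx]
  · ext x
    ring

variable [IsFiniteMeasure (weighted b a F)] (ha : ∀ i, 0 < a i)
include ha

/-- Near `x₀` the function is `f + h` with `f` smooth of compact support and `h` zero on the ball of
radius `2`. The semigroup on `f` and its derivatives are continuous down to time `0` by `ouMean`.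
For `x` within `1` of `x₀`, only kernel values at distance at least `1` meet `h`, and they vanish
uniformly as `t → 0`. The measure of density `h` is finite, so no growth condition on `F` enters. -/
theorem continuousWithinAt_semi_zero (x₀ : E) :
    ContinuousWithinAt (fun p : ℝ × E => semi b a F p.1 p.2) (Ici 0 ×ˢ univ) (0, x₀) ∧
    ContinuousWithinAt (fun p : ℝ × E => semiGrad b a F p.1 p.2) (Ici 0 ×ˢ univ) (0, x₀) ∧
    ContinuousWithinAt (fun p : ℝ × E => semiHess b a F p.1 p.2) (Ici 0 ×ˢ univ) (0, x₀) := by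
  have hcE := FiniteDimensional.complete ℝ E
  obtain ⟨f, h, hf, hfc, hh, hf0, hh0, hfar, hFe⟩ := exists_near_far hF hF0 x₀
  have : IsFiniteMeasure (weighted b a f) := isFiniteMeasure_of_le (weighted b a F)
    (weighted_mono b fun x => by rw [hFe]; linarith [hh0 x])
  have : IsFiniteMeasure (weighted b a h) := isFiniteMeasure_of_le (weighted b a F)
    (weighted_mono b fun x => by rw [hFe]; linarith [hf0 x])
  have hν : weighted b a F = weighted b a f + weighted b a h := by
    conv_lhs => rw [hFe]
    exact weighted_add b hf.continuous.measurable hf0 hh0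
  have hae := weighted_ae_far b (a := a) hfar hh.continuous.measurable
  have hmem : ((0 : ℝ), x₀) ∈ Ici (0 : ℝ) ×ˢ (univ : Set E) := ⟨le_refl (0 : ℝ), mem_univ _⟩
  obtain ⟨C₀, hC₀⟩ := hfc.exists_bound_of_continuous hf.continuous
  obtain ⟨C₁, hC₁⟩ := exists_bound_basisGrad b hf hfc
  obtain ⟨C₂, hC₂⟩ := exists_bound_fderiv_basisGrad b hf hfc
  have hg := contDiff_basisGrad b hf
  have hg' := hg.continuous_fderiv (by simp)
  set m := (weighted b a h).real univ with hm
  have hm0 : 0 ≤ m := measureReal_nonneg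
  have hloc : ∀ x ∈ ball x₀ 1, F =ᶠ[𝓝 x] f := fun x hx => by
    filter_upwards [isOpen_ball.mem_nhds hx] with y hy
    rw [hFe]
    simp [hfar y (ball_subset_closedBall (ball_subset_ball one_le_two hy))]
  have hlocg : ∀ x ∈ ball x₀ 1, basisGrad b F x = basisGrad b f x := fun x hx => by
    simp only [basisGrad, (hloc x hx).fderiv_eq]
  have hlocg' : ∀ x ∈ ball x₀ 1, basisGrad b F =ᶠ[𝓝 x] basisGrad b f := fun x hx => by
    filter_upwards [isOpen_ball.mem_nhds hx] with y hy using hlocg y hy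
  have hq := continuous_diagOp_exp b a
  have hq0 : diagOp b (fun i => Real.exp (-0 * a i)) = ContinuousLinearMap.id ℝ E := by
    ext x
    simpa using diagOp_one b x
  have key : ∀ ε : ℝ, 0 < ε → ε / (m + 1) * m ≤ ε := fun ε hε => by
    rw [div_mul_eq_mul_div, div_le_iff₀ (by positivity)]
    nlinarith
  refine ⟨?_, ?_, ?_⟩
  · refine continuousWithinAt_of_near (N := fun p => ouMean b a f p.1 p.2) hmem
      (continuous_ouMean b a hf.continuous hC₀).continuousAt fun ε hε => ?_
    filter_upwards [eventually_far_le b ha x₀ (show 0 < ε / (m + 1) by positivity)]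
      with p ⟨hp0, hp1, hp2⟩
    rcases hp0.eq_or_lt with h0 | h0
    · rw [← h0, ouMean_zero, semi, if_neg (lt_irrefl _), (hloc _ hp1).eq_of_nhds]
      simpa using hε.le
    · rw [semi, if_pos h0, ouMean_eq_mehlerInt b ha hf.continuous hf0 h0, hν]
      change ‖mehlerInt b a _ p.1 p.2 - mehlerInt b a (weighted b a f) p.1 p.2‖ ≤ ε
      rw [mehlerInt, integral_add_measure (integrable_exp_mehlerExp b _ ha h0 _)
        (integrable_exp_mehlerExp b _ ha h0 _), mehlerInt, add_sub_cancel_left]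
      refine (norm_integral_le_of_norm_le_const ?_).trans (key ε hε)
      filter_upwards [hae] with y hy
      rw [Real.norm_eq_abs, abs_of_pos (Real.exp_pos _)]
      exact (hp2 h0 y hy).1
  · refine continuousWithinAt_of_near (N := fun p => diagOp b (fun i => Real.exp (-p.1 * a i))
      (ouMean b a (basisGrad b f) p.1 p.2)) hmem
      (hq.clm_apply (continuous_ouMean b a hg.continuous hC₁)).continuousAt fun ε hε => ?_
    filter_upwards [eventually_far_le b ha x₀ (show 0 < ε / (m + 1) by positivity)]
      with p ⟨hp0, hp1, hp2⟩
    rcases hp0.eq_or_lt with h0 | h0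
    · rw [← h0, ouMean_zero, semiGrad, if_neg (lt_irrefl _), hlocg _ hp1, hq0]
      simpa using hε.le
    · rw [semiGrad, if_pos h0, ← mehlerIntGrad_weighted b ha hf hfc hf0 h0, hν]
      rw [mehlerIntGrad, integral_add_measure (integrable_exp_smul_mehlerGrad b _ ha h0 _)
        (integrable_exp_smul_mehlerGrad b _ ha h0 _), mehlerIntGrad, add_sub_cancel_left]
      refine (norm_integral_le_of_norm_le_const ?_).trans (key ε hε)
      filter_upwards [hae] with y hy
      rw [norm_smul, Real.norm_eq_abs, abs_of_pos (Real.exp_pos _)]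
      exact (hp2 h0 y hy).2.1
  · refine continuousWithinAt_of_near (N := fun p => diagOp b (fun i => Real.exp (-p.1 * a i)) ∘L
      ouMean b a (fderiv ℝ (basisGrad b f)) p.1 p.2 ∘L
      diagOp b (fun i => Real.exp (-p.1 * a i))) hmem
      (hq.clm_comp ((continuous_ouMean b a hg' hC₂).clm_comp hq)).continuousAt fun ε hε => ?_
    filter_upwards [eventually_far_le b ha x₀ (show 0 < ε / (m + 1) by positivity)]
      with p ⟨hp0, hp1, hp2⟩
    rcases hp0.eq_or_lt with h0 | h0
    · rw [← h0, ouMean_zero, semiHess, if_neg (lt_irrefl _), (hlocg' _ hp1).fderiv_eq, hq0]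
      simpa using hε.le
    · rw [semiHess, if_pos h0, ← mehlerIntHess_weighted b ha hf hfc hf0 h0, hν]
      rw [mehlerIntHess, integral_add_measure (integrable_exp_smul_mehlerHess b _ ha h0 _)
        (integrable_exp_smul_mehlerHess b _ ha h0 _), mehlerIntHess, add_sub_cancel_left]
      refine (norm_integral_le_of_norm_le_const ?_).trans (key ε hε)
      filter_upwards [hae] with y hy
      rw [norm_smul, Real.norm_eq_abs, abs_of_pos (Real.exp_pos _)]
      exact (hp2 h0 y hy).2.2

end Split

omit [InnerProductSpace ℝ E] [FiniteDimensional ℝ E] [MeasurableSpace E]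
  [BorelSpace E] in
theorem continuousOn_of_zero_of_pos {G : Type*} [TopologicalSpace G] {w w' : ℝ → E → G}
    (h0 : ∀ x, ContinuousWithinAt (fun p : ℝ × E => w p.1 p.2) (Ici 0 ×ˢ univ) (0, x))
    (h1 : ∀ p : ℝ × E, 0 < p.1 → ContinuousAt (fun p : ℝ × E => w' p.1 p.2) p)
    (heq : ∀ t, 0 < t → w t = w' t) :
    ContinuousOn (fun p : ℝ × E => w p.1 p.2) (Ici 0 ×ˢ univ) := by
  rintro ⟨t, x⟩ ⟨ht, -⟩
  rcases (show 0 ≤ t from ht).eq_or_lt with rfl | ht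
  · exact h0 x
  · refine ((h1 (t, x) ht).congr ?_).continuousWithinAt
    filter_upwards
      [continuous_fst.continuousAt.eventually (lt_mem_nhds (show 0 < (t, x).1 from ht))]
      with q hq
    rw [heq _ hq]

section Regularity

variable (ha : ∀ i, 0 < a i) (hF : ContDiff ℝ ∞ F) (hF0 : ∀ x, 0 ≤ F x)
  [IsFiniteMeasure (weighted b a F)]
include ha hF hF0

theorem continuousOn_semi : ContinuousOn (fun p : ℝ × E => semi b a F p.1 p.2) (Ici 0 ×ˢ univ) :=
  continuousOn_of_zero_of_pos (fun x => (continuousWithinAt_semi_zero b hF hF0 ha x).1)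
    (fun _ hp => continuousAt_mehlerInt b (weighted b a F) ha hp)
    fun t ht => funext fun x => by rw [semi, if_pos ht]

theorem continuousOn_semiGrad :
    ContinuousOn (fun p : ℝ × E => semiGrad b a F p.1 p.2) (Ici 0 ×ˢ univ) :=
  continuousOn_of_zero_of_pos (fun x => (continuousWithinAt_semi_zero b hF hF0 ha x).2.1)
    (fun _ hp => continuousAt_mehlerIntGrad b (weighted b a F) ha hp)
    fun t ht => funext fun x => by rw [semiGrad, if_pos ht]

theorem continuousOn_semiHess :
    ContinuousOn (fun p : ℝ × E => semiHess b a F p.1 p.2) (Ici 0 ×ˢ univ) :=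
  continuousOn_of_zero_of_pos (fun x => (continuousWithinAt_semi_zero b hF hF0 ha x).2.2)
    (fun _ hp => continuousAt_mehlerIntHess b (weighted b a F) ha hp)
    fun t ht => funext fun x => by rw [semiHess, if_pos ht]

omit hF0 in
theorem hasFDerivAt_semi (t : ℝ) (x : E) :
    HasFDerivAt (semi b a F t) (innerSL ℝ (semiGrad b a F t x)) x := by
  by_cases ht : 0 < t
  · have : semi b a F t = mehlerInt b a (weighted b a F) t := funext fun x => by
      rw [semi, if_pos ht]
    rw [this, semiGrad, if_pos ht]
    exact hasFDerivAt_mehlerInt b _ ha ht x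
  · have : semi b a F t = F := funext fun x => by rw [semi, if_neg ht]
    rw [this, semiGrad, if_neg ht, innerSL_basisGrad]
    exact (hF.differentiable (by simp) x).hasFDerivAt

omit hF0 in
theorem hasFDerivAt_semiGrad (t : ℝ) (x : E) :
    HasFDerivAt (semiGrad b a F t) (semiHess b a F t x) x := by
  by_cases ht : 0 < t
  · have : semiGrad b a F t = mehlerIntGrad b a (weighted b a F) t := funext fun x => by
      rw [semiGrad, if_pos ht]
    rw [this, semiHess, if_pos ht]
    exact hasFDerivAt_mehlerIntGrad b _ ha ht x
  · have : semiGrad b a F t = basisGrad b F := funext fun x => by rw [semiGrad, if_neg ht]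
    rw [this, semiHess, if_neg ht]
    exact ((contDiff_basisGrad b hF).differentiable (by simp) x).hasFDerivAt

end Regularity

theorem semi_pos [NeZero (weighted b a F)] [IsFiniteMeasure (weighted b a F)] (ha : ∀ i, 0 < a i)
    (hF0 : ∀ x, 0 < F x) (t : ℝ) (x : E) : 0 < semi b a F t x := by
  rw [semi]
  split_ifs with ht
  · exact integral_exp_pos (integrable_exp_mehlerExp b _ ha ht x)
  · exact hF0 x

end Semigroup

/-! ### Decay of the coefficients and linear growth of the logarithmic gradient -/

section Growth

open Set Metric Module
open scoped NNReal RealInnerProductSpace ENNReal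

variable {ι : Type*} [Fintype ι] {a : ι → ℝ} (ha : ∀ i, 0 < a i)
include ha

omit [Fintype ι] in
theorem exists_pos_forall_le [Finite ι] : ∃ κ, 0 < κ ∧ ∀ i, κ ≤ a i := by
  rcases isEmpty_or_nonempty ι with h | h
  · exact ⟨1, one_pos, fun i => h.elim i⟩
  · obtain ⟨i, hi⟩ := Finite.exists_min a
    exact ⟨a i, ha i, hi⟩

/-- Exponential decay of the coefficients of the Mehler kernel. -/
theorem exists_mehler_coeff_decay {δ : ℝ} (hδ : 0 < δ) : ∃ C κ : ℝ, 0 < C ∧ 0 < κ ∧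
    ∀ t, δ ≤ t → ∀ i, mehlerA (a i) t ≤ C * Real.exp (-κ * t) ∧
      mehlerB (a i) t ≤ C * Real.exp (-κ * t) ∧ 0 ≤ mehlerL (a i) t ∧
      mehlerL (a i) t ≤ C * Real.exp (-κ * t) := by
  obtain ⟨κ, hκ, hκa⟩ := exists_pos_forall_le ha
  set d := 1 - Real.exp (-κ * δ) ^ 2 with hd
  have hd0 : 0 < d := by
    have h1 : Real.exp (-κ * δ) < 1 := Real.exp_lt_one_iff.2 (by nlinarith)
    nlinarith [Real.exp_pos (-κ * δ)]
  set s := ∑ i, a i with hs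
  have hs0 : 0 ≤ s := Finset.sum_nonneg fun i _ => (ha i).le
  refine ⟨(1 + s) / d, κ, by positivity, hκ, fun t ht i => ?_⟩
  have ht0 : 0 < t := hδ.trans_le ht
  have has : a i ≤ s := Finset.single_le_sum (fun i _ => (ha i).le) (Finset.mem_univ i)
  have hai := ha i
  have hq0 := Real.exp_pos (-t * a i)
  have hq1 : Real.exp (-t * a i) ≤ Real.exp (-κ * t) := Real.exp_le_exp.2 (by nlinarith [hκa i])
  have hq2 : Real.exp (-t * a i) ≤ Real.exp (-κ * δ) :=
    hq1.trans (Real.exp_le_exp.2 (by nlinarith))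
  have hq3 : Real.exp (-t * a i) ≤ 1 := Real.exp_le_one_iff.2 (by nlinarith)
  have hqd : d ≤ 1 - Real.exp (-t * a i) ^ 2 := by
    rw [hd]
    gcongr
  unfold mehlerA mehlerB mehlerL
  generalize Real.exp (-t * a i) = q at *
  generalize Real.exp (-κ * t) = r at *
  have hD : 0 < 1 - q ^ 2 := hd0.trans_le hqd
  have hbound : ∀ c, 0 ≤ c → c ≤ (1 + s) * q → c / (1 - q ^ 2) ≤ (1 + s) / d * r := by
    intro c hc hcs
    rw [div_mul_eq_mul_div]
    have hr : 0 < r := hq0.trans_le hq1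
    exact div_le_div₀ (by positivity) (hcs.trans (by gcongr)) hd0 hqd
  have hqq : q ^ 2 ≤ q := by nlinarith
  refine ⟨hbound _ (by positivity) (by nlinarith), hbound _ (by positivity) ?_, ?_, ?_⟩
  · have := mul_le_mul_of_nonneg_left hqq hai.le
    nlinarith
  · have : Real.log (1 - q ^ 2) ≤ 0 := Real.log_nonpos hD.le (by nlinarith)
    linarith
  · have h1 := Real.one_sub_inv_le_log_of_pos hD
    have h2 : (1 - q ^ 2)⁻¹ - 1 = q ^ 2 / (1 - q ^ 2) := by field_simp; ring
    have h3 := hbound (q ^ 2) (by positivity) (by nlinarith)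
    have h4 : 0 ≤ q ^ 2 / (1 - q ^ 2) := by positivity
    linarith

variable {E : Type*} [NormedAddCommGroup E] [InnerProductSpace ℝ E] (b : OrthonormalBasis ι ℝ E)
  {t c : ℝ} (ht : 0 < t)
include ht

theorem le_mehlerExp (hA : ∀ i, mehlerA (a i) t ≤ c) (hB : ∀ i, mehlerB (a i) t ≤ c)
    (hL : ∀ i, 0 ≤ mehlerL (a i) t) (x y : E) :
    -(c * (‖x‖ ^ 2 + ‖y‖ ^ 2)) ≤ mehlerExp b a t x y := by
  rw [norm_sq_eq_sum_inner b, norm_sq_eq_sum_inner b, ← Finset.sum_add_distrib, Finset.mul_sum,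
    ← Finset.sum_neg_distrib]
  refine Finset.sum_le_sum fun i _ => ?_
  have h1 := mul_nonneg (mehlerA_pos (ha i) ht).le (sq_nonneg (⟪b i, x⟫ + ⟪b i, y⟫))
  have h2 := mul_le_mul_of_nonneg_right (hA i) (add_nonneg (sq_nonneg ⟪b i, x⟫)
    (sq_nonneg ⟪b i, y⟫))
  have h3 := mul_le_mul_of_nonneg_right (hB i) (add_nonneg (sq_nonneg ⟪b i, x⟫)
    (sq_nonneg ⟪b i, y⟫))
  linarith [hL i]

theorem mehlerExp_le_norm (hB : ∀ i, mehlerB (a i) t ≤ c) (hL : ∀ i, mehlerL (a i) t ≤ c)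
    (x y : E) : mehlerExp b a t x y ≤ Fintype.card ι * c + (c + ∑ i, a i) * ‖x‖ ^ 2 := by
  refine (mehlerExp_le b ha ht x y).trans ?_
  have h0 : (Fintype.card ι : ℝ) * c = ∑ _i : ι, c := by simp
  rw [h0, norm_sq_eq_sum_inner b, Finset.mul_sum, ← Finset.sum_add_distrib]
  refine Finset.sum_le_sum fun i _ => ?_
  have has : a i ≤ ∑ i, a i := Finset.single_le_sum (fun i _ => (ha i).le) (Finset.mem_univ i)
  have hBp := mehlerB_pos (ha i) ht
  rw [mehlerA_sq (ha i) ht, mul_div_cancel_left₀ _ hBp.ne']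
  have h1 : (mehlerB (a i) t + a i) * ⟪b i, x⟫ ^ 2 ≤ (c + ∑ i, a i) * ⟪b i, x⟫ ^ 2 :=
    mul_le_mul_of_nonneg_right (add_le_add (hB i) has) (sq_nonneg _)
  have h2 : 0 ≤ mehlerB (a i) t * ⟪b i, y⟫ ^ 2 := by positivity
  linarith [hL i]

omit ha ht [Fintype ι] [InnerProductSpace ℝ E] in
theorem exists_measureReal_closedBall_pos [MeasurableSpace E] [BorelSpace E] (ν : Measure E)
    [NeZero ν] [IsFiniteMeasure ν] : ∃ ρ : ℝ, 0 ≤ ρ ∧ 0 < ν.real (closedBall 0 ρ) := by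
  by_contra! h
  have h1 : ∀ n : ℕ, ν (closedBall (0 : E) n) = 0 := fun n =>
    (measureReal_eq_zero_iff).1 (le_antisymm (h n n.cast_nonneg) measureReal_nonneg)
  have h2 := measure_iUnion_null h1
  rw [iUnion_closedBall_nat] at h2
  exact NeZero.ne ν (Measure.measure_univ_eq_zero.1 h2)

variable [FiniteDimensional ℝ E] [MeasurableSpace E] [BorelSpace E] (ν : Measure E)
  [IsFiniteMeasure ν]

theorem le_mehlerInt (hA : ∀ i, mehlerA (a i) t ≤ c) (hB : ∀ i, mehlerB (a i) t ≤ c)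
    (hL : ∀ i, 0 ≤ mehlerL (a i) t) (hc : 0 ≤ c) (x : E) (ρ : ℝ) :
    Real.exp (-(c * (‖x‖ ^ 2 + ρ ^ 2))) * ν.real (closedBall 0 ρ) ≤ mehlerInt b a ν t x := by
  have hint := integrable_exp_mehlerExp b ν ha ht x
  refine le_trans ?_ (setIntegral_le_integral (s := closedBall 0 ρ) hint
    (ae_of_all _ fun y => (Real.exp_pos _).le))
  refine setIntegral_ge_of_const_le_real measurableSet_closedBall (measure_ne_top _ _)
    (fun y hy => Real.exp_le_exp.2 ((le_mehlerExp ha b ht hA hB hL x y).trans' ?_))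
    hint.integrableOn
  have : ‖y‖ ≤ ρ := by simpa using hy
  gcongr

theorem mehlerInt_le (hB : ∀ i, mehlerB (a i) t ≤ c) (hL : ∀ i, mehlerL (a i) t ≤ c) (x : E) :
    mehlerInt b a ν t x ≤
      Real.exp (Fintype.card ι * c + (c + ∑ i, a i) * ‖x‖ ^ 2) * ν.real univ := by
  have h := integral_mono (integrable_exp_mehlerExp b ν ha ht x) (integrable_const _)
    fun y => Real.exp_le_exp.2 (mehlerExp_le_norm ha b ht hB hL x y)
  rw [integral_const, smul_eq_mul, mul_comm] at h
  exact h

-- The exponent is quadratic in `x` and its Hessian does not depend on `y`. This exact expansion is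
-- what makes the logarithm of the Mehler integral semiconvex.
omit ha ht [FiniteDimensional ℝ E] [MeasurableSpace E] [BorelSpace E] in
theorem mehlerExp_add (x k y : E) : mehlerExp b a t (x + k) y = mehlerExp b a t x y
    + ⟪mehlerGrad b a t x y, k⟫ - ⟪diagOp b (fun i => mehlerB (a i) t) k, k⟫ / 2 := by
  rw [inner_diagOp_left, ← b.sum_inner_mul_inner, mehlerExp, mehlerExp, Finset.sum_div,
    ← Finset.sum_add_distrib, ← Finset.sum_sub_distrib]
  refine Finset.sum_congr rfl fun i _ => ?_
  rw [real_inner_comm (b i) (mehlerGrad b a t x y), inner_mehlerGrad, inner_add_right]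
  ring

/-- Jensen's inequality for the Mehler integral. -/
theorem mehlerInt_add_ge [NeZero ν] (x k : E) : mehlerInt b a ν t x * Real.exp
    (⟪mehlerIntGrad b a ν t x, k⟫ / mehlerInt b a ν t x
      - ⟪diagOp b (fun i => mehlerB (a i) t) k, k⟫ / 2) ≤ mehlerInt b a ν t (x + k) := by
  have hU : 0 < mehlerInt b a ν t x := integral_exp_pos (integrable_exp_mehlerExp b ν ha ht x)
  have hG := integrable_exp_smul_mehlerGrad b ν ha ht x
  have hE := integrable_exp_mehlerExp b ν ha ht x
  set q := ⟪diagOp b (fun i => mehlerB (a i) t) k, k⟫ / 2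
  set c := ⟪mehlerIntGrad b a ν t x, k⟫ / mehlerInt b a ν t x with hc
  have hI : Integrable (fun y => Real.exp (c - q) * (Real.exp (mehlerExp b a t x y) * (1 - c)
      + ⟪k, Real.exp (mehlerExp b a t x y) • mehlerGrad b a t x y⟫)) ν :=
    ((hE.mul_const _).add (hG.const_inner k)).const_mul _
  have h1 : ∫ y, Real.exp (c - q) * (Real.exp (mehlerExp b a t x y) * (1 - c)
      + ⟪k, Real.exp (mehlerExp b a t x y) • mehlerGrad b a t x y⟫) ∂ν =
      mehlerInt b a ν t x * Real.exp (c - q) := by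
    rw [integral_const_mul, integral_add (hE.mul_const _) (hG.const_inner k), integral_mul_const,
      integral_inner hG]
    change Real.exp (c - q) * (mehlerInt b a ν t x * (1 - c) + ⟪k, mehlerIntGrad b a ν t x⟫) = _
    rw [real_inner_comm, show ⟪mehlerIntGrad b a ν t x, k⟫ = c * mehlerInt b a ν t x by
      rw [hc]; field_simp]
    ring
  rw [← h1]
  refine integral_mono hI (integrable_exp_mehlerExp b ν ha ht (x + k)) fun y => ?_
  simp only [mehlerExp_add, inner_smul_right]
  rw [real_inner_comm (mehlerGrad b a t x y) k]
  set g := ⟪mehlerGrad b a t x y, k⟫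
  change _ ≤ Real.exp (mehlerExp b a t x y + g - q)
  -- Jensen's inequality through a tangent line. The line is taken at `c`, the mean of `g` under the
  -- normalized kernel, so that the linear term integrates to zero.
  have h2 := Real.add_one_le_exp (g - c)
  have h3 : Real.exp (mehlerExp b a t x y + g - q) =
      Real.exp (c - q) * (Real.exp (mehlerExp b a t x y) * Real.exp (g - c)) := by
    rw [← Real.exp_add, ← Real.exp_add]
    ring_nf
  rw [h3]
  have h4 := Real.exp_pos (c - q)
  have h5 := Real.exp_pos (mehlerExp b a t x y)
  refine mul_le_mul_of_nonneg_left ?_ h4.le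
  nlinarith

omit ht in
/-- Linear growth of the logarithmic gradient of the Mehler integral. -/
theorem exists_norm_mehlerIntGrad_le [NeZero ν] {δ : ℝ} (hδ : 0 < δ) : ∃ C, 0 ≤ C ∧
    ∀ t, δ ≤ t → ∀ x, ‖mehlerIntGrad b a ν t x‖ ≤ C * (1 + ‖x‖) * mehlerInt b a ν t x := by
  obtain ⟨c, κ, hc, hκ, hcoef⟩ := exists_mehler_coeff_decay ha hδ
  obtain ⟨ρ, hρ0, hρ⟩ := exists_measureReal_closedBall_pos ν
  have hm : 0 < ν.real univ := hρ.trans_le (measureReal_mono (subset_univ _))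
  set s := ∑ i, a i with hs
  have hs0 : 0 ≤ s := Finset.sum_nonneg fun i _ => (ha i).le
  set n : ℝ := (Fintype.card ι : ℝ) with hn
  have hn0 : 0 ≤ n := Nat.cast_nonneg _
  set l := |Real.log (ν.real univ)| + |Real.log (ν.real (closedBall 0 ρ))|
  refine ⟨l + n * c + 4 * (c + s) + c * (1 + ρ ^ 2) + c, by positivity, fun t ht x => ?_⟩
  have ht0 : 0 < t := hδ.trans_le ht
  have hle : c * Real.exp (-κ * t) ≤ c :=
    mul_le_of_le_one_right hc.le (Real.exp_le_one_iff.2 (by nlinarith))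
  have hA : ∀ i, mehlerA (a i) t ≤ c := fun i => (hcoef t ht i).1.trans hle
  have hB : ∀ i, mehlerB (a i) t ≤ c := fun i => (hcoef t ht i).2.1.trans hle
  have hL0 : ∀ i, 0 ≤ mehlerL (a i) t := fun i => (hcoef t ht i).2.2.1
  have hL : ∀ i, mehlerL (a i) t ≤ c := fun i => (hcoef t ht i).2.2.2.trans hle
  have hU : 0 < mehlerInt b a ν t x := integral_exp_pos (integrable_exp_mehlerExp b ν ha ht0 x)
  rw [← div_le_iff₀ hU]
  set g := mehlerIntGrad b a ν t x with hg
  rcases eq_or_ne g 0 with h0 | h0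
  · rw [h0, norm_zero, zero_div]
    positivity
  have hgn : 0 < ‖g‖ := norm_pos_iff.2 h0
  set r := 1 + ‖x‖ with hr
  have hr1 : 1 ≤ r := by linarith [norm_nonneg x]
  -- The step goes in the direction of the gradient and has length `r = 1 + ‖x‖`. Jensen's
  -- inequality then bounds `r` times the logarithmic gradient by an increment of the logarithm plus
  -- `O(r²)`; the increment is `O(r²)` as well, by the upper bound at `x + k` and the lower bound at
  -- `x`.
  set k := (r / ‖g‖) • g with hk
  have hkn : ‖k‖ = r := by
    rw [hk, norm_smul, Real.norm_eq_abs, abs_of_pos (by positivity), div_mul_cancel₀ _ hgn.ne']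
  have hgk : ⟪g, k⟫ = r * ‖g‖ := by
    rw [hk, real_inner_smul_right, real_inner_self_eq_norm_sq]
    field_simp
  have hBk : ⟪diagOp b (fun i => mehlerB (a i) t) k, k⟫ ≤ c * r ^ 2 := by
    refine (real_inner_le_norm _ _).trans ?_
    have := norm_diagOp_apply_le b hc.le
      (fun i => by rw [abs_of_pos (mehlerB_pos (ha i) ht0)]; exact hB i) k
    rw [hkn] at this ⊢
    have := mul_le_mul_of_nonneg_right this (zero_le_one.trans hr1)
    linarith [sq r]
  have h1 := mehlerInt_add_ge ha b ht0 ν x k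
  have h2 := mehlerInt_le ha b ht0 ν hB hL (x + k)
  have h3 := le_mehlerInt ha b ht0 ν hA hB hL0 hc.le x ρ
  have h4 := Real.log_le_log (by positivity) (h1.trans h2)
  rw [Real.log_mul hU.ne' (Real.exp_pos _).ne', Real.log_exp,
    Real.log_mul (Real.exp_pos _).ne' hm.ne', Real.log_exp] at h4
  have h5 := Real.log_le_log (by positivity) h3
  rw [Real.log_mul (Real.exp_pos _).ne' hρ.ne', Real.log_exp] at h5
  have hxk : ‖x + k‖ ^ 2 ≤ 4 * r ^ 2 := by
    have h13 : ‖x + k‖ ≤ 2 * r := by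
      have := norm_add_le x k
      rw [hkn] at this
      linarith
    have h14 := pow_le_pow_left₀ (norm_nonneg _) h13 2
    linarith [mul_pow 2 r 2]
  have h6 : (c + s) * ‖x + k‖ ^ 2 ≤ (c + s) * (4 * r ^ 2) := by gcongr
  have h7 : c * (‖x‖ ^ 2 + ρ ^ 2) ≤ c * ((1 + ρ ^ 2) * r ^ 2) := by
    gcongr
    nlinarith [norm_nonneg x, sq_nonneg ρ, mul_nonneg (sq_nonneg ρ) (sq_nonneg ‖x‖)]
  have h8 : Real.log (ν.real univ) - Real.log (ν.real (closedBall 0 ρ)) ≤ l := by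
    have := le_abs_self (Real.log (ν.real univ))
    have := neg_abs_le (Real.log (ν.real (closedBall 0 ρ)))
    simp only [l]
    linarith
  rw [hgk] at h4
  have h9 : l + n * c ≤ (l + n * c) * r ^ 2 := by
    exact le_mul_of_one_le_right (by positivity) (one_le_pow₀ hr1)
  have h10 : r * ‖g‖ / mehlerInt b a ν t x = r * (‖g‖ / mehlerInt b a ν t x) := mul_div_assoc _ _ _
  have h11 : r * (‖g‖ / mehlerInt b a ν t x) ≤
      r * ((l + n * c + 4 * (c + s) + c * (1 + ρ ^ 2) + c) * r) := by
    have h12 : r * ((l + n * c + 4 * (c + s) + c * (1 + ρ ^ 2) + c) * r) = (l + n * c) * r ^ 2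
      + (c + s) * (4 * r ^ 2) + c * ((1 + ρ ^ 2) * r ^ 2) + c * r ^ 2 := by ring
    rw [h12, ← h10]
    linarith [mul_nonneg hc.le (sq_nonneg r)]
  exact le_of_mul_le_mul_left h11 (by linarith)

end Growth

/-! ### The Langevin velocity field and conservation of mass -/

noncomputable section Velocity

open Set Metric Module
open scoped NNReal RealInnerProductSpace ENNReal

variable {ι : Type*} [Fintype ι] {E : Type*} [NormedAddCommGroup E] [InnerProductSpace ℝ E]
variable [FiniteDimensional ℝ E] [MeasurableSpace E] [BorelSpace E]
variable (b : OrthonormalBasis ι ℝ E) (a : ι → ℝ) (F : E → ℝ)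

/-- The Langevin velocity field: minus the logarithmic gradient of `semi`. -/
def vel (t : ℝ) (x : E) : E := -((semi b a F t x)⁻¹ • semiGrad b a F t x)

/-- The derivative of `vel`. -/
def velDeriv (t : ℝ) (x : E) : E →L[ℝ] E :=
  ((semi b a F t x)⁻¹ ^ 2) • (innerSL ℝ (semiGrad b a F t x)).smulRight (semiGrad b a F t x)
    - (semi b a F t x)⁻¹ • semiHess b a F t x

variable {a F} (ha : ∀ i, 0 < a i) (hF : ContDiff ℝ ∞ F) (hF0 : ∀ x, 0 < F x)
  [IsFiniteMeasure (weighted b a F)] [NeZero (weighted b a F)]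
include ha hF hF0

theorem regularField_vel : RegularField (vel b a F) (velDeriv b a F) where
  continuousOn :=
    (((continuousOn_semi b ha hF fun x => (hF0 x).le).inv₀ fun p _ =>
      (semi_pos b ha hF0 p.1 p.2).ne').smul
      (continuousOn_semiGrad b ha hF fun x => (hF0 x).le)).neg
  hasFDerivAt t _ x := by
    have hU := semi_pos b ha hF0 t x
    have h1 := (hasDerivAt_inv hU.ne').comp_hasFDerivAt x (hasFDerivAt_semi b ha hF t x)
    refine (h1.smul (hasFDerivAt_semiGrad b ha hF t x)).neg.congr_fderiv ?_
    ext w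
    simp [velDeriv, smul_smul]
    abel
  continuousOn_deriv := by
    have h0 := (continuousOn_semi b ha hF fun x => (hF0 x).le).inv₀ fun p _ =>
      (semi_pos b ha hF0 p.1 p.2).ne'
    have h1 := continuousOn_semiGrad b ha hF fun x => (hF0 x).le
    have h2 : Continuous fun p : (E →L[ℝ] ℝ) × E => p.1.smulRight p.2 :=
      isBoundedBilinearMap_smulRight.continuous
    exact ((h0.pow 2).smul (h2.comp_continuousOn
      (((innerSL ℝ).continuous.comp_continuousOn h1).prodMk h1))).sub
      (h0.smul (continuousOn_semiHess b ha hF fun x => (hF0 x).le))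
  growth δ T hδ := by
    obtain ⟨C, hC, h⟩ := exists_norm_mehlerIntGrad_le ha b (weighted b a F) hδ
    refine ⟨C, hC, fun t ht x => ?_⟩
    have ht0 : 0 < t := hδ.trans_le ht.1
    have hU := semi_pos b ha hF0 t x
    rw [vel, norm_neg, norm_smul, norm_inv, Real.norm_eq_abs, abs_of_pos hU, inv_mul_eq_div,
      div_le_iff₀ hU, semiGrad, if_pos ht0, semi, if_pos ht0]
    exact h t ht.1 x

omit [NeZero (weighted b a F)] hF hF0 [IsFiniteMeasure (weighted b a F)] ha in
theorem hasFDerivAt_diagGaussianPDF (a : ι → ℝ) (y : E) : HasFDerivAt (diagGaussianPDF b a)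
    (-(diagGaussianPDF b a y • innerSL ℝ (diagOp b a y))) y := by
  have h : ∀ i, HasFDerivAt (fun x : E => ⟪b i, x⟫) (innerSL ℝ (b i)) y := fun i =>
    (innerSL ℝ (b i)).hasFDerivAt
  have h1 := HasFDerivAt.fun_sum (u := Finset.univ) fun i (_ : i ∈ Finset.univ) =>
    (((h i).pow 2).const_mul (a i))
  have h2 := ((((h1.fun_neg.mul_const (1 / 2 : ℝ)).exp).const_mul (gaussNorm E)⁻¹).mul_const
    (∏ i, √(a i)))
  have h3 : (fun y => (gaussNorm E)⁻¹ * Real.exp (-(∑ i, a i * ⟪b i, y⟫ ^ 2) * (1 / 2))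
      * ∏ i, √(a i)) = diagGaussianPDF b a := by
    ext z
    rw [diagGaussianPDF, mul_one_div]
  refine HasFDerivAt.congr_fderiv (f := diagGaussianPDF b a) (h3 ▸ h2) ?_
  ext w
  simp only [_root_.smul_apply, _root_.neg_apply, _root_.sum_apply, innerSL_apply_apply,
    smul_eq_mul, diagGaussianPDF, inner_diagOp_left]
  rw [mul_one_div (-(∑ i, a i * ⟪b i, y⟫ ^ 2))]
  have h4 : ∑ i, a i * ((2 : ℕ) • ⟪b i, y⟫ ^ (2 - 1) * ⟪b i, w⟫)
      = 2 * ∑ i, a i * (⟪b i, y⟫ * ⟪b i, w⟫) := by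
    rw [Finset.mul_sum]
    refine Finset.sum_congr rfl fun i _ => ?_
    simp
    ring
  rw [h4]
  ring

/-- Conservation of mass along the flow. -/
theorem density_mul_det_eq {S : ℝ → E → E} (hS : IsFlow (vel b a F) S) {M : ℝ → E →L[ℝ] E} {x : E}
    (hM0 : M 0 = ContinuousLinearMap.id ℝ E)
    (hM : ∀ t, 0 ≤ t → HasDerivWithinAt M (velDeriv b a F t (S t x) ∘L M t) (Ici 0) t)
    {t : ℝ} (ht : 0 ≤ t) :
    semi b a F t (S t x) * diagGaussianPDF b a (S t x) * (M t).det =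
      F x * diagGaussianPDF b a x := by
  have hid : (ContinuousLinearMap.id ℝ E).det = 1 := LinearMap.det_id
  rcases ht.eq_or_lt with rfl | ht
  · simp [hM0, hS.initial, semi, hid]
  set H : ℝ → ℝ := fun s => semi b a F s (S s x) * diagGaussianPDF b a (S s x) * (M s).det with hH
  have hpath := hS.continuousOn_path x
  have hsub : Icc 0 t ⊆ Ici 0 := Icc_subset_Ici_self
  have hpdf : Continuous (diagGaussianPDF b a) := continuous_iff_continuousAt.2 fun y =>
    (hasFDerivAt_diagGaussianPDF b a y).continuousAt
  have hdet : ContinuousOn (fun s => (M s).det) (Ici 0) := fun s hs =>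
    (hasDerivWithinAt_det_of_linear (hM s hs)).continuousWithinAt
  have hc : ContinuousOn H (Icc 0 t) :=
    ((continuousOn_comp_path (continuousOn_semi b ha hF fun x => (hF0 x).le) hsub
      (hpath.mono hsub)).mul (hpdf.comp_continuousOn (hpath.mono hsub))).mul (hdet.mono hsub)
  -- The derivative is computed at positive times only, where the backward equation is available;
  -- continuity of `H` up to time `0` closes the argument by the mean value theorem.
  have hd : ∀ s ∈ Ioo 0 t, HasDerivAt H 0 s := fun s hs => by
    have hs0 : 0 < s := hs.1
    have hn : Ici 0 ∈ 𝓝 s := Ici_mem_nhds hs0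
    have hU := semi_pos b ha hF0 s (S s x)
    have hv : vel b a F s (S s x) = -((semi b a F s (S s x))⁻¹ • semiGrad b a F s (S s x)) := rfl
    have h1 := (hS.hasDeriv x s hs0.le).hasDerivAt hn
    have h2 := (hasDerivWithinAt_det_of_linear (hM s hs0.le)).hasDerivAt hn
    have h3 := (hasFDerivAt_diagGaussianPDF b a (S s x)).comp_hasDerivAt s h1
    have h4 := (hasFDerivAt_mehlerInt_prod b (weighted b a F) ha hs0 (S s x)).comp_hasDerivAt s
      ((hasDerivAt_id s).prodMk h1)
    have h5 : HasDerivAt (fun s => semi b a F s (S s x)) _ s := h4.congr_of_eventuallyEq (by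
      filter_upwards [lt_mem_nhds hs0] with r hr
      simp only [semi, if_pos hr, Function.comp, id])
    refine ((h5.mul h3).mul h2).congr_deriv ?_
    -- The divergence of the velocity is `|∇U|² / U² - ΔU / U`. The first term cancels the transport
    -- of `U`, the second cancels the Laplacian in `∂_t U`, and the drift term of `∂_t U` cancels
    -- the transport of the Gaussian density.
    have h6 : LinearMap.trace ℝ E (velDeriv b a F s (S s x) : E →ₗ[ℝ] E) =
        (semi b a F s (S s x))⁻¹ ^ 2 * ⟪semiGrad b a F s (S s x), semiGrad b a F s (S s x)⟫
          - (semi b a F s (S s x))⁻¹ * LinearMap.trace ℝ E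
            (mehlerIntHess b a (weighted b a F) s (S s x) : E →ₗ[ℝ] E) := by
      rw [trace_eq_sum_inner b, trace_eq_sum_inner b, ← b.sum_inner_mul_inner, Finset.mul_sum,
        Finset.mul_sum, ← Finset.sum_sub_distrib]
      refine Finset.sum_congr rfl fun i _ => ?_
      simp [velDeriv, semiHess, hs0, inner_sub_right, inner_smul_right]
    rw [h6]
    simp only [ContinuousLinearMap.coprod_apply, ContinuousLinearMap.smulRight_apply,
      ContinuousLinearMap.id_apply, innerSL_apply_apply, _root_.neg_apply, _root_.smul_apply,
      smul_eq_mul, one_mul, Function.comp, mehlerIntTime_eq b (weighted b a F) ha hs0, hv,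
      inner_neg_right, inner_smul_right, Pi.mul_apply]
    have h7 : mehlerIntGrad b a (weighted b a F) s (S s x) = semiGrad b a F s (S s x) := by
      rw [semiGrad, if_pos hs0]
    rw [h7]
    field_simp
    ring
  obtain ⟨s, hs, hslope⟩ := exists_hasDerivAt_eq_slope H _ ht hc hd
  have h0 : H t - H 0 = 0 := by
    rw [eq_comm, div_eq_zero_iff] at hslope
    exact hslope.resolve_right (by linarith)
  have h1 : H 0 = F x * diagGaussianPDF b a x := by simp [hH, hM0, hS.initial, semi, hid]
  rw [← h1]
  exact sub_eq_zero.1 h0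

end Velocity

/-! ### Equilibrium, first moments and decay of the velocity -/

noncomputable section LongTime

open Set Metric Module
open scoped NNReal RealInnerProductSpace ENNReal

variable {ι : Type*} [Fintype ι] {E : Type*} [NormedAddCommGroup E] [InnerProductSpace ℝ E]
variable [FiniteDimensional ℝ E] [MeasurableSpace E] [BorelSpace E]
variable (b : OrthonormalBasis ι ℝ E) {a : ι → ℝ} (ha : ∀ i, 0 < a i)
variable (ν : Measure E) [IsFiniteMeasure ν]
include ha

omit [MeasurableSpace E] [BorelSpace E] [FiniteDimensional ℝ E] in
theorem tendsto_mehlerExp_atTop (x y : E) :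
    Tendsto (fun t => mehlerExp b a t x y) atTop (𝓝 0) := by
  obtain ⟨C, κ, hC, hκ, hcoef⟩ := exists_mehler_coeff_decay ha one_pos
  have hlim : Tendsto (fun t : ℝ => C * Real.exp (-κ * t)) atTop (𝓝 0) := by
    have h1 : Tendsto (fun t : ℝ => -κ * t) atTop atBot :=
      tendsto_id.const_mul_atTop_of_neg (by linarith)
    simpa using (Real.tendsto_exp_atBot.comp h1).const_mul C
  have hA : ∀ i, Tendsto (fun t => mehlerA (a i) t) atTop (𝓝 0) := fun i =>
    tendsto_of_tendsto_of_tendsto_of_le_of_le' tendsto_const_nhds hlim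
      ((eventually_ge_atTop 1).mono fun t ht => (mehlerA_pos (ha i) (by linarith)).le)
      ((eventually_ge_atTop 1).mono fun t ht => (hcoef t ht i).1)
  have hB : ∀ i, Tendsto (fun t => mehlerB (a i) t) atTop (𝓝 0) := fun i =>
    tendsto_of_tendsto_of_tendsto_of_le_of_le' tendsto_const_nhds hlim
      ((eventually_ge_atTop 1).mono fun t ht => (mehlerB_pos (ha i) (by linarith)).le)
      ((eventually_ge_atTop 1).mono fun t ht => (hcoef t ht i).2.1)
  have hL : ∀ i, Tendsto (fun t => mehlerL (a i) t) atTop (𝓝 0) := fun i =>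
    tendsto_of_tendsto_of_tendsto_of_le_of_le' tendsto_const_nhds hlim
      ((eventually_ge_atTop 1).mono fun t ht => (hcoef t ht i).2.2.1)
      ((eventually_ge_atTop 1).mono fun t ht => (hcoef t ht i).2.2.2)
  have h : Tendsto (fun t => mehlerExp b a t x y) atTop (𝓝 (∑ i : ι,
      (0 - 0 * (⟪b i, x⟫ ^ 2 + ⟪b i, y⟫ ^ 2) / 2 + 0 * (⟪b i, x⟫ * ⟪b i, y⟫)))) :=
    tendsto_finsetSum _ fun i _ => ((hL i).sub (((hB i).mul_const _).div_const 2)).add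
      ((hA i).mul_const _)
  simpa using h

omit ha in
theorem le_of_decay {C κ t : ℝ} (hC : 0 < C) (hκ : 0 < κ) (ht : 0 < t) :
    C * Real.exp (-κ * t) ≤ C :=
  mul_le_of_le_one_right hC.le (Real.exp_le_one_iff.2 (by nlinarith))

omit [FiniteDimensional ℝ E] in
/-- Convergence to equilibrium. -/
theorem tendsto_mehlerInt_atTop [SecondCountableTopology E] (x : E) :
    Tendsto (fun t => mehlerInt b a ν t x) atTop (𝓝 (ν.real univ)) := by
  obtain ⟨C, κ, hC, hκ, hcoef⟩ := exists_mehler_coeff_decay ha one_pos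
  have h := tendsto_integral_filter_of_dominated_convergence (μ := ν) (l := atTop)
    (F := fun t y => Real.exp (mehlerExp b a t x y)) (f := fun _ => Real.exp 0)
    (fun _ => Real.exp (Fintype.card ι * C + (C + ∑ i, a i) * ‖x‖ ^ 2))
    (Eventually.of_forall fun t =>
      (Real.continuous_exp.comp (continuous_mehlerExp b t x)).aestronglyMeasurable)
    ((eventually_ge_atTop 1).mono fun t ht => ae_of_all _ fun y => ?_) (integrable_const _)
    (ae_of_all _ fun y => (Real.continuous_exp.tendsto _).comp (tendsto_mehlerExp_atTop b ha x y))
  · simpa [mehlerInt] using h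
  · have ht0 : 0 < t := by linarith
    have hle := le_of_decay hC hκ ht0
    rw [Real.norm_eq_abs, abs_of_pos (Real.exp_pos _)]
    exact Real.exp_le_exp.2 (mehlerExp_le_norm ha b ht0 (fun i => (hcoef t ht i).2.1.trans hle)
      (fun i => (hcoef t ht i).2.2.2.trans hle) x y)

/-- Exponential decay of the logarithmic gradient, for measures with a first moment. -/
theorem exists_mehlerIntGrad_decay [NeZero ν] (hν : Integrable (fun y => ‖y‖) ν) (R : ℝ) :
    ∃ C c : ℝ, 0 < C ∧ 0 < c ∧ ∀ t, 1 ≤ t → ∀ x, ‖x‖ ≤ R →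
      ‖mehlerIntGrad b a ν t x‖ ≤ C * Real.exp (-c * t) * mehlerInt b a ν t x := by
  obtain ⟨C, κ, hC, hκ, hcoef⟩ := exists_mehler_coeff_decay ha one_pos
  obtain ⟨ρ, hρ0, hρ⟩ := exists_measureReal_closedBall_pos ν
  set s := ∑ i, a i with hs
  have hs0 : 0 ≤ s := Finset.sum_nonneg fun i _ => (ha i).le
  set K := Real.exp (Fintype.card ι * C + (C + s) * R ^ 2) with hK
  set m := Real.exp (-(C * (R ^ 2 + ρ ^ 2))) * ν.real (closedBall 0 ρ) with hm
  have hm0 : 0 < m := mul_pos (Real.exp_pos _) hρ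
  set I := ∫ y, (‖y‖ + |R|) ∂ν with hI
  have hI0 : 0 ≤ I := integral_nonneg fun y => by positivity
  refine ⟨C * K * (I + 1) / m, κ, by positivity, hκ, fun t ht x hx => ?_⟩
  have hx' : ‖x‖ ≤ |R| := hx.trans (le_abs_self R)
  have hx2 : ‖x‖ ^ 2 ≤ R ^ 2 := pow_le_pow_left₀ (norm_nonneg _) hx 2
  have ht0 : 0 < t := by linarith
  have hle := le_of_decay hC hκ ht0
  set r := C * Real.exp (-κ * t) with hr
  have hr0 : 0 < r := by positivity
  have hU : m ≤ mehlerInt b a ν t x := by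
    refine le_trans ?_ (le_mehlerInt ha b ht0 ν (fun i => (hcoef t ht i).1.trans hle)
      (fun i => (hcoef t ht i).2.1.trans hle) (fun i => (hcoef t ht i).2.2.1) hC.le x ρ)
    rw [hm]
    gcongr
  have hG : ‖mehlerIntGrad b a ν t x‖ ≤ K * r * I := by
    -- For `t ≥ 1` the kernel is bounded by `K`, and its logarithmic gradient is at most `r (‖y‖ +
    -- ‖x‖)` with `r` exponentially small. This is where the first moment enters.
    have h1 : ‖mehlerIntGrad b a ν t x‖ ≤ ∫ y, K * r * (‖y‖ + |R|) ∂ν := by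
      refine norm_integral_le_of_norm_le ((hν.add (integrable_const _)).const_mul _)
        (ae_of_all _ fun y => ?_)
      rw [norm_smul, Real.norm_eq_abs, abs_of_pos (Real.exp_pos _), mul_assoc]
      have h2 := norm_mehlerGrad_le b hr0.le
        (fun i => by rw [abs_of_pos (mehlerA_pos (ha i) ht0)]; exact (hcoef t ht i).1) hr0.le
        (fun i => by rw [abs_of_pos (mehlerB_pos (ha i) ht0)]; exact (hcoef t ht i).2.1) x y
      have h3 : Real.exp (mehlerExp b a t x y) ≤ K := by
        refine Real.exp_le_exp.2 ((mehlerExp_le_norm ha b ht0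
          (fun i => (hcoef t ht i).2.1.trans hle)
          (fun i => (hcoef t ht i).2.2.2.trans hle) x y).trans ?_)
        gcongr
      refine mul_le_mul h3 (h2.trans ?_) (norm_nonneg _) (Real.exp_pos _).le
      rw [← mul_add]
      gcongr
    rwa [integral_const_mul] at h1
  refine hG.trans ?_
  have h4 : C * K * (I + 1) / m * Real.exp (-κ * t) * m = K * r * (I + 1) := by
    rw [hr]
    field_simp
  refine le_trans ?_ (mul_le_mul_of_nonneg_left hU (by positivity))
  rw [h4]
  gcongr
  linarith

omit [FiniteDimensional ℝ E] [MeasurableSpace E] [BorelSpace E] ha in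
theorem continuous_mehlerExp_prod (t : ℝ) :
    Continuous fun p : E × E => mehlerExp b a t p.2 p.1 := by
  unfold mehlerExp
  fun_prop

omit [FiniteDimensional ℝ E] ha in
theorem measurable_mehler_prod [SecondCountableTopology E] (t : ℝ) :
    Measurable fun p : E × E => ENNReal.ofReal (Real.exp (mehlerExp b a t p.2 p.1)) :=
  (Real.measurable_exp.comp (continuous_mehlerExp_prod b t).measurable).ennreal_ofReal

omit [FiniteDimensional ℝ E] ha in
theorem measurable_ofReal_exp_mehlerExp (t : ℝ) (x : E) :
    Measurable fun y : E => ENNReal.ofReal (Real.exp (mehlerExp b a t x y)) :=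
  (Real.measurable_exp.comp (continuous_mehlerExp b t x).measurable).ennreal_ofReal

theorem lintegral_ouKernel_eq {t : ℝ} (ht : 0 < t) {g : E → ℝ≥0∞} (hg : Measurable g) (y : E) :
    ∫⁻ x, g x ∂(ouKernel b a t y) = ∫⁻ x, g x *
      ENNReal.ofReal (Real.exp (mehlerExp b a t x y)) ∂(diagGaussian b a) := by
  rw [ouKernel_eq_withDensity b ha ht, lintegral_withDensity_eq_lintegral_mul _
    (measurable_ofReal_exp_mehlerExp b t y) hg]
  refine lintegral_congr fun x => ?_
  rw [Pi.mul_apply, mul_comm, mehlerExp_comm]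

theorem ofReal_mehlerInt {t : ℝ} (ht : 0 < t) (x : E) : ENNReal.ofReal (mehlerInt b a ν t x) =
    ∫⁻ y, ENNReal.ofReal (Real.exp (mehlerExp b a t x y)) ∂ν :=
  ofReal_integral_eq_lintegral_ofReal (integrable_exp_mehlerExp b ν ha ht x)
    (ae_of_all _ fun _ => (Real.exp_pos _).le)

/-- The law of the Ornstein–Uhlenbeck process at time `t`, through its transition kernels. -/
theorem lintegral_ouKernel {t : ℝ} (ht : 0 < t) {g : E → ℝ≥0∞} (hg : Measurable g) :
    ∫⁻ y, ∫⁻ x, g x ∂(ouKernel b a t y) ∂ν =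
      ∫⁻ x, g x * ENNReal.ofReal (mehlerInt b a ν t x) ∂(diagGaussian b a) := by
  have h2 : Measurable fun p : E × E =>
      g p.2 * ENNReal.ofReal (Real.exp (mehlerExp b a t p.2 p.1)) :=
    (hg.comp measurable_snd).mul (measurable_mehler_prod b t)
  have h3 : AEMeasurable (Function.uncurry fun y x =>
      g x * ENNReal.ofReal (Real.exp (mehlerExp b a t x y))) (ν.prod (diagGaussian b a)) := by
    simp only [Function.uncurry_def]
    exact h2.aemeasurable
  rw [lintegral_congr (lintegral_ouKernel_eq b ha ht hg), lintegral_lintegral_swap h3]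
  refine lintegral_congr fun x => ?_
  rw [ofReal_mehlerInt b ha ν ht]
  exact lintegral_const_mul _ (measurable_ofReal_exp_mehlerExp b t x)

-- The transition law from `y` has mean `e^{-tA} y`, so the norm of the mean is at most the absolute
-- moment. This carries a first moment at time `t` back to time `0`.
omit ha in
theorem enorm_diagOp_le_lintegral_ouKernel (t : ℝ) (y : E) :
    ‖diagOp b (fun i => Real.exp (-t * a i)) y‖ₑ ≤ ∫⁻ x, ‖x‖ₑ ∂(ouKernel b a t y) := by
  have hcE := FiniteDimensional.complete ℝ E
  have h1 : ∫ z, (diagOp b (fun i => Real.exp (-t * a i)) y + diagOp b (ouDev a t) z)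
      ∂stdGaussian E = diagOp b (fun i => Real.exp (-t * a i)) y := by
    have hint : Integrable (fun z : E => z) (stdGaussian E) :=
      IsGaussian.integrable_id
    rw [integral_add (integrable_const _) ((diagOp b (ouDev a t)).integrable_comp hint),
      ContinuousLinearMap.integral_comp_comm _ hint]
    simp
  conv_lhs => rw [← h1]
  rw [ouKernel, lintegral_map (by fun_prop) (by fun_prop)]
  exact enorm_integral_le_lintegral_enorm _

omit ha in
theorem integrable_norm_mul_exp {c B : ℝ} (hc : 0 < c) :
    Integrable fun x : E => ‖x‖ * Real.exp (B * ‖x‖ - c * ‖x‖ ^ 2) := by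
  have h := (GaussianFourier.integrable_cexp_neg_mul_sq_norm_add (V := E) (b := (c / 2 : ℝ))
    (by simpa using hc) 0 0).norm
  refine (h.const_mul (Real.exp ((B + 1) ^ 2 / (2 * c)))).mono'
    (by fun_prop) (ae_of_all _ fun x => ?_)
  rw [norm_mul, norm_norm, Real.norm_eq_abs, abs_of_pos (Real.exp_pos _), Complex.norm_exp,
    show (-((c / 2 : ℝ) : ℂ) * (‖x‖ : ℂ) ^ 2 + 0 * ((⟪(0 : E), x⟫ : ℝ) : ℂ))
      = ((-(c / 2) * ‖x‖ ^ 2 : ℝ) : ℂ) by push_cast; ring, Complex.ofReal_re, ← Real.exp_add]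
  have h1 : ‖x‖ ≤ Real.exp ‖x‖ := by linarith [Real.add_one_le_exp ‖x‖]
  refine (mul_le_mul_of_nonneg_right h1 (Real.exp_pos _).le).trans ?_
  rw [← Real.exp_add]
  refine Real.exp_le_exp.2 ?_
  -- Completion of the square, after half of the Gaussian exponent is set aside for integrability.
  have h2 : (B + 1) ^ 2 / (2 * c) + -(c / 2) * ‖x‖ ^ 2 - (‖x‖ + (B * ‖x‖ - c * ‖x‖ ^ 2)) =
      ((B + 1) - c * ‖x‖) ^ 2 / (2 * c) := by
    field_simp
    ring
  have h3 : 0 ≤ ((B + 1) - c * ‖x‖) ^ 2 / (2 * c) := by positivity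
  linarith

/-- A Gaussian upper bound on the Mehler integral yields a first moment. -/
theorem integrable_norm_of_mehlerInt_le {t : ℝ} (ht : 0 < t) {K B l κ : ℝ}
    (hκ : ∀ i, κ ≤ a i) (hl : -κ < l)
    (hU : ∀ x, mehlerInt b a ν t x ≤ K * Real.exp (B * ‖x‖ - l / 2 * ‖x‖ ^ 2)) :
    Integrable (fun y => ‖y‖) ν := by
  have hcE := FiniteDimensional.complete ℝ E
  set P := (gaussNorm E)⁻¹ * ∏ i, √(a i) with hP
  have hZ := gaussNorm_pos E
  have hP0 : 0 ≤ P := by positivity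
  have hpdf : ∀ x, diagGaussianPDF b a x ≤ P * Real.exp (-(κ / 2) * ‖x‖ ^ 2) := fun x => by
    rw [diagGaussianPDF, mul_right_comm]
    refine mul_le_mul_of_nonneg_left (Real.exp_le_exp.2 ?_) hP0
    have : κ * ‖x‖ ^ 2 ≤ ∑ i, a i * ⟪b i, x⟫ ^ 2 := by
      rw [norm_sq_eq_sum_inner b, Finset.mul_sum]
      exact Finset.sum_le_sum fun i _ => mul_le_mul_of_nonneg_right (hκ i) (sq_nonneg _)
    linarith
  have hint := (integrable_norm_mul_exp (E := E) (c := (κ + l) / 2) (B := B)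
    (by linarith)).const_mul (P * K)
  -- The evolved law has a finite first moment: its Lebesgue density has Gaussian rate at least `(κ
  -- + l) / 2`, positive by `hl`, up to an exponential factor linear in `‖x‖`.
  have hfin : ∫⁻ x, ‖x‖ₑ * ENNReal.ofReal (mehlerInt b a ν t x) ∂(diagGaussian b a) < ⊤ := by
    have hmeas : Measurable fun x => mehlerInt b a ν t x :=
      (continuous_iff_continuousAt.2 fun x =>
        (hasFDerivAt_mehlerInt b ν ha ht x).continuousAt).measurable
    rw [diagGaussian_eq_withDensity b ha, lintegral_withDensity_eq_lintegral_mul _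
      (measurable_diagGaussianPDF b).ennreal_ofReal (by fun_prop)]
    refine lt_of_le_of_lt (lintegral_mono fun x => ?_) hint.2
    rw [Pi.mul_apply, ← ofReal_norm, ← ENNReal.ofReal_mul (norm_nonneg _),
      ← ENNReal.ofReal_mul (diagGaussianPDF_pos b ha x).le, ← ofReal_norm]
    refine ENNReal.ofReal_le_ofReal ((le_abs_self _).trans' ?_)
    have h1 : P * K * (‖x‖ * Real.exp (B * ‖x‖ - (κ + l) / 2 * ‖x‖ ^ 2)) =
        P * Real.exp (-(κ / 2) * ‖x‖ ^ 2) *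
          (‖x‖ * (K * Real.exp (B * ‖x‖ - l / 2 * ‖x‖ ^ 2))) := by
      rw [show B * ‖x‖ - (κ + l) / 2 * ‖x‖ ^ 2 = -(κ / 2) * ‖x‖ ^ 2 +
        (B * ‖x‖ - l / 2 * ‖x‖ ^ 2) by ring, Real.exp_add]
      ring
    refine le_of_le_of_eq ?_ h1.symm
    have h0 : 0 ≤ mehlerInt b a ν t x := integral_nonneg fun y => (Real.exp_pos _).le
    have hK : 0 ≤ K * Real.exp (B * ‖x‖ - l / 2 * ‖x‖ ^ 2) := h0.trans (hU x)
    exact mul_le_mul (hpdf x) (mul_le_mul_of_nonneg_left (hU x) (norm_nonneg _))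
      (by positivity) (by positivity)
  rw [← lintegral_ouKernel b ha ν ht measurable_enorm] at hfin
  -- The moment at time `t` is the `ν`-average of the moments of the transition laws, and these
  -- dominate `‖e^{-tA} y‖`. Inverting `e^{-tA}` then gives the first moment of `ν`.
  have hD : Integrable (fun y => diagOp b (fun i => Real.exp (-t * a i)) y) ν :=
    ⟨by fun_prop, (lintegral_mono fun y =>
      enorm_diagOp_le_lintegral_ouKernel b t y).trans_lt hfin⟩
  refine ((diagOp b fun i => (Real.exp (-t * a i))⁻¹).integrable_comp hD).norm.congr
    (ae_of_all _ fun y => ?_)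
  simp only [diagOp_inv_cancel' b (fun i => (Real.exp_pos (-t * a i)).ne')]

/-- Semiconcavity of the driving potential at a positive time yields a first moment. -/
theorem integrable_norm_of_velDeriv_ge {F : E → ℝ} (hF : ContDiff ℝ ∞ F) (hF0 : ∀ x, 0 < F x)
    [IsFiniteMeasure (weighted b a F)] [NeZero (weighted b a F)] {t : ℝ} (ht : 0 < t) {l κ : ℝ}
    (hκ : ∀ i, κ ≤ a i) (hl : -κ < l) (h : ∀ x w, l * ‖w‖ ^ 2 ≤ ⟪velDeriv b a F t x w, w⟫) :
    Integrable (fun y => ‖y‖) (weighted b a F) := by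
  have hpos := semi_pos b ha hF0 t
  refine integrable_norm_of_mehlerInt_le b ha (weighted b a F) ht (K := semi b a F t 0)
    (B := ‖vel b a F t 0‖) hκ hl fun x => ?_
  have hsemi : mehlerInt b a (weighted b a F) t x = semi b a F t x := by rw [semi, if_pos ht]
  rw [hsemi]
  -- Here `vel` at `0` is minus the gradient of `log U` at `0`, and `l` bounds minus the Hessian of
  -- `log U` from below. So `ψ` is `log U` along the ray minus its linear term and the quadratic
  -- majorant; it cannot increase between `0` and `1`.
  set ψ : ℝ → ℝ := fun s => Real.log (semi b a F t (s • x)) + s * ⟪vel b a F t 0, x⟫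
    + s ^ 2 * (l * ‖x‖ ^ 2 / 2) with hψ
  have hd : ∀ s : ℝ, HasDerivAt ψ (-⟪vel b a F t (s • x), x⟫ + ⟪vel b a F t 0, x⟫
      + 2 * s * (l * ‖x‖ ^ 2 / 2)) s := fun s => by
    have h1 : HasDerivAt (fun s : ℝ => s • x) x s := by
      simpa using (hasDerivAt_id s).smul_const x
    have h2 : HasDerivAt (fun s : ℝ => semi b a F t (s • x))
        (innerSL ℝ (semiGrad b a F t (s • x)) x) s := by
      have h3 := hasFDerivAt_semi b ha hF t (s • x)
      exact h3.comp_hasDerivAt s h1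
    refine (((h2.log (hpos _).ne').add ((hasDerivAt_id s).mul_const _)).add
      ((hasDerivAt_pow 2 s).mul_const _)).congr_deriv ?_
    simp only [vel, innerSL_apply_apply, inner_neg_left, real_inner_smul_left]
    simp only [div_eq_inv_mul]
    ring
  obtain ⟨s, hs, hslope⟩ := exists_hasDerivAt_eq_slope ψ _ (zero_lt_one' ℝ)
    (fun s _ => (hd s).continuousAt.continuousWithinAt) fun s _ => hd s
  have h1 := inner_sub_ge_of_hasFDerivAt
    (fun x => (regularField_vel b ha hF hF0).hasFDerivAt t ht.le x) h (s • x) 0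
  rw [sub_zero, real_inner_smul_right, inner_sub_left, norm_smul, Real.norm_eq_abs, mul_pow,
    sq_abs] at h1
  have h2 : s * (l * ‖x‖ ^ 2) ≤ ⟪vel b a F t (s • x), x⟫ - ⟪vel b a F t 0, x⟫ := by
    refine le_of_mul_le_mul_left ?_ hs.1
    linarith
  have h3 : ψ 1 - ψ 0 ≤ 0 := by
    rw [sub_zero, div_one] at hslope
    rw [← hslope]
    linarith
  simp only [hψ, one_smul, zero_smul] at h3
  have h4 : -(‖vel b a F t 0‖ * ‖x‖) ≤ ⟪vel b a F t 0, x⟫ :=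
    neg_le_of_abs_le (abs_real_inner_le_norm _ _)
  have h5 : Real.log (semi b a F t x) ≤ Real.log (semi b a F t 0)
      + (‖vel b a F t 0‖ * ‖x‖ - l / 2 * ‖x‖ ^ 2) := by linarith
  rw [← Real.log_exp (‖vel b a F t 0‖ * ‖x‖ - l / 2 * ‖x‖ ^ 2),
    ← Real.log_mul (hpos 0).ne' (Real.exp_pos _).ne'] at h5
  exact (Real.log_le_log_iff (hpos x) (mul_pos (hpos 0) (Real.exp_pos _))).1 h5

end LongTime

/-! ### Construction of the transport maps and of their limit -/

section Transport

open Set Metric Module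
open scoped NNReal RealInnerProductSpace ENNReal

variable {ι : Type*} [Fintype ι] {E : Type*} [NormedAddCommGroup E] [InnerProductSpace ℝ E]
variable [FiniteDimensional ℝ E] [MeasurableSpace E] [BorelSpace E]
variable (b : OrthonormalBasis ι ℝ E) {a : ι → ℝ} {F : E → ℝ}

-- Otherwise `|lam|` would be at least `κ` on a half-line of infinite length. One such time is
-- enough to produce the first moment.
omit [Fintype ι] [FiniteDimensional ℝ E] [MeasurableSpace E] [BorelSpace E]
  [InnerProductSpace ℝ E] in
theorem exists_pos_neg_lt_of_integrableOn {lam : ℝ → ℝ} (h : IntegrableOn lam (Ioi 0)) {κ : ℝ}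
    (hκ : 0 < κ) : ∃ t, 0 < t ∧ -κ < lam (2 * t) := by
  by_contra! hc
  have h1 : IntegrableOn (fun _ : ℝ => κ) (Ioi (0 : ℝ)) := by
    refine h.norm.mono' aestronglyMeasurable_const ?_
    filter_upwards [ae_restrict_mem measurableSet_Ioi] with s hs
    have h2 := hc (s / 2) (half_pos hs)
    rw [mul_div_cancel₀ s two_ne_zero] at h2
    rw [Real.norm_eq_abs, Real.norm_eq_abs, abs_of_pos hκ]
    linarith [neg_le_abs (lam s)]
  rw [integrableOn_const_iff (by simp)] at h1
  simp [hκ.ne'] at h1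

variable (ha : ∀ i, 0 < a i) (hF : ContDiff ℝ ∞ F) (hF0 : ∀ x, 0 < F x)
  [IsProbabilityMeasure (weighted b a F)]
include ha hF hF0

omit hF0 in
theorem continuous_semi (t : ℝ) : Continuous (semi b a F t) :=
  continuous_iff_continuousAt.2 fun x => (hasFDerivAt_semi b ha hF t x).continuousAt

/-- By conservation of mass the determinant is a quotient of two positive densities. -/
theorem det_pos_of_isFlow {S : ℝ → E → E} (hS : IsFlow (vel b a F) S) {M : ℝ → E →L[ℝ] E} {x : E}
    (hM0 : M 0 = ContinuousLinearMap.id ℝ E)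
    (hM : ∀ t, 0 ≤ t → HasDerivWithinAt M (velDeriv b a F t (S t x) ∘L M t) (Ici 0) t)
    {t : ℝ} (ht : 0 ≤ t) : 0 < (M t).det := by
  have h1 := density_mul_det_eq b ha hF hF0 hS hM0 hM ht
  have h2 := mul_pos (hF0 x) (diagGaussianPDF_pos b ha x)
  rw [← h1] at h2
  exact (pos_iff_pos_of_mul_pos h2).1
    (mul_pos (semi_pos b ha hF0 t _) (diagGaussianPDF_pos b ha _))

theorem map_withDensity_semi {S : ℝ → E → E} (hS : IsFlow (vel b a F) S) {t : ℝ} (ht : 0 ≤ t)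
    {T : E → E} (hl : Function.LeftInverse T (S t)) (hr : Function.RightInverse T (S t))
    (hT : Measurable T) :
    ((diagGaussian b a).withDensity fun x => ENNReal.ofReal (semi b a F t x)).map T =
      weighted b a F := by
  obtain ⟨M, hM0, hM, hMd, -⟩ := hS.exists_deriv (regularField_vel b ha hF hF0)
  have hρ : ∀ f : E → ℝ, Measurable f → (diagGaussian b a).withDensity
      (fun x => ENNReal.ofReal (f x)) =
      volume.withDensity fun x => ENNReal.ofReal (diagGaussianPDF b a x * f x) := fun f hf => by
    rw [diagGaussian_eq_withDensity b ha,
      ← withDensity_mul _ (measurable_diagGaussianPDF b).ennreal_ofReal hf.ennreal_ofReal]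
    congr 1
    ext x
    rw [Pi.mul_apply, ENNReal.ofReal_mul (diagGaussianPDF_pos b ha x).le]
  rw [weighted, hρ F hF.continuous.measurable, hρ _ (continuous_semi b ha hF t).measurable]
  refine map_withDensity_of_det volume (hMd t ht) hT hl hr fun x => ?_
  rw [abs_of_pos (det_pos_of_isFlow b ha hF hF0 hS (hM0 x) (hM x) ht),
    mul_comm (diagGaussianPDF b a x), mul_comm (diagGaussianPDF b a (S t x))]
  exact density_mul_det_eq b ha hF hF0 hS (hM0 x) (hM x) ht

/-- Lipschitz transport maps along the Ornstein–Uhlenbeck semigroup. -/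
theorem exists_transport {lam : ℝ → ℝ}
    (hl : ∀ t, 0 ≤ t → ∀ x w, lam (2 * t) * ‖w‖ ^ 2 ≤ ⟪velDeriv b a F t x w, w⟫)
    (hlam : ∀ t : ℝ, 0 ≤ t → IntervalIntegrable lam volume 0 t) :
    ∃ S T : ℝ → E → E, IsFlow (vel b a F) S ∧
      (∀ t : ℝ, 0 ≤ t →
        Function.LeftInverse (T t) (S t) ∧ Function.RightInverse (T t) (S t) ∧
        ContDiff ℝ 1 (S t) ∧ ContDiff ℝ 1 (T t) ∧
        ((diagGaussian b a).withDensity fun x => ENNReal.ofReal (semi b a F t x)).map (T t) =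
          weighted b a F ∧
        LipschitzWith (Real.exp (-(∫ s in (0 : ℝ)..(2 * t), lam s) / 2)).toNNReal (T t)) ∧
      (IntegrableOn lam (Ioi 0) → ∃ Tlim : E → E,
        (∀ x, Tendsto (fun t => T t x) atTop (𝓝 (Tlim x))) ∧
        (diagGaussian b a).map Tlim = weighted b a F ∧
        LipschitzWith (Real.exp (-(∫ s in Ioi (0 : ℝ), lam s) / 2)).toNNReal Tlim) := by
  have hproper : ProperSpace E := FiniteDimensional.proper ℝ E
  have hcE := FiniteDimensional.complete ℝ E
  have hv := regularField_vel b ha hF hF0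
  obtain ⟨S, hS⟩ := hv.exists_isFlow
  obtain ⟨M, hM0, hM, hMd, hSC⟩ := hS.exists_deriv hv
  have hex : ∀ t, 0 ≤ t → ∃ T : E → E, Function.LeftInverse T (S t) ∧
      Function.RightInverse T (S t) ∧ ContDiff ℝ 1 T ∧
      LipschitzWith (Real.exp (-(∫ s in (0 : ℝ)..(2 * t), lam s) / 2)).toNNReal T := fun t ht => by
    -- The expansion rate at time `s` is `lam (2 * s)`; the substitution `s ↦ 2 s` produces both the
    -- upper limit `2 * t` and the factor one half in the exponent.
    have hint : IntervalIntegrable (fun s => lam (2 * s)) volume 0 t := by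
      simpa using (hlam (2 * t) (by linarith)).comp_mul_left (c := 2)
    have h1 := exists_inverse_of_expanding (hSC t ht) (hMd t ht)
      (fun x => (det_pos_of_isFlow b ha hF hF0 hS (hM0 x) (hM x) ht).ne') (Real.exp_pos _)
      (hS.norm_sub_ge hv hl ht hint)
    rw [← Real.exp_neg, intervalIntegral.integral_comp_mul_left _ two_ne_zero, mul_zero,
      smul_eq_mul] at h1
    rwa [inv_mul_eq_div, ← neg_div] at h1
  choose! T hTl hTr hTC hTL using hex
  refine ⟨S, T, hS, fun t ht => ⟨hTl t ht, hTr t ht, hSC t ht, hTC t ht,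
    map_withDensity_semi b ha hF hF0 hS ht (hTl t ht) (hTr t ht) (hTC t ht).continuous.measurable,
    hTL t ht⟩, fun hint => ?_⟩
  obtain ⟨κ, hκ, hκa⟩ := exists_pos_forall_le ha
  obtain ⟨t₀, ht₀, hlt₀⟩ := exists_pos_neg_lt_of_integrableOn hint hκ
  -- The expansion bound at the time `t₀`, where `lam (2 * t₀)` exceeds minus a lower bound of the
  -- eigenvalues, gives the first moment on which the decay of the velocity rests.
  have hmom := integrable_norm_of_velDeriv_ge b ha hF hF0 ht₀ hκa hlt₀ (hl t₀ ht₀.le)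
  -- Convergence of the inverses needs a Lipschitz constant independent of `t`, so `|lam|` is used
  -- here. The sharp constant returns for the limit map.
  have hK : ∀ t, 0 ≤ t → LipschitzWith (Real.exp ((∫ s in Ioi (0 : ℝ), |lam s|) / 2)).toNNReal
      (T t) := fun t ht => by
    refine (hTL t ht).weaken (Real.toNNReal_le_toNNReal (Real.exp_le_exp.2 ?_))
    have h1 : -(∫ s in (0 : ℝ)..(2 * t), lam s) ≤ ∫ s in Ioi (0 : ℝ), |lam s| := by
      refine (neg_le_abs _).trans ?_
      rw [intervalIntegral.integral_of_le (by linarith)]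
      refine (abs_integral_le_integral_abs).trans
        (setIntegral_mono_set hint.abs (ae_of_all _ fun s => abs_nonneg _)
          (Ioc_subset_Ioi_self).eventuallyLE)
    linarith
  have hdec : ∀ R : ℝ, ∃ C c : ℝ, 0 < C ∧ 0 < c ∧ ∀ t, 1 ≤ t → ∀ x, ‖x‖ ≤ R →
      ‖vel b a F t x‖ ≤ C * Real.exp (-c * t) := fun R => by
    obtain ⟨C, c, hC, hc, h⟩ := exists_mehlerIntGrad_decay b ha (weighted b a F) hmom R
    refine ⟨C, c, hC, hc, fun t ht x hx => ?_⟩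
    have ht0 : 0 < t := by linarith
    have hU := semi_pos b ha hF0 t x
    rw [vel, norm_neg, norm_smul, norm_inv, Real.norm_eq_abs, abs_of_pos hU, inv_mul_eq_div,
      div_le_iff₀ hU, semiGrad, if_pos ht0, semi, if_pos ht0]
    exact h t ht x hx
  choose Tlim hTlim using hS.exists_tendsto_inverse hTl hTr hK hdec
  have hLip : LipschitzWith (Real.exp (-(∫ s in Ioi (0 : ℝ), lam s) / 2)).toNNReal Tlim := by
    refine LipschitzWith.of_dist_le_mul fun x y => ?_
    have h1 : Tendsto (fun t : ℝ => Real.exp (-(∫ s in (0 : ℝ)..(2 * t), lam s) / 2)) atTop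
        (𝓝 (Real.exp (-(∫ s in Ioi (0 : ℝ), lam s) / 2))) :=
      (Real.continuous_exp.tendsto _).comp (((intervalIntegral_tendsto_integral_Ioi 0 hint
        (tendsto_id.const_mul_atTop two_pos)).neg).div_const 2)
    refine le_of_tendsto_of_tendsto ((hTlim x).dist (hTlim y))
      ((NNReal.tendsto_coe.2 ((continuous_real_toNNReal.tendsto _).comp h1)).mul_const _) ?_
    filter_upwards [eventually_ge_atTop 0] with t ht
    exact (hTL t ht).dist_le_mul x y
  refine ⟨Tlim, hTlim, ?_, hLip⟩
  refine map_eq_of_tendsto_density (h := fun n : ℕ => semi b a F n) (T := fun n => T n)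
    (fun n => (continuous_semi b ha hF n).measurable) (fun x => ?_)
    (fun n => (hTC n n.cast_nonneg).continuous) hLip.continuous
    (fun x => (hTlim x).comp tendsto_natCast_atTop_atTop)
    fun n => map_withDensity_semi b ha hF hF0 hS n.cast_nonneg (hTl n n.cast_nonneg)
      (hTr n n.cast_nonneg) (hTC n n.cast_nonneg).continuous.measurable
  have h1 := (tendsto_mehlerInt_atTop b ha (weighted b a F) x).comp
    (tendsto_natCast_atTop_atTop (R := ℝ))
  rw [probReal_univ] at h1
  refine h1.congr' ?_
  filter_upwards [eventually_gt_atTop 0] with n hn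
  rw [Function.comp, semi, if_pos (Nat.cast_pos.2 hn)]

end Transport

/-! ### Functions of a symmetric matrix in its eigenbasis -/

noncomputable section Spectral

open Set Metric Module
open scoped NNReal RealInnerProductSpace ENNReal MatrixOrder

variable {ι : Type*} [Fintype ι] [DecidableEq ι] {A : Matrix ι ι ℝ} (hA : A.IsHermitian)

/-- The function `f` of the eigenvalues of a Hermitian matrix, as a matrix. -/
def specMat (f : ι → ℝ) : Matrix ι ι ℝ :=
  (hA.eigenvectorUnitary : Matrix ι ι ℝ) * diagonal f * star (hA.eigenvectorUnitary : Matrix ι ι ℝ)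

theorem specMat_apply (f : ι → ℝ) (i j : ι) : specMat hA f i j =
    ∑ k, (hA.eigenvectorUnitary : Matrix ι ι ℝ) i k * f k *
      star (hA.eigenvectorUnitary : Matrix ι ι ℝ) k j := by
  rw [specMat, Matrix.mul_apply]
  simp only [Matrix.mul_diagonal]

theorem specMat_mul (f g : ι → ℝ) :
    specMat hA f * specMat hA g = specMat hA fun i => f i * g i := by
  have h := Unitary.coe_star_mul_self hA.eigenvectorUnitary
  simp only [specMat, Matrix.mul_assoc]
  rw [← Matrix.mul_assoc (star (hA.eigenvectorUnitary : Matrix ι ι ℝ)) _ (diagonal g * _),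
    h, Matrix.one_mul, ← Matrix.mul_assoc (diagonal f), diagonal_mul_diagonal]

theorem specMat_one : specMat hA (fun _ => 1) = 1 := by
  rw [specMat, diagonal_one, Matrix.mul_one]
  exact Unitary.coe_mul_star_self _

theorem specMat_eigenvalues : specMat hA hA.eigenvalues = A := by
  conv_rhs => rw [hA.spectral_theorem]
  rfl

theorem specMat_smul (c : ℝ) (f : ι → ℝ) : c • specMat hA f = specMat hA fun i => c * f i := by
  ext i j
  rw [Matrix.smul_apply, specMat_apply, specMat_apply, smul_eq_mul, Finset.mul_sum]
  exact Finset.sum_congr rfl fun k _ => by ring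

theorem specMat_posSemidef {f : ι → ℝ} (hf : ∀ i, 0 ≤ f i) : (specMat hA f).PosSemidef := by
  rw [specMat, star_eq_conjTranspose]
  exact (PosSemidef.diagonal (Pi.le_def.2 hf)).mul_mul_conjTranspose_same _

theorem exp_specMat (f : ι → ℝ) :
    NormedSpace.exp (specMat hA f) = specMat hA fun i => Real.exp (f i) := by
  have hinv : (hA.eigenvectorUnitary : Matrix ι ι ℝ)⁻¹ =
      star (hA.eigenvectorUnitary : Matrix ι ι ℝ) :=
    Matrix.inv_eq_right_inv (Unitary.coe_mul_star_self hA.eigenvectorUnitary)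
  have hu : IsUnit (hA.eigenvectorUnitary : Matrix ι ι ℝ) :=
    IsUnit.of_mul_eq_one _ (Unitary.coe_mul_star_self hA.eigenvectorUnitary)
  rw [specMat, specMat, ← hinv, Matrix.exp_conj _ _ hu, Matrix.exp_diagonal]
  congr 3
  ext i
  rw [Real.exp_eq_exp_ℝ, Pi.coe_exp]

theorem exp_smul_eq_specMat (c : ℝ) :
    NormedSpace.exp (c • A) = specMat hA fun i => Real.exp (c * hA.eigenvalues i) := by
  conv_lhs => rw [← specMat_eigenvalues hA, specMat_smul, exp_specMat]

theorem toEuclideanCLM_specMat (f : ι → ℝ) :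
    toEuclideanCLM (𝕜 := ℝ) (specMat hA f) = diagOp hA.eigenvectorBasis f := by
  ext1 x
  refine ext_inner_basis hA.eigenvectorBasis fun i => ?_
  rw [inner_diagOp]
  have hb : ∀ j, toEuclideanCLM (𝕜 := ℝ) (specMat hA f) (hA.eigenvectorBasis j) =
      f j • hA.eigenvectorBasis j := fun j => by
    apply (WithLp.ofLp_injective 2)
    rw [ofLp_toEuclideanCLM, specMat, ← mulVec_mulVec, ← mulVec_mulVec,
      hA.star_eigenvectorUnitary_mulVec, diagonal_mulVec_single, ← smul_eq_mul, Pi.single_smul,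
      mulVec_smul, hA.eigenvectorUnitary_mulVec]
    rfl
  conv_lhs => rw [← hA.eigenvectorBasis.sum_repr' x, map_sum, inner_sum]
  simp only [map_smul, hb, inner_smul_right, hA.eigenvectorBasis.inner_eq_ite]
  simp [mul_comm]

/-- The Gaussian measure is built from the positive square root of its covariance, and uniqueness of
that root identifies it in the eigenbasis. -/
theorem multivariateGaussian_specMat {f : ι → ℝ} (hf : ∀ i, 0 ≤ f i) :
    multivariateGaussian 0 (specMat hA f) =
      (stdGaussian (EuclideanSpace ℝ ι)).map (diagOp hA.eigenvectorBasis fun i => √(f i)) := by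
  have h : CFC.sqrt (specMat hA f) = specMat hA fun i => √(f i) := by
    refine CFC.sqrt_unique ?_ (specMat_posSemidef hA fun i => Real.sqrt_nonneg _).nonneg
    rw [specMat_mul]
    congr 1
    ext i
    exact Real.mul_self_sqrt (hf i)
  rw [multivariateGaussian, h, toEuclideanCLM_specMat]
  simp only [zero_add]

theorem intervalIntegral_specMat {f : ℝ → ι → ℝ} (hf : ∀ i, Continuous fun s => f s i) (t : ℝ)
    (i j : ι) : ∫ s in (0 : ℝ)..t, specMat hA (f s) i j =
      specMat hA (fun k => ∫ s in (0 : ℝ)..t, f s k) i j := by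
  simp only [specMat_apply]
  rw [intervalIntegral.integral_finsetSum fun k _ =>
    (Continuous.intervalIntegrable (by have := hf k; fun_prop) _ _)]
  refine Finset.sum_congr rfl fun k _ => ?_
  rw [intervalIntegral.integral_mul_const, intervalIntegral.integral_const_mul]

end Spectral

/-! ### Matching the dynamics, the model and the renormalized potential with the diagonal picture -/

noncomputable section Bridge

open Set Metric Module
open scoped NNReal RealInnerProductSpace ENNReal

variable {ι : Type*} [Fintype ι] [DecidableEq ι] {A : Matrix ι ι ℝ} (hA : A.PosDef)

theorem integral_two_mul_exp {c : ℝ} (hc : 0 < c) (t : ℝ) :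
    ∫ s in (0 : ℝ)..t, 2 * Real.exp (-(2 * s) * c) = (1 - Real.exp (-t * c) ^ 2) / c := by
  have h : ∀ s : ℝ, HasDerivAt (fun s => -Real.exp (-(2 * s) * c) / c)
      (2 * Real.exp (-(2 * s) * c)) s := fun s => by
    have h1 : HasDerivAt (fun s : ℝ => -(2 * s) * c) (-2 * c) s := by
      simpa using (((hasDerivAt_id s).const_mul 2).neg).mul_const c
    refine (h1.exp.neg.div_const c).congr_deriv ?_
    field_simp
  rw [intervalIntegral.integral_eq_sub_of_hasDerivAt (fun s _ => h s)
    (Continuous.intervalIntegrable (by fun_prop) _ _)]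
  have h2 : Real.exp (-t * c) ^ 2 = Real.exp (-(2 * t) * c) := by
    rw [← Real.exp_nat_mul]
    congr 1
    push_cast
    ring
  rw [h2]
  simp
  ring

theorem ouCovariance_eq_specMat (t : ℝ) : ouCovariance A t =
    specMat hA.1 fun i => (1 - Real.exp (-t * hA.1.eigenvalues i) ^ 2) / hA.1.eigenvalues i := by
  ext i j
  rw [ouCovariance, Matrix.of_apply]
  have h1 : ∀ s : ℝ, 2 * NormedSpace.exp (-(2 * s) • A) i j =
      specMat hA.1 (fun k => 2 * Real.exp (-(2 * s) * hA.1.eigenvalues k)) i j := fun s => by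
    rw [exp_smul_eq_specMat hA.1, ← specMat_smul]
    rfl
  simp_rw [h1]
  rw [intervalIntegral_specMat hA.1 (fun k => by fun_prop)]
  congr 2
  ext k
  exact integral_two_mul_exp (hA.eigenvalues_pos k) t

-- As `Q_s² = e^{-sA}`, this is the substitution `s ↦ 2 s`. It is the source of the doubled time in
-- the Lipschitz constants.
include hA in
theorem C_two_mul_eq_ouCovariance (t : ℝ) : C A (2 * t) = ouCovariance A t := by
  ext i j
  rw [C, ouCovariance, Matrix.of_apply, Matrix.of_apply]
  have h1 : ∀ s, (Q A s * Q A s) i j = specMat hA.1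
      (fun k => Real.exp (-s * hA.1.eigenvalues k)) i j := fun s => by
    rw [Q, exp_smul_eq_specMat hA.1, specMat_mul]
    congr 2
    ext k
    rw [← Real.exp_add]
    ring_nf
  have h2 : ∀ s : ℝ, 2 * NormedSpace.exp (-(2 * s) • A) i j =
      2 * specMat hA.1 (fun k => Real.exp (-(2 * s) * hA.1.eigenvalues k)) i j := fun s => by
    rw [exp_smul_eq_specMat hA.1]
  simp_rw [h1, h2]
  have h3 := intervalIntegral.smul_integral_comp_mul_left (a := 0) (b := t)
    (fun s => specMat hA.1 (fun k => Real.exp (-s * hA.1.eigenvalues k)) i j) 2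
  rw [mul_zero, smul_eq_mul] at h3
  rw [intervalIntegral.integral_const_mul, h3]

theorem multivariateGaussian_ouCovariance {t : ℝ} (ht : 0 ≤ t) :
    multivariateGaussian 0 (ouCovariance A t) = (stdGaussian (EuclideanSpace ℝ ι)).map
      (diagOp hA.1.eigenvectorBasis (ouDev hA.1.eigenvalues t)) := by
  rw [ouCovariance_eq_specMat hA, multivariateGaussian_specMat]
  · rfl
  · intro i
    have := hA.eigenvalues_pos i
    have h1 : Real.exp (-t * hA.1.eigenvalues i) ≤ 1 := Real.exp_le_one_iff.2 (by nlinarith)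
    exact div_nonneg (by nlinarith [Real.exp_pos (-t * hA.1.eigenvalues i)]) this.le

theorem freeField_eq_diagGaussian :
    freeField A = diagGaussian hA.1.eigenvectorBasis hA.1.eigenvalues := by
  have h : A⁻¹ = specMat hA.1 fun i => (hA.1.eigenvalues i)⁻¹ := by
    refine Matrix.inv_eq_right_inv ?_
    have h1 := specMat_mul hA.1 hA.1.eigenvalues fun i => (hA.1.eigenvalues i)⁻¹
    rw [specMat_eigenvalues] at h1
    rw [h1, ← specMat_one hA.1]
    congr 1
    ext i
    exact mul_inv_cancel₀ (hA.eigenvalues_pos i).ne'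
  rw [freeField, h, multivariateGaussian_specMat hA.1
    (fun i => inv_nonneg.2 (hA.eigenvalues_pos i).le), diagGaussian]
  simp_rw [Real.sqrt_inv]

theorem model_eq_weighted (V₀ : EuclideanSpace ℝ ι → ℝ) : model A V₀ =
    weighted hA.1.eigenvectorBasis hA.1.eigenvalues fun x => Real.exp (-V₀ x) := by
  rw [model, freeField_eq_diagGaussian hA]
  rfl

theorem toEuclideanCLM_exp (c : ℝ) : toEuclideanCLM (𝕜 := ℝ) (NormedSpace.exp (c • A)) =
    diagOp hA.1.eigenvectorBasis fun i => Real.exp (c * hA.1.eigenvalues i) := by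
  rw [exp_smul_eq_specMat hA.1, toEuclideanCLM_specMat]

theorem lintegral_ouLaw {t : ℝ} (ht : 0 ≤ t) (μ : Measure (EuclideanSpace ℝ ι)) [SFinite μ]
    {g : EuclideanSpace ℝ ι → ℝ≥0∞} (hg : Measurable g) : ∫⁻ x, g x ∂(ouLaw A t μ) =
      ∫⁻ y, ∫⁻ x, g x ∂(ouKernel hA.1.eigenvectorBasis hA.1.eigenvalues t y) ∂μ := by
  rw [ouLaw, multivariateGaussian_ouCovariance hA ht, toEuclideanCLM_exp hA,
    Measure.lintegral_conv hg]
  have h1 : ∀ η : Measure (EuclideanSpace ℝ ι), SFinite η →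
      Measurable fun x => ∫⁻ y, g (x + y) ∂η := fun η _ =>
    Measurable.lintegral_prod_right' (f := fun p : _ × _ => g (p.1 + p.2)) (by fun_prop)
  rw [lintegral_map (h1 _ inferInstance) (by fun_prop)]
  refine lintegral_congr fun y => ?_
  rw [lintegral_map (by fun_prop) (by fun_prop), ouKernel, lintegral_map hg (by fun_prop)]

theorem ouLaw_dirac {t : ℝ} (ht : 0 ≤ t) (x : EuclideanSpace ℝ ι) :
    ouLaw A t (Measure.dirac x) = ouKernel hA.1.eigenvectorBasis hA.1.eigenvalues t x := by
  ext s hs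
  rw [← lintegral_indicator_one hs, lintegral_ouLaw hA ht _ (measurable_one.indicator hs),
    lintegral_dirac, lintegral_indicator_one hs]

omit [DecidableEq ι] in
theorem ouKernel_zero {E : Type*} [NormedAddCommGroup E] [InnerProductSpace ℝ E]
    [FiniteDimensional ℝ E] [MeasurableSpace E] [BorelSpace E] (b : OrthonormalBasis ι ℝ E)
    (a : ι → ℝ) (x : E) : ouKernel b a 0 x = Measure.dirac x := by
  have h1 : ouDev a 0 = fun _ => 0 := by ext i; simp [ouDev]
  have h2 : diagOp b (fun _ : ι => (0 : ℝ)) = 0 := by ext x; simp [diagOp_apply]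
  have h3 : (fun i => Real.exp (-0 * a i)) = fun _ => 1 := by ext i; simp
  rw [ouKernel, h1, h2, h3]
  simp [diagOp_one]

variable {V₀ : EuclideanSpace ℝ ι → ℝ}

/-- Reversibility: averaging the transition laws over `ν` and exchanging the two variables of the
symmetric kernel turns the law at time `t` into a Gaussian density. At `t = 0` there is no kernel
and the transition law is a Dirac mass. -/
theorem ouLaw_model [IsFiniteMeasure (model A V₀)] {t : ℝ} (ht : 0 ≤ t) : ouLaw A t (model A V₀) =
    (diagGaussian hA.1.eigenvectorBasis hA.1.eigenvalues).withDensity fun x => ENNReal.ofReal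
      (semi hA.1.eigenvectorBasis hA.1.eigenvalues (fun x => Real.exp (-V₀ x)) t x) := by
  have hfin : IsFiniteMeasure (weighted hA.1.eigenvectorBasis hA.1.eigenvalues
      fun x => Real.exp (-V₀ x)) := by
    rw [← model_eq_weighted hA]
    infer_instance
  ext s hs
  rw [← lintegral_indicator_one hs, lintegral_ouLaw hA ht _ (measurable_one.indicator hs)]
  rcases ht.eq_or_lt with rfl | ht
  · simp only [ouKernel_zero, lintegral_dirac]
    simp only [lintegral_indicator_one hs, model_eq_weighted hA, weighted, semi, lt_irrefl,
      if_false]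
  · rw [model_eq_weighted hA, lintegral_ouKernel _ hA.eigenvalues_pos _ ht
      (measurable_one.indicator hs), withDensity_apply _ hs, ← lintegral_indicator hs]
    refine lintegral_congr fun x => ?_
    by_cases hx : x ∈ s <;> simp [hx, semi, ht]

theorem ouMean_eq_semi (hV₀ : ContDiff ℝ ∞ V₀) {t : ℝ} (ht : 0 ≤ t) (x : EuclideanSpace ℝ ι) :
    ouMean hA.1.eigenvectorBasis hA.1.eigenvalues (fun x => Real.exp (-V₀ x)) t x =
      semi hA.1.eigenvectorBasis hA.1.eigenvalues (fun x => Real.exp (-V₀ x)) t x := by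
  have hc : Continuous (fun x => Real.exp (-V₀ x)) := by have := hV₀.continuous; fun_prop
  rcases ht.eq_or_lt with rfl | ht
  · rw [ouMean_zero, semi, if_neg (lt_irrefl _)]
  · rw [semi, if_pos ht, weighted,
      ouMean_eq_mehlerInt _ hA.eigenvalues_pos hc (fun x => (Real.exp_pos _).le) ht]

theorem drivingPotential_eq (hV₀ : ContDiff ℝ ∞ V₀) {t : ℝ} (ht : 0 ≤ t) :
    drivingPotential A V₀ t = fun x => Real.log
      (semi hA.1.eigenvectorBasis hA.1.eigenvalues (fun x => Real.exp (-V₀ x)) t x) := by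
  have hc : Continuous (fun x => Real.exp (-V₀ x)) := by have := hV₀.continuous; fun_prop
  ext x
  rw [drivingPotential, ouSemigroup, ouLaw_dirac hA ht, ← ouMean_eq_integral _ _ hc,
    ouMean_eq_semi hA hV₀ ht]

/-- The Ornstein–Uhlenbeck process started at `x` is, at time `t`, Gaussian with mean `e^{-tA} x`
and covariance `C_{2t}`, so both sides are logarithms of the same average. -/
theorem renormalizedPotential_two_mul (hV₀ : ContDiff ℝ ∞ V₀) {t : ℝ} (ht : 0 ≤ t)
    (x : EuclideanSpace ℝ ι) :
    renormalizedPotential A V₀ (2 * t)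
        (diagOp hA.1.eigenvectorBasis (fun i => Real.exp (-t * hA.1.eigenvalues i)) x) =
      -Real.log (semi hA.1.eigenvectorBasis hA.1.eigenvalues (fun x => Real.exp (-V₀ x)) t x) := by
  have hc : Continuous V₀ := hV₀.continuous
  rw [renormalizedPotential, C_two_mul_eq_ouCovariance hA, multivariateGaussian_ouCovariance hA ht,
    integral_map (by fun_prop) (by fun_prop), ← ouMean_eq_semi hA hV₀ ht]
  rfl

variable (hV₀ : ContDiff ℝ ∞ V₀) [IsProbabilityMeasure (model A V₀)]
include hV₀

theorem gradient_drivingPotential {t : ℝ} (ht : 0 ≤ t) (x : EuclideanSpace ℝ ι) :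
    -gradient (drivingPotential A V₀ t) x =
      vel hA.1.eigenvectorBasis hA.1.eigenvalues (fun x => Real.exp (-V₀ x)) t x := by
  have hfin : IsProbabilityMeasure (weighted hA.1.eigenvectorBasis hA.1.eigenvalues
      fun x => Real.exp (-V₀ x)) := by
    rw [← model_eq_weighted hA]
    infer_instance
  have hF : ContDiff ℝ ∞ (fun x => Real.exp (-V₀ x)) := by fun_prop
  rw [drivingPotential_eq hA hV₀ ht, vel]
  congr 1
  refine HasGradientAt.gradient ?_
  rw [hasGradientAt_iff_hasFDerivAt]
  refine ((hasFDerivAt_semi _ hA.eigenvalues_pos hF t x).log (semi_pos _ hA.eigenvalues_pos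
    (fun x => Real.exp_pos _) t x).ne').congr_fderiv ?_
  ext w
  simp

theorem isLangevinFlow_iff_isFlow {S : ℝ → EuclideanSpace ℝ ι → EuclideanSpace ℝ ι} :
    IsLangevinFlow A V₀ S ↔
      IsFlow (vel hA.1.eigenvectorBasis hA.1.eigenvalues (fun x => Real.exp (-V₀ x))) S := by
  refine ⟨fun h => ⟨h.initial, fun x t ht => ?_⟩, fun h => ⟨h.initial, fun x t ht => ?_⟩⟩
  · rw [← gradient_drivingPotential hA hV₀ ht]
    exact h.hasDeriv x t ht
  · rw [gradient_drivingPotential hA hV₀ ht]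
    exact h.hasDeriv x t ht

end Bridge

/-! ### The multiscale criterion as a lower bound on the derivative of the velocity -/

section Criterion

open Set Metric Module
open scoped NNReal RealInnerProductSpace ENNReal

variable {ι : Type*} [Fintype ι] [DecidableEq ι]

theorem inner_toEuclideanCLM_hessian (f : EuclideanSpace ℝ ι → ℝ) (φ u v : EuclideanSpace ℝ ι) :
    ⟪u, toEuclideanCLM (𝕜 := ℝ) (hessian f φ) v⟫ = fderiv ℝ (fderiv ℝ f) φ u v := by
  have h : ∀ w : EuclideanSpace ℝ ι, w = ∑ i, w i • EuclideanSpace.single i (1 : ℝ) := fun w => by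
    simpa using ((EuclideanSpace.basisFun ι ℝ).sum_repr w).symm
  rw [inner_toEuclideanCLM]
  conv_rhs => rw [h u, h v]
  simp only [map_sum, map_smul, _root_.sum_apply, _root_.smul_apply, smul_eq_mul, dotProduct,
    mulVec, hessian, Matrix.of_apply, iteratedFDeriv_two_apply, Finset.mul_sum]
  rw [Finset.sum_comm]
  refine Finset.sum_congr rfl fun i _ => Finset.sum_congr rfl fun j _ => ?_
  simp
  ring

variable {A : Matrix ι ι ℝ} (hA : A.PosDef) {V₀ : EuclideanSpace ℝ ι → ℝ}
  (hV₀ : ContDiff ℝ ∞ V₀) [IsProbabilityMeasure (model A V₀)]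
include hV₀

/-- With `D = e^{-tA} = Q_{2t}`, the identity `u_t = -V_{2t} ∘ D` and the chain rule give `Dv_t(x) =
D ∇²V_{2t}(D x) D`. The criterion at time `2t`, at the point `D x`, bounds exactly this operator. -/
theorem velDeriv_ge_of_multiscaleBakryEmery {lam : ℝ → ℝ} (hBE : MultiscaleBakryEmery A V₀ lam)
    {t : ℝ} (ht : 0 ≤ t) (x w : EuclideanSpace ℝ ι) : lam (2 * t) * ‖w‖ ^ 2 ≤
      ⟪velDeriv hA.1.eigenvectorBasis hA.1.eigenvalues (fun x => Real.exp (-V₀ x)) t x w, w⟫ := by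
  have hfin : IsProbabilityMeasure (weighted hA.1.eigenvectorBasis hA.1.eigenvalues
      fun x => Real.exp (-V₀ x)) := by
    rw [← model_eq_weighted hA]
    infer_instance
  have hF : ContDiff ℝ ∞ fun x => Real.exp (-V₀ x) := by fun_prop
  have hv := regularField_vel hA.1.eigenvectorBasis hA.eigenvalues_pos hF fun x => Real.exp_pos _
  set b := hA.1.eigenvectorBasis
  set a := hA.1.eigenvalues
  have ha : ∀ i, 0 < a i := hA.eigenvalues_pos
  set F : EuclideanSpace ℝ ι → ℝ := fun x => Real.exp (-V₀ x)
  set D := diagOp b fun i => Real.exp (-t * a i) with hD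
  set D' := diagOp b fun i => (Real.exp (-t * a i))⁻¹ with hD'
  have hne : ∀ i, Real.exp (-t * a i) ≠ 0 := fun i => (Real.exp_pos _).ne'
  have hD'D : ∀ y, D' (D y) = y := fun y => diagOp_inv_cancel' b hne y
  have hDD' : ∀ y, D (D' y) = y := fun y => diagOp_inv_cancel b hne y
  have hQ : toEuclideanCLM (𝕜 := ℝ) (Q A (2 * t)) = D := by
    rw [Q, mul_div_cancel_left₀ t two_ne_zero, toEuclideanCLM_exp hA]
  set f := renormalizedPotential A V₀ (2 * t)
  -- As `D` is invertible, the renormalized potential is written through `semi`, whose derivatives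
  -- are known. No further differentiation under a Gaussian integral is needed.
  have hf : f = fun y => -Real.log (semi b a F t (D' y)) := by
    ext y
    rw [← renormalizedPotential_two_mul hA hV₀ ht (D' y)]
    exact congrArg f (hDD' y).symm
  have hf1 : fderiv ℝ f = fun y => (innerSL ℝ (vel b a F t (D' y))).comp D' := by
    ext1 y
    have h1 := (hasFDerivAt_semi b ha hF t (D' y)).log (semi_pos b ha
      (fun x => Real.exp_pos _) t (D' y)).ne'
    have h2 : HasFDerivAt f _ y := hf ▸ (h1.comp y D'.hasFDerivAt).fun_neg
    rw [h2.fderiv]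
    ext z
    simp [vel]
  have hf2 : fderiv ℝ (fderiv ℝ f) (D x) (D w) (D w) = ⟪velDeriv b a F t x w, w⟫ := by
    have h1 : HasFDerivAt (fun y => vel b a F t (D' y)) (velDeriv b a F t x ∘L D') (D x) := by
      have h2 := hv.hasFDerivAt t ht (D' (D x))
      have h3 := h2.comp (D x) D'.hasFDerivAt
      rwa [hD'D] at h3
    have h4 := ((ContinuousLinearMap.compL ℝ _ _ ℝ).flip D' ∘L innerSL ℝ).hasFDerivAt.comp (D x) h1
    rw [hf1]
    change fderiv ℝ (((ContinuousLinearMap.compL ℝ _ _ ℝ).flip D' ∘L innerSL ℝ) ∘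
      fun y => vel b a F t (D' y)) (D x) (D w) (D w) = _
    rw [h4.fderiv]
    simp [hD'D]
    rfl
  have hpsd := (hBE (2 * t) (by linarith) (D x)).dotProduct_mulVec_nonneg w
  rw [star_trivial, ← inner_toEuclideanCLM, map_sub, map_mul, map_mul, hQ, map_smul,
    map_one] at hpsd
  change 0 ≤ ⟪w, D (toEuclideanCLM (𝕜 := ℝ) (hessian f (D x)) (D w)) - lam (2 * t) • w⟫ at hpsd
  rw [inner_sub_right, inner_smul_right] at hpsd
  have hsymm : ∀ u v : EuclideanSpace ℝ ι, ⟪u, D v⟫ = ⟪D u, v⟫ := fun u v => by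
    rw [real_inner_comm, inner_diagOp_left, inner_diagOp_left]
    exact Finset.sum_congr rfl fun i _ => by ring
  rw [hsymm, inner_toEuclideanCLM_hessian, hf2, real_inner_self_eq_norm_sq] at hpsd
  linarith

end Criterion

/-! ### Positivity of the free-field matrix and conclusion -/

theorem posDef_freeFieldMatrix (d N : ℕ) [NeZero N] {ε m : ℝ} (hε : 0 < ε) (hm : 0 < m) :
    (freeFieldMatrix d N ε m).PosDef := by
  classical
  rw [freeFieldMatrix, discreteLaplacian, neg_neg]
  have h1 := ((neighbourGraph d N).posSemidef_lapMatrix ℝ).smul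
    (inv_nonneg.2 (sq_nonneg ε))
  exact (PosDef.posSemidef_add h1 (PosDef.one.smul hm)).smul (pow_pos hε d)

end LangevinTransport

open LangevinTransport
theorem theorem2p2 (d N : ℕ) [NeZero N] (ε m : ℝ) (hε : 0 < ε) (hm : 0 < m)
    (A : Matrix (TorusLattice d N) (TorusLattice d N) ℝ) (hA : A = freeFieldMatrix d N ε m)
    (V₀ : EuclideanSpace ℝ (TorusLattice d N) → ℝ) (hV₀ : ContDiff ℝ ∞ V₀)
    (hν : IsProbabilityMeasure (model A V₀))
    (lam : ℝ → ℝ) (hBE : MultiscaleBakryEmery A V₀ lam)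
    (hlam : ∀ t : ℝ, 0 ≤ t → IntervalIntegrable lam volume 0 t) :
    ∃ S T : ℝ → EuclideanSpace ℝ (TorusLattice d N) → EuclideanSpace ℝ (TorusLattice d N),
      IsLangevinFlow A V₀ S ∧
      (∀ S', IsLangevinFlow A V₀ S' → ∀ t : ℝ, 0 ≤ t → S' t = S t) ∧
      (∀ t : ℝ, 0 ≤ t →
        Function.LeftInverse (T t) (S t) ∧ Function.RightInverse (T t) (S t) ∧
        ContDiff ℝ 1 (S t) ∧ ContDiff ℝ 1 (T t) ∧
        (ouLaw A t (model A V₀)).map (T t) = model A V₀ ∧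
        LipschitzWith (Real.exp (-(∫ s in (0 : ℝ)..(2 * t), lam s) / 2)).toNNReal (T t)) ∧
      (IntegrableOn lam (Set.Ioi 0) →
        ∃ Tlim : EuclideanSpace ℝ (TorusLattice d N) → EuclideanSpace ℝ (TorusLattice d N),
          (∀ φ, Tendsto (fun t => T t φ) atTop (𝓝 (Tlim φ))) ∧
          (freeField A).map Tlim = model A V₀ ∧
          LipschitzWith (Real.exp (-(∫ s in Set.Ioi (0 : ℝ), lam s) / 2)).toNNReal Tlim) := by
  have hpos : A.PosDef := hA ▸ posDef_freeFieldMatrix d N hε hm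
  have hF : ContDiff ℝ ∞ fun x => Real.exp (-V₀ x) := by fun_prop
  have hw := model_eq_weighted hpos V₀
  have hfin : IsProbabilityMeasure (weighted hpos.1.eigenvectorBasis hpos.1.eigenvalues
      fun x => Real.exp (-V₀ x)) := hw ▸ hν
  have hF0 : ∀ x, 0 < Real.exp (-V₀ x) := fun x => Real.exp_pos _
  obtain ⟨S, T, hS, hT, hlim⟩ := exists_transport hpos.1.eigenvectorBasis hpos.eigenvalues_pos hF
    hF0 (fun t ht => velDeriv_ge_of_multiscaleBakryEmery hpos hV₀ hBE ht) hlam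
  refine ⟨S, T, (isLangevinFlow_iff_isFlow hpos hV₀).2 hS, fun S' hS' t ht =>
    hS.unique (regularField_vel _ hpos.eigenvalues_pos hF hF0)
      ((isLangevinFlow_iff_isFlow hpos hV₀).1 hS') ht, fun t ht => ?_, fun hint => ?_⟩
  · rw [ouLaw_model hpos ht, hw]
    exact hT t ht
  · rw [freeField_eq_diagGaussian hpos, hw]
    exact hlim hint
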